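/- **Setting.** For integers $d, N \ge 1$ let $E = (\mathbb Z/N\mathbb Z)^d \times \mathbb Z$ with its nearest-neighbour graph structure, and let $\pi_E : \mathbb Z^{d+1} \to E$ be the canonical projection. For $j \in \mathbb Z$ set $$B_j = (\mathbb Z/N\mathbb Z)^d \times [(j-1)N, (j+1)N], \qquad \widetilde B_j = (\mathbb Z/N\mathbb Z)^d \times [(j-2)N+1, (j+2)N-1],$$ $$C_j = (\mathbb Z/N\mathbb Z)^d \times \big([(j-\tfrac34)N, (j+\tfrac34)N] \cap \mathbb Z\big).$$ Let $P$ (with expectation $E[\cdot]$) be the law of simple random walk $(X_n)_{n \ge 0}$ on $E$ with $X_0$ uniformly distributed on $B_0$. Let $H_x = \inf\{n \ge 0 : X_n = x\}$. Let $D^j_0 = 0$ and, for $k \ge 0$, let $R^j_{k+1} = \inf\{n \ge D^j_k : X_n \in B_j\}$ and $D^j_{k+1} = \inf\{n \ge R^j_{k+1} : X_n \notin \widetilde B_j\}$; for real $t \ge 0$ put $D^j_t = D^j_{[t]}$. For $m \ge 1$ let $\mathcal A^j_m$ be the collection of non-empty sets $A \subseteq C_j$ that are contained in $\pi_E\big(y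 + \sum_{i \in I} \mathbb Z e_i\big)$ for some $y \in \mathbb Z^{d+1}$ and some $I \subseteq \{1, \dots, d+1\}$ with $|I| = m$, where $(e_i)$ is the canonical basis. Finally let $q(\nu)$ be the probability that simple random walk on $\mathbb Z^\nu$ started at the origin returns to the origin at some time $n \ge 1$. **Theorem 1.2.** Let $d \ge 3$. There is a constant $c > 0$ depending only on $d$ such that the following holds for all integers $1 \le m \le d-2$ and all $\lambda > 0$ with $$\chi(\lambda) := e^\lambda \Big( \frac{m}{d+1} + \Big(1 - \frac{m}{d+1}\Big) q(d+1-m) \Big) < 1 .$$ For every $u > 0$, $$\limsup_{N \to \infty} \ \sup_{j \in \mathbb Z,\, A \in \mathcal A^j_m} |A|^{-1} \log E\Big[ e^{\lambda \sum_{x \in A} 1\{H_x \le D^j_{uN^{d-1}}\}} \Big] \le c\, u\, \frac{e^\lambda - 1}{1 - \chi(\lambda)} ,$$ and there exist $N_1 = N_1(d,m,\lambda) > 0$ and $u_1 = u_1(d,m,\lambda) > 0$ such that for all $N \ge N_1$, $$P\big[ X_{[0, D^j_{u_1 N^{d-1}}]} \supseteq A \big] \le e^{-\lambda |A|} \quad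 \text{for all } j \in \mathbb Z \text{ and } A \in \mathcal A^j_m .$$ -/

import Mathlib

open MeasureTheory ProbabilityTheory Filter

namespace CylinderWalk

/-! ### Random walks, entrance and hitting times -/

/-- The law on path space of the random walk on a group `G` with initial distribution `μ` whose
increments are independent and uniformly distributed on the set `S` of allowed steps. If `S` is the
set of neighbours of the origin in a translation invariant graph on `G`, this is the law of simple
random walk on that graph. -/
noncomputable def walkLaw {G : Type*} [AddCommGroup G] [MeasurableSpace G]
    (μ : Measure G) (S : Set G) : Measure (ℕ → G) :=
  (μ.prod (Measure.infinitePi fun _ : ℕ => uniformOn S)).map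
    fun p n => p.1 + ∑ k ∈ Finset.range n, p.2 k

/-- `inf {n ≥ t : ω n ∈ U}`, with value `⊤` if there is no such `n`, in particular if `t = ⊤`.
For `t = 0` this is the entrance time `H_U`, for `t = 1` the hitting time of `U`; in general it
is `H_U ∘ θ_t + t`. With `Uᶜ` in place of `U` it is `T_U ∘ θ_t + t`, `T_U` the exit time. -/
noncomputable def entranceFrom {G : Type*} (U : Set G) (t : ℕ∞) (ω : ℕ → G) : ℕ∞ :=
  ⨅ (n : ℕ) (_ : t ≤ (n : ℕ∞) ∧ ω n ∈ U), (n : ℕ∞)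

/-- The vectors of `ℤ^ν` of Euclidean norm one, i.e. the neighbours of the origin. -/
def unitVectors (ν : ℕ) : Set (Fin ν → ℤ) := {s | ∑ i, |s i| = 1}

/-- `q(ν)`: the probability that simple random walk on `ℤ^ν` started at the origin returns to the
origin at some time `n ≥ 1`. -/
noncomputable def returnProb (ν : ℕ) : ℝ :=
  (walkLaw (Measure.dirac (0 : Fin ν → ℤ)) (unitVectors ν)).real
    {ω | entranceFrom {0} 1 ω < ⊤}

/-! ### The discrete cylinder -/

/-- The discrete cylinder `E = (ℤ/Nℤ)^d × ℤ`. -/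
abbrev Cylinder (d N : ℕ) : Type := (Fin d → ZMod N) × ℤ

/-- The canonical projection `π_E` of `ℤ^(d+1)` onto the cylinder. -/
def proj (d N : ℕ) (x : Fin (d + 1) → ℤ) : Cylinder d N :=
  (fun i => (x i.castSucc : ZMod N), x (Fin.last d))

/-- The neighbours of the origin in the cylinder, i.e. its points at distance one. -/
def steps (d N : ℕ) : Set (Cylinder d N) := proj d N '' unitVectors (d + 1) \ {0}

/-- `B_j = (ℤ/Nℤ)^d × [(j - 1) N, (j + 1) N]`. -/
def innerBlock (d N : ℕ) (j : ℤ) : Set (Cylinder d N) :=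
  {x | (j - 1) * N ≤ x.2 ∧ x.2 ≤ (j + 1) * N}

/-- `B̃_j = (ℤ/Nℤ)^d × [(j - 2) N + 1, (j + 2) N - 1]`. -/
def outerBlock (d N : ℕ) (j : ℤ) : Set (Cylinder d N) :=
  {x | (j - 2) * N + 1 ≤ x.2 ∧ x.2 ≤ (j + 2) * N - 1}

/-- `C_j = (ℤ/Nℤ)^d × ([(j - 3/4) N, (j + 3/4) N] ∩ ℤ)`. -/
def block (d N : ℕ) (j : ℤ) : Set (Cylinder d N) :=
  {x | ((j : ℝ) - 3 / 4) * N ≤ (x.2 : ℝ) ∧ (x.2 : ℝ) ≤ ((j : ℝ) + 3 / 4) * N}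

/-- The law `P` of simple random walk on the cylinder whose starting point is uniformly distributed
on `B_0`. -/
noncomputable def cylLaw (d N : ℕ) : Measure (ℕ → Cylinder d N) :=
  walkLaw (uniformOn (innerBlock d N 0)) (steps d N)

/-- The successive departures `D^j_k`: `D^j_0 = 0`, and `D^j_(k+1)` is the first exit from `B̃_j`
after the return time `R^j_(k+1)`, which is the first visit to `B_j` from time `D^j_k` on. -/
noncomputable def departure (d N : ℕ) (j : ℤ) : ℕ → (ℕ → Cylinder d N) → ℕ∞
  | 0, _ => 0
  | k + 1, ω =>
      entranceFrom (outerBlock d N j)ᶜ (entranceFrom (innerBlock d N j) (departure d N j k ω) ω) ω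

/-- `ℒ_m`: the images under `π_E` of the affine lattices `y + ∑_{i ∈ I} ℤ e_i` with `|I| = m`. -/
def latticeSections (d N m : ℕ) : Set (Set (Cylinder d N)) :=
  {F | ∃ (I : Finset (Fin (d + 1))) (y : Fin (d + 1) → ℤ), I.card = m ∧
    F = proj d N '' {x | ∀ i, i ∉ I → x i = y i}}

/-- `𝒜^j_m`: the non-empty subsets of `C_j` contained in some element of `ℒ_m`
(they are finite as soon as `N ≥ 1`). -/
def admissible (d N m : ℕ) (j : ℤ) : Set (Finset (Cylinder d N)) :=
  {A | A.Nonempty ∧ (A : Set (Cylinder d N)) ⊆ block d N j ∧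
    ∃ F ∈ latticeSections d N m, (A : Set (Cylinder d N)) ⊆ F}

open Classical in
/-- `∑_{x ∈ A} 1{H_x ≤ D^j_t}`, with `D^j_t = D^j_[t]` for real `t ≥ 0`: the number of points of `A`
visited by time `D^j_t`. -/
noncomputable def visited (d N : ℕ) (j : ℤ) (A : Finset (Cylinder d N)) (t : ℝ)
    (ω : ℕ → Cylinder d N) : ℝ :=
  ∑ x ∈ A, if entranceFrom {x} 0 ω ≤ departure d N j ⌊t⌋₊ ω then 1 else 0

/-- The event `X_[0, D^j_t] ⊇ A`. -/
def coversBy (d N : ℕ) (j : ℤ) (A : Finset (Cylinder d N)) (t : ℝ) :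
    Set (ℕ → Cylinder d N) :=
  {ω | ∀ x ∈ A, ∃ n : ℕ, (n : ℕ∞) ≤ departure d N j ⌊t⌋₊ ω ∧ ω n = x}

/-- `χ(λ) = e^λ (m/(d+1) + (1 - m/(d+1)) q(d+1-m))`. -/
noncomputable def chi (d m : ℕ) (lam : ℝ) : ℝ :=
  Real.exp lam * ((m : ℝ) / (d + 1) + (1 - (m : ℝ) / (d + 1)) * returnProb (d + 1 - m))

end CylinderWalk

/-! The number of points of `A` seen by time `D^j_k` is at most the number of visits to `A` counted
with multiplicity, and exponential moments of the latter are governed by two numbers, ρ and η.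

Suppose that from each point of `A` the chance to return to `A` before leaving `B̃_j` is at most ρ,
with `e^λ ρ < 1`. Then γ = (e^λ - 1)/(1 - e^λ ρ) solves e^λ (1 + γρ) = 1 + γ, so 1 + γ h(z), with h
the probability to hit `A` before leaving `B̃_j`, dominates the mean of e^(λ · visits) over one
excursion. If h ≤ η at each entrance into `B_j`, every further excursion costs a factor 1 + γη
(`lintegral_visitWeight_le`).

The number ρ: returning to `A` implies returning to the lattice section F containing it. In ℤ^(d+1)
a step either stays in the section, with probability m/(d+1), or moves the transverse coordinates,
which perform a lazy walk on ℤ^(d+1-m). This gives the return probability `sectionReturn`, and e^λ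
times it is χ(λ). The cylinder adds only ε for large N (`exists_nbrAvg_hitProb_le`): up to a fixed
time M the walk does not wrap around; between M and K N² the expected number of visits is small by a
heat kernel bound of order n^(-3/2) + N^(-3) for three transverse coordinates, which exist since m ≤
d - 2; after K N² steps the walk has probably left `B̃_j`.

The number η: entrances into `B_j` occur at vertical distance at least N/4 from `C_j`. An explicit
superharmonic function with a unit source at the origin, `greenFun`, is there of order N^(1-d), so η
is of order |A| N^(1-d) (`hitProb_le_of_far`). A walk started in `B_j` may be close to `A`, but the
average of h over the uniform starting point has the same order (`sum_hitProb_le`). Hence u N^(d-1)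
excursions give a moment of at most exp(c u γ |A|).

The covering estimate is Markov's inequality for some λ' > λ with χ(λ') < 1 and u so small that the
moment is at most e^((λ' - λ)|A|). -/

namespace CylinderWalk

/-! ### The Markov property of the random walk -/

/-- The path that starts in `z` and then follows `ω`. -/
def prepend {G : Type*} (z : G) (ω : ℕ → G) : ℕ → G
  | 0 => z
  | n + 1 => ω n

@[simp] lemma prepend_zero {G : Type*} (z : G) (ω : ℕ → G) : prepend z ω 0 = z := rfl

@[simp] lemma prepend_succ {G : Type*} (z : G) (ω : ℕ → G) (n : ℕ) :
    prepend z ω (n + 1) = ω n := rfl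

lemma measurable_prepend {G : Type*} [MeasurableSpace G] :
    Measurable fun p : G × (ℕ → G) => prepend p.1 p.2 := by
  refine measurable_pi_lambda _ fun n => ?_
  cases n with
  | zero => exact measurable_fst
  | succ n => exact (measurable_pi_apply n).comp measurable_snd

/-- An i.i.d. sequence stays i.i.d. when an independent entry of the same law is put in front. It
suffices to compare finite-dimensional boxes; the index set is enlarged to an initial segment so
that coordinate 0 splits off. -/
lemma map_prepend_infinitePi {G : Type*} [MeasurableSpace G] (ν : Measure G)
    [IsProbabilityMeasure ν] :
    (ν.prod (Measure.infinitePi fun _ : ℕ => ν)).map (fun p => prepend p.1 p.2) =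
      Measure.infinitePi fun _ : ℕ => ν := by
  classical
  refine Measure.eq_infinitePi _ fun s t ht => ?_
  obtain ⟨n, hn⟩ : ∃ n, s ⊆ Finset.range (n + 1) :=
    ⟨s.sup id, fun i hi => Finset.mem_range.2 (Nat.lt_succ_of_le (Finset.le_sup (f := id) hi))⟩
  set t' : ℕ → Set G := fun i => if i ∈ s then t i else Set.univ with ht'
  have hmeas : ∀ i, MeasurableSet (t' i) := by
    intro i
    simp only [ht']
    split_ifs
    exacts [ht i, MeasurableSet.univ]
  have h1 : (s : Set ℕ).pi t = ((Finset.range (n + 1) : Finset ℕ) : Set ℕ).pi t' := by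
    ext x
    simp only [Set.mem_pi, Finset.mem_coe, ht']
    constructor
    · intro h i _
      split_ifs with his
      exacts [h i his, Set.mem_univ _]
    · intro h i his
      simpa [his] using h i (hn his)
  have h2 : ∏ i ∈ s, ν (t i) = ∏ i ∈ Finset.range (n + 1), ν (t' i) := by
    rw [← Finset.prod_subset hn]
    · exact Finset.prod_congr rfl fun i hi => by simp [ht', hi]
    · intro i _ hi
      simp [ht', hi]
  have h3 : (fun p : G × (ℕ → G) => prepend p.1 p.2) ⁻¹'
      ((Finset.range (n + 1) : Finset ℕ) : Set ℕ).pi t' =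
      t' 0 ×ˢ ((Finset.range n : Finset ℕ) : Set ℕ).pi fun i => t' (i + 1) := by
    ext p
    simp only [Set.mem_preimage, Set.mem_pi, Finset.mem_coe, Finset.mem_range, Set.mem_prod]
    constructor
    · intro h
      exact ⟨h 0 (by omega), fun i hi => h (i + 1) (by omega)⟩
    · rintro ⟨h0, h⟩ i hi
      cases i with
      | zero => exact h0
      | succ i => exact h i (by omega)
  rw [h1, h2, Measure.map_apply measurable_prepend
    (MeasurableSet.pi (Finset.countable_toSet _) fun i _ => hmeas i), h3, Measure.prod_prod,
    Measure.infinitePi_pi _ (fun i _ => hmeas (i + 1)), Finset.prod_range_succ', mul_comm]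

section Law

variable {G : Type*} [AddCommGroup G] [MeasurableSpace G] [MeasurableAdd₂ G]

lemma measurable_walkPath :
    Measurable fun p : G × (ℕ → G) => fun n : ℕ => p.1 + ∑ k ∈ Finset.range n, p.2 k := by
  refine measurable_pi_lambda _ fun n => measurable_fst.add ?_
  exact Finset.measurable_sum _ fun k _ => (measurable_pi_apply k).comp measurable_snd

lemma lintegral_walkLaw (μ : Measure G) (S : Set G) [IsProbabilityMeasure (uniformOn S)]
    {f : (ℕ → G) → ENNReal} (hf : Measurable f) :
    ∫⁻ ω, f ω ∂walkLaw μ S = ∫⁻ z, ∫⁻ ω, f ω ∂walkLaw (Measure.dirac z) S ∂μ := by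
  have h : ∀ μ' : Measure G, ∫⁻ ω, f ω ∂walkLaw μ' S = ∫⁻ z, ∫⁻ ξ,
      f (fun n => z + ∑ k ∈ Finset.range n, ξ k)
        ∂(Measure.infinitePi fun _ : ℕ => uniformOn S) ∂μ' := by
    intro μ'
    rw [walkLaw, lintegral_map hf measurable_walkPath, lintegral_prod]
    exact (hf.comp measurable_walkPath).aemeasurable
  rw [h]
  refine lintegral_congr fun z => ?_
  rw [h, lintegral_dirac']
  exact (hf.comp measurable_walkPath).lintegral_prod_right'

instance isProbabilityMeasure_walkLaw (μ : Measure G) [IsProbabilityMeasure μ] (S : Set G)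
    [IsProbabilityMeasure (uniformOn S)] : IsProbabilityMeasure (walkLaw μ S) :=
  Measure.isProbabilityMeasure_map measurable_walkPath.aemeasurable

/-- The Markov property of the walk at time one. -/
lemma lintegral_walkLaw_dirac (z : G) (S : Set G) [IsProbabilityMeasure (uniformOn S)]
    {f : (ℕ → G) → ENNReal} (hf : Measurable f) :
    ∫⁻ ω, f ω ∂walkLaw (Measure.dirac z) S =
      ∫⁻ s, ∫⁻ ω, f (prepend z ω) ∂walkLaw (Measure.dirac (z + s)) S ∂uniformOn S := by
  have h : ∀ (x : G) {g : (ℕ → G) → ENNReal}, Measurable g →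
      ∫⁻ ω, g ω ∂walkLaw (Measure.dirac x) S = ∫⁻ ξ,
        g (fun n => x + ∑ k ∈ Finset.range n, ξ k)
          ∂(Measure.infinitePi fun _ : ℕ => uniformOn S) := by
    intro x g hg
    rw [walkLaw, lintegral_map hg measurable_walkPath, lintegral_prod, lintegral_dirac']
    · exact (hg.comp measurable_walkPath).lintegral_prod_right'
    · exact (hg.comp measurable_walkPath).aemeasurable
  have hpath : Measurable fun ξ : ℕ → G => fun n : ℕ => z + ∑ k ∈ Finset.range n, ξ k :=
    measurable_walkPath.comp (measurable_const.prodMk measurable_id)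
  have hpre : Measurable fun ω : ℕ → G => prepend z ω :=
    measurable_prepend.comp (measurable_const.prodMk measurable_id)
  rw [h z hf]
  conv_lhs => rw [← map_prepend_infinitePi]
  refine (lintegral_map (hf.comp hpath) measurable_prepend).trans ?_
  rw [lintegral_prod]
  · refine lintegral_congr fun s => ?_
    refine Eq.trans ?_ (h (z + s) (hf.comp hpre)).symm
    refine lintegral_congr fun ξ => congrArg f ?_
    funext n
    cases n with
    | zero => simp
    | succ n =>
      change z + ∑ k ∈ Finset.range (n + 1), prepend s ξ k = z + s + ∑ k ∈ Finset.range n, ξ k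
      rw [Finset.sum_range_succ']
      simp only [prepend_zero, prepend_succ]
      abel
  · exact ((hf.comp hpath).comp measurable_prepend).aemeasurable

end Law

/-! ### Averages over neighbours -/

/-- The mean of `f` over the points `z + E i` and `z - E i`. -/
noncomputable def nbrAvg {G ι : Type*} [AddCommGroup G] [Fintype ι] (E : ι → G) (f : G → ℝ)
    (z : G) : ℝ :=
  (∑ i, (f (z + E i) + f (z - E i))) / (2 * Fintype.card ι)

/-- `S` consists of the pairwise distinct elements `E i` and `-E i`. -/
structure IsStepSet {G ι : Type*} [AddCommGroup G] (S : Set G) (E : ι → G) : Prop where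
  eq_union : S = Set.range E ∪ Set.range fun i => -E i
  injective : Function.Injective E
  ne_neg : ∀ i k, E i ≠ -E k

lemma ofReal_nbrAvg {G ι : Type*} [AddCommGroup G] [Fintype ι] [Nonempty ι] {E : ι → G} {φ : G → ℝ} (hφ : ∀ x, 0 ≤ φ x) (z : G) :
    ENNReal.ofReal (nbrAvg E φ z) =
      (∑ i, (ENNReal.ofReal (φ (z + E i)) + ENNReal.ofReal (φ (z - E i)))) /
          (2 * Fintype.card ι : ℕ) := by
  have hpos : 0 < Fintype.card ι := Fintype.card_pos
  rw [nbrAvg, ENNReal.ofReal_div_of_pos (by positivity), ENNReal.ofReal_sum_of_nonneg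
    fun i _ => add_nonneg (hφ _) (hφ _)]
  congr 1
  · exact Finset.sum_congr rfl fun i _ => ENNReal.ofReal_add (hφ _) (hφ _)
  · rw [← ENNReal.ofReal_natCast]
    push_cast
    rfl

lemma lintegral_uniformOn_finset {G : Type*} [MeasurableSpace G] [MeasurableSingletonClass G]
    (s : Finset G) (f : G → ENNReal) :
    ∫⁻ x, f x ∂uniformOn (s : Set G) = (∑ x ∈ s, f x) / s.card := by
  rw [uniformOn, ProbabilityTheory.cond, lintegral_smul_measure, Measure.count_apply_finset,
    smul_eq_mul, ENNReal.div_eq_inv_mul, lintegral_finset]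
  simp

namespace IsStepSet

variable {G ι : Type*} [AddCommGroup G] [Fintype ι] {S : Set G} {E : ι → G}

lemma eq_coe [DecidableEq G] (h : IsStepSet S E) :
    S = ((Finset.univ.image E ∪ Finset.univ.image fun i => -E i : Finset G) : Set G) := by
  simp [h.eq_union]

lemma disjoint [DecidableEq G] (h : IsStepSet S E) :
    Disjoint (Finset.univ.image E) (Finset.univ.image fun i => -E i) := by
  rw [Finset.disjoint_left]
  intro x hx hx'
  obtain ⟨i, -, rfl⟩ := Finset.mem_image.1 hx
  obtain ⟨k, -, hk⟩ := Finset.mem_image.1 hx'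
  exact h.ne_neg i k hk.symm

variable [MeasurableSpace G] [MeasurableSingletonClass G]

lemma isProbabilityMeasure [Nonempty ι] (h : IsStepSet S E) :
    IsProbabilityMeasure (uniformOn S) := by
  classical
  rw [h.eq_coe]
  refine isProbabilityMeasure_uniformOn (Finset.finite_toSet _) ?_
  exact ⟨E (Classical.arbitrary ι), by simp⟩

lemma lintegral_uniformOn (h : IsStepSet S E) (f : G → ENNReal) :
    ∫⁻ s, f s ∂uniformOn S = (∑ i, (f (E i) + f (-E i))) / (2 * Fintype.card ι : ℕ) := by
  classical
  have hneg : Function.Injective fun i => -E i := fun i k hik => h.injective (neg_injective hik)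
  rw [h.eq_coe, lintegral_uniformOn_finset, Finset.sum_union h.disjoint,
    Finset.card_union_of_disjoint h.disjoint, Finset.card_image_of_injective _ h.injective,
    Finset.card_image_of_injective _ hneg, Finset.sum_image fun i _ k _ hik => h.injective hik,
    Finset.sum_image fun i _ k _ hik => hneg hik, Finset.sum_add_distrib, Finset.card_univ,
    two_mul]

variable [Nonempty ι]

lemma lintegral_walkLaw [MeasurableAdd₂ G] (h : IsStepSet S E) (z : G) {f : (ℕ → G) → ENNReal} (hf : Measurable f) :
    ∫⁻ ω, f ω ∂walkLaw (Measure.dirac z) S =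
      (∑ i, (∫⁻ ω, f (prepend z ω) ∂walkLaw (Measure.dirac (z + E i)) S +
        ∫⁻ ω, f (prepend z ω) ∂walkLaw (Measure.dirac (z - E i)) S)) /
          (2 * Fintype.card ι : ℕ) := by
  have := h.isProbabilityMeasure
  rw [lintegral_walkLaw_dirac z S hf, h.lintegral_uniformOn]
  simp [sub_eq_add_neg]

/-- The induction step for upper bounds: an estimate after the first step, for every position
reached, becomes an estimate by the neighbour average. The next lemma does the same for lower
bounds. They link path-space integrals to the recursively defined functions below. -/
lemma lintegral_walkLaw_le [MeasurableAdd₂ G] (h : IsStepSet S E) (z : G) {f : (ℕ → G) → ENNReal}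
    (hf : Measurable f) {φ : G → ℝ} (hφ : ∀ x, 0 ≤ φ x)
    (hle : ∀ x, ∫⁻ ω, f (prepend z ω) ∂walkLaw (Measure.dirac x) S ≤ ENNReal.ofReal (φ x)) :
    ∫⁻ ω, f ω ∂walkLaw (Measure.dirac z) S ≤ ENNReal.ofReal (nbrAvg E φ z) := by
  rw [h.lintegral_walkLaw z hf, ofReal_nbrAvg hφ]
  gcongr
  exacts [hle _, hle _]

lemma le_lintegral_walkLaw [MeasurableAdd₂ G] (h : IsStepSet S E) (z : G) {f : (ℕ → G) → ENNReal}
    (hf : Measurable f) {φ : G → ℝ} (hφ : ∀ x, 0 ≤ φ x)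
    (hle : ∀ x, ENNReal.ofReal (φ x) ≤ ∫⁻ ω, f (prepend z ω) ∂walkLaw (Measure.dirac x) S) :
    ENNReal.ofReal (nbrAvg E φ z) ≤ ∫⁻ ω, f ω ∂walkLaw (Measure.dirac z) S := by
  rw [h.lintegral_walkLaw z hf, ofReal_nbrAvg hφ]
  gcongr
  exacts [hle _, hle _]

end IsStepSet

/-! ### Unit vectors -/

/-- The projection of the `i`-th vector of the canonical basis. -/
def cylVec (d N : ℕ) (i : Fin (d + 1)) : Cylinder d N := proj d N (Pi.single i 1)

lemma mem_unitVectors_iff {ν : ℕ} {s : Fin ν → ℤ} :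
    s ∈ unitVectors ν ↔ ∃ i, s = Pi.single i 1 ∨ s = -Pi.single i 1 := by
  constructor
  · intro h
    have h1 : ∑ i, |s i| = 1 := h
    obtain ⟨i, hi⟩ : ∃ i, s i ≠ 0 := by
      by_contra! hc
      simp [hc] at h1
    have h2 : |s i| + ∑ k ∈ Finset.univ.erase i, |s k| = 1 := by
      rw [Finset.add_sum_erase _ (fun k => |s k|) (Finset.mem_univ i), h1]
    have h3 : 0 ≤ ∑ k ∈ Finset.univ.erase i, |s k| := Finset.sum_nonneg fun _ _ => abs_nonneg _
    have h4 : 1 ≤ |s i| := Int.one_le_abs hi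
    have h5 : ∑ k ∈ Finset.univ.erase i, |s k| = 0 := by omega
    have h6 : ∀ k, k ≠ i → s k = 0 := fun k hk => by
      have := (Finset.sum_eq_zero_iff_of_nonneg fun _ _ => abs_nonneg _).1 h5 k (by simp [hk])
      simpa using this
    have h7 : |s i| = 1 := by omega
    refine ⟨i, ?_⟩
    rcases (abs_eq (by norm_num)).1 h7 with h8 | h8
    · left
      funext k
      by_cases hk : k = i
      · subst hk; simp [h8]
      · simp [h6 k hk, hk]
    · right
      funext k
      by_cases hk : k = i
      · subst hk; simp [h8]
      · simp [h6 k hk, hk]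
  · rintro ⟨i, rfl | rfl⟩
    · simp [unitVectors, Pi.single_apply, apply_ite abs]
    · simp [unitVectors, Pi.single_apply, apply_ite abs]

lemma isStepSet_unitVectors (ν : ℕ) :
    IsStepSet (unitVectors ν) fun i : Fin ν => (Pi.single i 1 : Fin ν → ℤ) where
  eq_union := by
    ext s
    simp only [mem_unitVectors_iff, Set.mem_union, Set.mem_range, exists_or, eq_comm]
  injective := fun i k h => by
    by_contra hik
    have := congrFun h i
    simp [hik] at this
  ne_neg := fun i k h => by
    have := congrFun h i
    by_cases hik : i = k
    · subst hik; simp at this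
    · simp [hik] at this

lemma proj_add (d N : ℕ) (x y : Fin (d + 1) → ℤ) :
    proj d N (x + y) = proj d N x + proj d N y := by
  ext <;> simp [proj]

lemma proj_neg (d N : ℕ) (x : Fin (d + 1) → ℤ) : proj d N (-x) = -proj d N x := by
  ext <;> simp [proj]

lemma proj_sub (d N : ℕ) (x y : Fin (d + 1) → ℤ) :
    proj d N (x - y) = proj d N x - proj d N y := by
  rw [sub_eq_add_neg, proj_add, proj_neg, sub_eq_add_neg]

lemma cylVec_last (d N : ℕ) : cylVec d N (Fin.last d) = (0, 1) := by
  ext i <;> simp [cylVec, proj, (Fin.castSucc_lt_last _).ne]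

lemma cylVec_castSucc (d N : ℕ) (i : Fin d) :
    cylVec d N i.castSucc = (Pi.single i 1, 0) := by
  ext k
  · by_cases h : k = i <;> simp [cylVec, proj, Pi.single_apply, h]
  · simp [cylVec, proj, Pi.single_apply, (Fin.castSucc_lt_last _).ne']

lemma abs_snd_add_cylVec_le {d N : ℕ} (z : Cylinder d N) (i : Fin (d + 1)) :
    |(z + cylVec d N i).2 - z.2| ≤ 1 ∧ |(z - cylVec d N i).2 - z.2| ≤ 1 := by
  refine Fin.lastCases ?_ (fun i => ?_) i
  · simp [cylVec_last]
  · simp [cylVec_castSucc]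

/-- The assumption 3 ≤ N excludes N = 2, where a horizontal step equals its negative, and N = 1,
where it vanishes. In both cases the uniform law on the set of neighbours is not the average over
signed basis vectors. -/
lemma isStepSet_steps (d : ℕ) {N : ℕ} (hN : 3 ≤ N) : IsStepSet (steps d N) (cylVec d N) := by
  have : Fact (1 < N) := ⟨by omega⟩
  have h10 : (1 : ZMod N) ≠ 0 := one_ne_zero
  have h11 : (1 : ZMod N) ≠ -1 := by
    intro h
    have h2 : ((2 : ℕ) : ZMod N) = 0 := by
      push_cast
      linear_combination h
    have := Nat.le_of_dvd (by norm_num) ((ZMod.natCast_eq_zero_iff 2 N).1 h2)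
    omega
  have hne0 : ∀ i, cylVec d N i ≠ 0 := by
    intro i
    refine Fin.lastCases ?_ (fun i => ?_) i
    · rw [cylVec_last]
      simp [Prod.ext_iff]
    · rw [cylVec_castSucc]
      simp [Prod.ext_iff]
  refine ⟨?_, ?_, ?_⟩
  · ext z
    simp only [steps, Set.mem_sdiff, Set.mem_image, mem_unitVectors_iff, Set.mem_singleton_iff,
      Set.mem_union, Set.mem_range]
    constructor
    · rintro ⟨⟨s, ⟨i, rfl | rfl⟩, rfl⟩, -⟩
      · exact Or.inl ⟨i, rfl⟩
      · exact Or.inr ⟨i, (proj_neg d N _).symm⟩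
    · rintro (⟨i, rfl⟩ | ⟨i, rfl⟩)
      · exact ⟨⟨_, ⟨i, Or.inl rfl⟩, rfl⟩, hne0 i⟩
      · exact ⟨⟨_, ⟨i, Or.inr rfl⟩, proj_neg d N _⟩, neg_ne_zero.2 (hne0 i)⟩
  · intro i k h
    revert h
    refine Fin.lastCases ?_ (fun i => ?_) i <;> refine Fin.lastCases ?_ (fun k => ?_) k
    · simp
    · rw [cylVec_last, cylVec_castSucc]
      simp [Prod.ext_iff]
    · rw [cylVec_last, cylVec_castSucc]
      simp [Prod.ext_iff]
    · rw [cylVec_castSucc, cylVec_castSucc]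
      intro h
      by_contra hik
      have hik' : i ≠ k := fun h => hik (by rw [h])
      have := congrFun (congrArg Prod.fst h) i
      simp [hik'] at this
  · intro i k
    refine Fin.lastCases ?_ (fun i => ?_) i <;> refine Fin.lastCases ?_ (fun k => ?_) k
    · rw [cylVec_last]
      simp [Prod.ext_iff]
    · rw [cylVec_last, cylVec_castSucc]
      simp [Prod.ext_iff]
    · rw [cylVec_last, cylVec_castSucc]
      simp [Prod.ext_iff]
    · rw [cylVec_castSucc, cylVec_castSucc]
      intro h
      have := congrFun (congrArg Prod.fst h) i
      by_cases hik : i = k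
      · subst hik
        simp only [Pi.single_eq_same, Prod.fst_neg, Pi.neg_apply] at this
        exact h11 this
      · simp [hik] at this

/-! ### Linearity, monotonicity and iteration of the averaging operator. -/

section Average

variable {G ι : Type*} [AddCommGroup G] [Fintype ι] {E : ι → G} {f g : G → ℝ} {z : G}

lemma nbrAvg_le_nbrAvg (h : ∀ i, f (z + E i) ≤ g (z + E i) ∧ f (z - E i) ≤ g (z - E i)) :
    nbrAvg E f z ≤ nbrAvg E g z := by
  unfold nbrAvg
  gcongr with i
  exacts [(h i).1, (h i).2]

lemma nbrAvg_mono (h : ∀ x, f x ≤ g x) : nbrAvg E f z ≤ nbrAvg E g z :=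
  nbrAvg_le_nbrAvg fun _ => ⟨h _, h _⟩

lemma nbrAvg_nonneg (h : ∀ x, 0 ≤ f x) : 0 ≤ nbrAvg E f z :=
  div_nonneg (Finset.sum_nonneg fun _ _ => add_nonneg (h _) (h _)) (by positivity)

lemma nbrAvg_add : nbrAvg E (fun x => f x + g x) z = nbrAvg E f z + nbrAvg E g z := by
  simp only [nbrAvg, ← add_div, ← Finset.sum_add_distrib]
  congr 1
  exact Finset.sum_congr rfl fun _ _ => by ring

lemma nbrAvg_const_mul (c : ℝ) : nbrAvg E (fun x => c * f x) z = c * nbrAvg E f z := by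
  simp only [nbrAvg, ← mul_add, ← Finset.mul_sum]
  ring

lemma nbrAvg_const [Nonempty ι] (c : ℝ) : nbrAvg E (fun _ => c) z = c := by
  have : (0 : ℝ) < Fintype.card ι := by exact_mod_cast Fintype.card_pos
  simp only [nbrAvg, Finset.sum_const, Finset.card_univ, nsmul_eq_mul]
  field_simp
  ring

lemma nbrAvg_sum {κ : Type*} (s : Finset κ) (F : κ → G → ℝ) :
    nbrAvg E (fun x => ∑ k ∈ s, F k x) z = ∑ k ∈ s, nbrAvg E (F k) z := by
  simp only [nbrAvg, ← Finset.sum_add_distrib, ← Finset.sum_div]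
  rw [Finset.sum_comm]

lemma nbrAvg_le_of_forall [Nonempty ι] {c : ℝ}
    (h : ∀ i, f (z + E i) ≤ c ∧ f (z - E i) ≤ c) : nbrAvg E f z ≤ c :=
  (nbrAvg_le_nbrAvg (g := fun _ => c) h).trans_eq (nbrAvg_const c)

lemma iterate_nbrAvg_mono (h : ∀ x, f x ≤ g x) (n : ℕ) (z : G) :
    (nbrAvg E)^[n] f z ≤ (nbrAvg E)^[n] g z := by
  induction n generalizing z with
  | zero => exact h z
  | succ n ih =>
    rw [Function.iterate_succ_apply', Function.iterate_succ_apply']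
    exact nbrAvg_mono ih

lemma iterate_nbrAvg_const [Nonempty ι] (c : ℝ) (n : ℕ) (z : G) :
    (nbrAvg E)^[n] (fun _ => c) z = c := by
  induction n generalizing z with
  | zero => rfl
  | succ n ih =>
    rw [Function.iterate_succ_apply', funext ih, nbrAvg_const]

lemma iterate_nbrAvg_add (n : ℕ) (z : G) :
    (nbrAvg E)^[n] (fun x => f x + g x) z = (nbrAvg E)^[n] f z + (nbrAvg E)^[n] g z := by
  induction n generalizing z with
  | zero => rfl
  | succ n ih =>
    simp only [Function.iterate_succ_apply']
    rw [funext ih, nbrAvg_add]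

lemma iterate_nbrAvg_sum {κ : Type*} (s : Finset κ) (F : κ → G → ℝ) (n : ℕ) (z : G) :
    (nbrAvg E)^[n] (fun x => ∑ k ∈ s, F k x) z = ∑ k ∈ s, (nbrAvg E)^[n] (F k) z := by
  induction n generalizing z with
  | zero => rfl
  | succ n ih =>
    simp only [Function.iterate_succ_apply']
    rw [funext ih, nbrAvg_sum]

lemma iterate_nbrAvg_of_eigen {r : ℝ} (h : ∀ x, nbrAvg E f x = r * f x) (n : ℕ) (z : G) :
    (nbrAvg E)^[n] f z = r ^ n * f z := by
  induction n generalizing z with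
  | zero => simp
  | succ n ih =>
    rw [Function.iterate_succ_apply', funext ih, nbrAvg_const_mul, h]
    ring

end Average

/-! ### Hitting and survival probabilities -/

lemma indicator_one_nonneg {G : Type*} {F : Set G} (z : G) :
    0 ≤ F.indicator (fun _ => (1 : ℝ)) z :=
  Set.indicator_nonneg (fun _ _ => zero_le_one) z

section Hitting

variable {G ι : Type*} [AddCommGroup G] [Fintype ι] (E : ι → G) (D F : Set G)

open Classical in
/-- The probability that the walk started in `z` visits `F` within `n` steps, before it leaves `D`. -/
noncomputable def hitProb : ℕ → G → ℝ
  | 0, z => if z ∈ D ∧ z ∈ F then 1 else 0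
  | n + 1, z => if z ∈ D then if z ∈ F then 1 else nbrAvg E (hitProb n) z else 0

open Classical in
/-- The probability that the walk started in `z` does not leave `D` within `n` steps. -/
noncomputable def survProb : ℕ → G → ℝ
  | 0, z => if z ∈ D then 1 else 0
  | n + 1, z => if z ∈ D then nbrAvg E (survProb n) z else 0

variable {E D F}

lemma hitProb_of_mem (n : ℕ) {z : G} (hD : z ∈ D) (hF : z ∈ F) : hitProb E D F n z = 1 := by
  cases n <;> simp [hitProb, hD, hF]

lemma hitProb_of_notMem (n : ℕ) {z : G} (hD : z ∉ D) : hitProb E D F n z = 0 := by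
  cases n <;> simp [hitProb, hD]

lemma hitProb_succ (n : ℕ) {z : G} (hD : z ∈ D) (hF : z ∉ F) :
    hitProb E D F (n + 1) z = nbrAvg E (hitProb E D F n) z := by
  simp [hitProb, hD, hF]

lemma hitProb_nonneg (n : ℕ) (z : G) : 0 ≤ hitProb E D F n z := by
  induction n generalizing z with
  | zero => simp only [hitProb]; split_ifs <;> norm_num
  | succ n ih =>
    simp only [hitProb]
    split_ifs
    exacts [zero_le_one, nbrAvg_nonneg ih, le_rfl]

lemma hitProb_le_one [Nonempty ι] (n : ℕ) (z : G) : hitProb E D F n z ≤ 1 := by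
  induction n generalizing z with
  | zero => simp only [hitProb]; split_ifs <;> norm_num
  | succ n ih =>
    simp only [hitProb]
    split_ifs
    exacts [le_rfl, nbrAvg_le_of_forall fun i => ⟨ih _, ih _⟩, zero_le_one]

lemma hitProb_mono_set [Nonempty ι] {F' : Set G} (h : F ⊆ F') (n : ℕ) (z : G) :
    hitProb E D F n z ≤ hitProb E D F' n z := by
  induction n generalizing z with
  | zero =>
    by_cases hz : z ∈ D ∧ z ∈ F
    · rw [hitProb_of_mem _ hz.1 hz.2, hitProb_of_mem _ hz.1 (h hz.2)]
    · simpa [hitProb, hz] using hitProb_nonneg (E := E) (D := D) (F := F') 0 z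
  | succ n ih =>
    by_cases hD : z ∈ D
    · by_cases hF' : z ∈ F'
      · rw [hitProb_of_mem _ hD hF']
        exact hitProb_le_one _ _
      · rw [hitProb_succ n hD hF', hitProb_succ n hD fun hF => hF' (h hF)]
        exact nbrAvg_mono ih
    · rw [hitProb_of_notMem _ hD, hitProb_of_notMem _ hD]

lemma hitProb_le_succ (n : ℕ) (z : G) : hitProb E D F n z ≤ hitProb E D F (n + 1) z := by
  induction n generalizing z with
  | zero =>
    by_cases hz : z ∈ D ∧ z ∈ F
    · rw [hitProb_of_mem _ hz.1 hz.2, hitProb_of_mem _ hz.1 hz.2]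
    · simpa [hitProb, hz] using hitProb_nonneg (E := E) (D := D) (F := F) 1 z
  | succ n ih =>
    by_cases hD : z ∈ D
    · by_cases hF : z ∈ F
      · rw [hitProb_of_mem _ hD hF, hitProb_of_mem _ hD hF]
      · rw [hitProb_succ n hD hF, hitProb_succ _ hD hF]
        exact nbrAvg_mono ih
    · rw [hitProb_of_notMem _ hD, hitProb_of_notMem _ hD]

/-- A superharmonic function dominates the hitting probabilities. -/
lemma hitProb_le_of_superharmonic {U : Set G} {φ : G → ℝ}
    (hstep : ∀ z ∈ D, ∀ i, z + E i ∈ U ∧ z - E i ∈ U) (h0 : ∀ z ∈ U, 0 ≤ φ z)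
    (h1 : ∀ z ∈ D, z ∈ F → 1 ≤ φ z) (h2 : ∀ z ∈ D, nbrAvg E φ z ≤ φ z) (n : ℕ) {z : G}
    (hz : z ∈ U) : hitProb E D F n z ≤ φ z := by
  induction n generalizing z with
  | zero =>
    by_cases hzF : z ∈ D ∧ z ∈ F
    · rw [hitProb_of_mem _ hzF.1 hzF.2]
      exact h1 z hzF.1 hzF.2
    · simpa [hitProb, hzF] using h0 z hz
  | succ n ih =>
    by_cases hD : z ∈ D
    · by_cases hF : z ∈ F
      · rw [hitProb_of_mem _ hD hF]
        exact h1 z hD hF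
      · rw [hitProb_succ n hD hF]
        exact (nbrAvg_le_nbrAvg fun i => ⟨ih (hstep z hD i).1, ih (hstep z hD i).2⟩).trans (h2 z hD)
    · rw [hitProb_of_notMem _ hD]
      exact h0 z hz

lemma survProb_of_notMem (n : ℕ) {z : G} (hD : z ∉ D) : survProb E D n z = 0 := by
  cases n <;> simp [survProb, hD]

lemma survProb_nonneg (n : ℕ) (z : G) : 0 ≤ survProb E D n z := by
  induction n generalizing z with
  | zero => simp only [survProb]; split_ifs <;> norm_num
  | succ n ih =>
    simp only [survProb]
    split_ifs
    exacts [nbrAvg_nonneg ih, le_rfl]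

lemma survProb_le_one [Nonempty ι] (n : ℕ) (z : G) : survProb E D n z ≤ 1 := by
  induction n generalizing z with
  | zero => simp only [survProb]; split_ifs <;> norm_num
  | succ n ih =>
    simp only [survProb]
    split_ifs
    exacts [nbrAvg_le_of_forall fun i => ⟨ih _, ih _⟩, zero_le_one]

/-- A function decreasing by one along the walk bounds the expected exit time. -/
lemma mul_survProb_le [Nonempty ι] {U : Set G} {φ : G → ℝ}
    (hstep : ∀ z ∈ D, ∀ i, z + E i ∈ U ∧ z - E i ∈ U) (h0 : ∀ z ∈ U, 0 ≤ φ z)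
    (h1 : ∀ z ∈ D, nbrAvg E φ z + 1 ≤ φ z) (n : ℕ) {z : G} (hz : z ∈ U) :
    n * survProb E D n z ≤ φ z := by
  induction n generalizing z with
  | zero => simpa using h0 z hz
  | succ n ih =>
    by_cases hD : z ∈ D
    · have h2 : survProb E D (n + 1) z = nbrAvg E (survProb E D n) z := by simp [survProb, hD]
      have h3 : n * nbrAvg E (survProb E D n) z ≤ nbrAvg E φ z := by
        rw [← nbrAvg_const_mul]
        exact nbrAvg_le_nbrAvg fun i => ⟨ih (hstep z hD i).1, ih (hstep z hD i).2⟩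
      have h4 := survProb_le_one (E := E) (D := D) (n + 1) z
      have h5 := h1 z hD
      push_cast
      rw [h2] at *
      linarith
    · rw [survProb_of_notMem _ hD]
      simpa using h0 z hz

lemma iterate_nbrAvg_nonneg {f : G → ℝ} (h : ∀ x, 0 ≤ f x) (n : ℕ) (z : G) :
    0 ≤ (nbrAvg E)^[n] f z := by
  induction n generalizing z with
  | zero => exact h z
  | succ n ih =>
    rw [Function.iterate_succ_apply']
    exact nbrAvg_nonneg ih

/-- A visit to `F` before the exit from `D` happens at one of the first `L` times, or the walk stays
in `D` for `L` steps. -/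
lemma hitProb_le_sum_add_survProb [Nonempty ι] (L n : ℕ) (z : G) :
    hitProb E D F n z ≤
      ∑ k ∈ Finset.range L, (nbrAvg E)^[k] (F.indicator fun _ => (1 : ℝ)) z +
        survProb E D L z := by
  induction L generalizing n z with
  | zero =>
    by_cases hD : z ∈ D
    · simpa [survProb, hD] using hitProb_le_one n z
    · simp [hitProb_of_notMem _ hD, survProb, hD]
  | succ L ih =>
    have hsum : 0 ≤ ∑ k ∈ Finset.range L,
        (nbrAvg E)^[k + 1] (F.indicator fun _ => (1 : ℝ)) z :=
      Finset.sum_nonneg fun k _ => iterate_nbrAvg_nonneg indicator_one_nonneg _ _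
    have hsurv := survProb_nonneg (E := E) (D := D) (L + 1) z
    rw [Finset.sum_range_succ', Function.iterate_zero_apply]
    by_cases hF : z ∈ F
    · have := hitProb_le_one (E := E) (D := D) (F := F) n z
      simp only [Set.indicator_of_mem hF]
      linarith
    · simp only [Set.indicator_of_notMem hF]
      by_cases hD : z ∈ D
      · cases n with
        | zero =>
          simp only [hitProb, hF, and_false, if_false]
          linarith
        | succ n =>
          rw [hitProb_succ n hD hF]
          refine (nbrAvg_mono (ih n)).trans ?_
          rw [nbrAvg_add, nbrAvg_sum]
          simp only [Function.iterate_succ_apply', survProb, hD, if_true]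
          linarith
      · rw [hitProb_of_notMem _ hD]
        linarith

/-- A visit to `F` happens within `M` steps or after them. -/
lemma hitProb_le_hitProb_univ_add [Nonempty ι] {g : G → ℝ} (hg0 : ∀ x, 0 ≤ g x)
    (hg : ∀ n x, hitProb E D F n x ≤ g x) (M n : ℕ) (z : G) :
    hitProb E D F n z ≤ hitProb E Set.univ F M z + (nbrAvg E)^[M + 1] g z := by
  induction M generalizing n z with
  | zero =>
    have h1 : 0 ≤ nbrAvg E g z := nbrAvg_nonneg hg0
    rw [zero_add, Function.iterate_one]
    by_cases hF : z ∈ F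
    · rw [hitProb_of_mem _ (Set.mem_univ z) hF]
      linarith [hitProb_le_one (E := E) (D := D) (F := F) n z]
    · have h2 := hitProb_nonneg (E := E) (D := Set.univ) (F := F) 0 z
      by_cases hD : z ∈ D
      · cases n with
        | zero =>
          simp only [hitProb, hF, and_false, if_false]
          linarith
        | succ n =>
          rw [hitProb_succ n hD hF]
          linarith [nbrAvg_mono (E := E) (z := z) (hg n)]
      · rw [hitProb_of_notMem _ hD]
        linarith
  | succ M ih =>
    have h1 : 0 ≤ (nbrAvg E)^[M + 2] g z := iterate_nbrAvg_nonneg hg0 _ _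
    by_cases hF : z ∈ F
    · rw [hitProb_of_mem _ (Set.mem_univ z) hF]
      linarith [hitProb_le_one (E := E) (D := D) (F := F) n z]
    · have h2 := hitProb_nonneg (E := E) (D := Set.univ) (F := F) (M + 1) z
      by_cases hD : z ∈ D
      · cases n with
        | zero =>
          have h3 : hitProb E D F 0 z = 0 := by simp [hitProb, hF]
          linarith
        | succ n =>
          rw [hitProb_succ n hD hF, hitProb_succ M (Set.mem_univ z) hF,
            Function.iterate_succ_apply']
          refine (nbrAvg_mono (ih n)).trans ?_
          rw [nbrAvg_add]
      · rw [hitProb_of_notMem _ hD]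
        linarith

end Hitting

/-! ### The return probability on `ℤ^ν` -/

/-- The basis vectors of `ℤ^ν`. -/
def intVec (ν : ℕ) (i : Fin ν) : Fin ν → ℤ := Pi.single i 1

lemma entranceFrom_lt_top_iff {G : Type*} {U : Set G} {t : ℕ∞} {ω : ℕ → G} :
    entranceFrom U t ω < ⊤ ↔ ∃ n : ℕ, t ≤ n ∧ ω n ∈ U := by
  simp only [entranceFrom, iInf_lt_iff, exists_prop]
  exact ⟨fun ⟨n, h, _⟩ => ⟨n, h⟩, fun ⟨n, h⟩ => ⟨n, h, ENat.natCast_lt_top n⟩⟩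

lemma measurableSet_exists_apply_eq {G : Type*} [MeasurableSpace G] [MeasurableSingletonClass G]
    (x : G) : MeasurableSet {ω : ℕ → G | ∃ n, ω n = x} := by
  simp only [Set.ofPred_exists]
  exact MeasurableSet.iUnion fun n => measurable_pi_apply (X := fun _ => G) n (measurableSet_singleton x)

/-- Only this inequality is needed: the recursive quantities have to be bounded above by the return
probability, uniformly in the number of steps. -/
lemma hitProb_le_walkLaw {ν : ℕ} (hν : 0 < ν) (k : ℕ) (z : Fin ν → ℤ) :
    ENNReal.ofReal (hitProb (intVec ν) Set.univ {0} k z) ≤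
      walkLaw (Measure.dirac z) (unitVectors ν) {ω | ∃ n, ω n = 0} := by
  have : Nonempty (Fin ν) := ⟨⟨0, hν⟩⟩
  have hstep := isStepSet_unitVectors ν
  have := hstep.isProbabilityMeasure
  have hmeas := measurableSet_exists_apply_eq (0 : Fin ν → ℤ)
  have hind : Measurable ({ω : ℕ → Fin ν → ℤ | ∃ n, ω n = 0}.indicator fun _ => (1 : ENNReal)) :=
    measurable_const.indicator hmeas
  have hint : ∀ z : Fin ν → ℤ, walkLaw (Measure.dirac z) (unitVectors ν) {ω | ∃ n, ω n = 0} =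
      ∫⁻ ω, {ω : ℕ → Fin ν → ℤ | ∃ n, ω n = 0}.indicator (fun _ => (1 : ENNReal)) ω
        ∂walkLaw (Measure.dirac z) (unitVectors ν) := fun z => by
    rw [lintegral_indicator_const hmeas, one_mul]
  have hstart : ∀ k, ENNReal.ofReal (hitProb (intVec ν) Set.univ {0} k 0) ≤
      walkLaw (Measure.dirac 0) (unitVectors ν) {ω | ∃ n, ω n = 0} := by
    intro k
    rw [hitProb_of_mem k (Set.mem_univ _) (Set.mem_singleton _), hint, hstep.lintegral_walkLaw 0 hind,
      ← nbrAvg_const (E := intVec ν) (z := 0) (1 : ℝ),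
      ofReal_nbrAvg fun _ => zero_le_one]
    have : ∀ ω : ℕ → Fin ν → ℤ,
        {ω : ℕ → Fin ν → ℤ | ∃ n, ω n = 0}.indicator (fun _ => (1 : ENNReal)) (prepend 0 ω) = 1 :=
      fun ω => Set.indicator_of_mem
        (show prepend 0 ω ∈ {ω : ℕ → Fin ν → ℤ | ∃ n, ω n = 0} from ⟨0, rfl⟩) _
    simp [this]
  induction k generalizing z with
  | zero =>
    by_cases hz : z = 0
    · subst hz
      exact hstart 0
    · simp [hitProb, hz]
  | succ k ih =>
    by_cases hz : z = 0
    · subst hz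
      exact hstart _
    · rw [hitProb_succ k (Set.mem_univ z) hz, hint]
      refine hstep.le_lintegral_walkLaw z hind (fun x => hitProb_nonneg k x) fun x => ?_
      refine (ih x).trans ?_
      rw [hint]
      refine lintegral_mono fun ω => ?_
      by_cases hω : ∃ n, ω n = 0
      · obtain ⟨n, hn⟩ := hω
        rw [Set.indicator_of_mem (show ω ∈ {ω : ℕ → Fin ν → ℤ | ∃ n, ω n = 0} from ⟨n, hn⟩),
          Set.indicator_of_mem
            (show prepend z ω ∈ {ω : ℕ → Fin ν → ℤ | ∃ n, ω n = 0} from ⟨n + 1, hn⟩)]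
      · rw [Set.indicator_of_notMem (show ω ∉ {ω : ℕ → Fin ν → ℤ | ∃ n, ω n = 0} from hω)]
        exact zero_le

/-- By the Markov property at time one, a return at some time n ≥ 1 is a hit of the origin by the
walk restarted after its first step. -/
lemma nbrAvg_hitProb_le_returnProb {ν : ℕ} (hν : 0 < ν) (k : ℕ) :
    nbrAvg (intVec ν) (hitProb (intVec ν) Set.univ {0} k) 0 ≤ returnProb ν := by
  have : Nonempty (Fin ν) := ⟨⟨0, hν⟩⟩
  have hstep := isStepSet_unitVectors ν
  have := hstep.isProbabilityMeasure
  have hset : {ω : ℕ → Fin ν → ℤ | entranceFrom {0} 1 ω < ⊤} = {ω | ∃ n, ω (n + 1) = 0} := by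
    ext ω
    simp only [Set.mem_ofPred_eq, entranceFrom_lt_top_iff, Set.mem_singleton_iff]
    constructor
    · rintro ⟨n, hn, h⟩
      have hn' : 1 ≤ n := by exact_mod_cast hn
      exact ⟨n - 1, by rwa [Nat.sub_add_cancel hn']⟩
    · rintro ⟨n, h⟩
      exact ⟨n + 1, by push_cast; exact le_add_self, h⟩
  have hmeas : MeasurableSet {ω : ℕ → Fin ν → ℤ | ∃ n, ω (n + 1) = 0} := by
    simp only [Set.ofPred_exists]
    exact MeasurableSet.iUnion fun n => measurable_pi_apply (n + 1) (measurableSet_singleton 0)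
  rw [returnProb, hset, Measure.real, ← ENNReal.ofReal_le_iff_le_toReal (measure_ne_top _ _),
    ← one_mul (walkLaw _ _ _), ← lintegral_indicator_const hmeas]
  refine hstep.le_lintegral_walkLaw 0 (measurable_const.indicator hmeas)
    (fun x => hitProb_nonneg k x) fun x => ?_
  refine (hitProb_le_walkLaw hν k x).trans_eq ?_
  rw [← one_mul (walkLaw _ _ _), ← lintegral_indicator_const (measurableSet_exists_apply_eq 0)]
  rfl

/-! ### Fourier analysis on the torus -/

section Torus

variable {N : ℕ} [NeZero N]

/-- `cos (2 π k / N)`. -/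
noncomputable def zcos (k : ZMod N) : ℝ := (ZMod.stdAddChar k).re

lemma zcos_eq_cos (k : ZMod N) : zcos k = Real.cos (2 * Real.pi * k.valMinAbs / N) := by
  have h : (2 * Real.pi * Complex.I * (k.valMinAbs : ℤ) / N : ℂ) =
      ((2 * Real.pi * k.valMinAbs / N : ℝ) : ℂ) * Complex.I := by
    push_cast
    ring
  rw [zcos]
  conv_lhs => rw [← ZMod.coe_valMinAbs k]
  rw [ZMod.stdAddChar_coe, h, Complex.exp_ofReal_mul_I_re]

lemma zcos_le_one (k : ZMod N) : zcos k ≤ 1 := by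
  rw [zcos_eq_cos]
  exact Real.cos_le_one _

lemma neg_one_le_zcos (k : ZMod N) : -1 ≤ zcos k := by
  rw [zcos_eq_cos]
  exact Real.neg_one_le_cos _

lemma abs_zcos_le_one (k : ZMod N) : |zcos k| ≤ 1 :=
  abs_le.2 ⟨neg_one_le_zcos k, zcos_le_one k⟩

@[simp] lemma zcos_zero : zcos (0 : ZMod N) = 1 := by simp [zcos]

lemma zcos_add_add_zcos_sub (a b : ZMod N) : zcos (a + b) + zcos (a - b) = 2 * zcos b * zcos a := by
  simp only [zcos, sub_eq_add_neg, AddChar.map_add_eq_mul, AddChar.map_neg_eq_conj,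
    Complex.mul_re, Complex.conj_re, Complex.conj_im]
  ring

/-- The bound cos θ ≤ 1 - (2/π²) θ² for |θ| ≤ π, at θ = 2πk/N; taking the representative of least
absolute value guarantees |θ| ≤ π. -/
lemma sq_valMinAbs_le_one_sub_zcos (k : ZMod N) :
    8 * (|(k.valMinAbs : ℝ)| / N) ^ 2 ≤ 1 - zcos k := by
  have hN : (0 : ℝ) < N := by exact_mod_cast Nat.pos_of_ne_zero (NeZero.ne N)
  have h1 : |(k.valMinAbs : ℝ)| ≤ N / 2 := by
    have h2 := ZMod.natAbs_valMinAbs_le k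
    have h3 : 2 * k.valMinAbs.natAbs ≤ N := by omega
    have h4 : (2 : ℝ) * (k.valMinAbs.natAbs : ℝ) ≤ N := by exact_mod_cast h3
    rw [Nat.cast_natAbs, Int.cast_abs] at h4
    linarith
  have h5 : |2 * Real.pi * k.valMinAbs / N| ≤ Real.pi := by
    rw [abs_div, abs_mul, abs_of_pos hN, abs_of_pos Real.two_pi_pos, div_le_iff₀ hN]
    nlinarith [Real.pi_pos]
  have h6 := Real.cos_le_one_sub_mul_cos_sq h5
  rw [zcos_eq_cos]
  have h7 : 2 / Real.pi ^ 2 * (2 * Real.pi * k.valMinAbs / N) ^ 2 =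
      8 * (|(k.valMinAbs : ℝ)| / N) ^ 2 := by
    have := Real.pi_pos.ne'
    rw [div_pow _ (N : ℝ), div_pow _ (N : ℝ), sq_abs]
    field_simp
    ring
  linarith

/-- Least absolute residues are distinct integers, so the sum is dominated by the two-sided
geometric series over ℤ, a bound uniform in N. -/
lemma sum_exp_valMinAbs_le {b : ℝ} (hb : 0 < b) :
    ∑ k : ZMod N, Real.exp (-(b * |(k.valMinAbs : ℝ)|)) ≤ 1 + 2 / b := by
  have hr0 : 0 < Real.exp (-b) := Real.exp_pos _
  have hr1 : Real.exp (-b) < 1 := by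
    rw [← Real.exp_zero]
    exact Real.exp_lt_exp.2 (by linarith)
  have hgeo := hasSum_geometric_of_lt_one hr0.le hr1
  have h1 : HasSum (fun n : ℕ => Real.exp (-(b * |((n : ℤ) : ℝ)|))) (1 - Real.exp (-b))⁻¹ := by
    refine hgeo.congr_fun ?_
    intro n
    rw [← Real.exp_nat_mul]
    congr 1
    rw [Int.cast_natCast, abs_of_nonneg n.cast_nonneg]
    ring
  have h2 : HasSum (fun n : ℕ => Real.exp (-(b * |((-((n : ℤ) + 1) : ℤ) : ℝ)|)))
      (Real.exp (-b) * (1 - Real.exp (-b))⁻¹) := by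
    refine (hgeo.mul_left (Real.exp (-b))).congr_fun ?_
    intro n
    rw [← Real.exp_nat_mul, ← Real.exp_add]
    congr 1
    push_cast
    rw [abs_neg, abs_of_nonneg (by positivity)]
    ring
  have h3 := HasSum.of_nat_of_neg_add_one (f := fun j : ℤ => Real.exp (-(b * |(j : ℝ)|))) h1 h2
  have h4 := sum_le_hasSum (Finset.univ.image (ZMod.valMinAbs : ZMod N → ℤ))
    (fun j _ => (Real.exp_pos _).le) h3
  rw [Finset.sum_image fun _ _ _ _ h => ZMod.injective_valMinAbs h] at h4
  refine h4.trans ?_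
  have h5 : Real.exp (-b) * (1 + b) ≤ 1 := by
    have := Real.add_one_le_exp b
    rw [Real.exp_neg, inv_mul_le_iff₀ (Real.exp_pos b)]
    linarith
  have h6 : 0 < 1 - Real.exp (-b) := by linarith
  rw [← one_add_mul, ← div_eq_mul_inv, div_le_iff₀ h6]
  have h7 : 2 * Real.exp (-b) ≤ 2 / b * (1 - Real.exp (-b)) := by
    rw [div_mul_eq_mul_div, le_div_iff₀ hb]
    linarith
  linarith

variable {ι : Type*} [Fintype ι] [DecidableEq ι]

/-- The frequencies that vanish outside of `J`. -/
def freqs (N : ℕ) [NeZero N] (J : Finset ι) : Finset (ι → ZMod N) :=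
  Fintype.piFinset fun i => if i ∈ J then Finset.univ else {0}

lemma eq_zero_of_mem_freqs {J : Finset ι} {ξ : ι → ZMod N} (hξ : ξ ∈ freqs N J) {i : ι}
    (hi : i ∉ J) : ξ i = 0 := by
  simpa [hi] using Fintype.mem_piFinset.1 hξ i

lemma freqs_univ : freqs N (Finset.univ : Finset ι) = Finset.univ := by
  simp [freqs]

lemma stdAddChar_sum {κ : Type*} (s : Finset κ) (f : κ → ZMod N) :
    ZMod.stdAddChar (∑ i ∈ s, f i) = ∏ i ∈ s, ZMod.stdAddChar (f i) := by
  classical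
  induction s using Finset.induction_on with
  | empty => simp
  | insert i s hi ih => rw [Finset.sum_insert hi, Finset.prod_insert hi, AddChar.map_add_eq_mul, ih]

/-- Orthogonality of characters, factorised over the coordinates; those outside `J` carry only the
frequency zero and contribute a factor one. -/
lemma sum_freqs_zcos (J : Finset ι) (c : ι → ZMod N) :
    ∑ ξ ∈ freqs N J, zcos (∑ i, ξ i * c i) = if ∀ i ∈ J, c i = 0 then (N : ℝ) ^ J.card else 0 := by
  have h1 : ∑ ξ ∈ freqs N J, ZMod.stdAddChar (∑ i, ξ i * c i) =
      ((if ∀ i ∈ J, c i = 0 then (N : ℝ) ^ J.card else 0 : ℝ) : ℂ) := by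
    have h2 : ∀ i, (∑ k ∈ (if i ∈ J then Finset.univ else {0}),
        (ZMod.stdAddChar (k * c i) : ℂ)) = if i ∈ J then (if c i = 0 then (N : ℂ) else 0) else 1 := by
      intro i
      by_cases hi : i ∈ J
      · simp only [hi, if_true]
        rw [AddChar.sum_mulShift _ (ZMod.isPrimitive_stdAddChar N), ZMod.card]
        split_ifs <;> simp
      · simp [hi]
    simp only [stdAddChar_sum, freqs]
    rw [← Finset.prod_univ_sum _ fun i k => (ZMod.stdAddChar (k * c i) : ℂ)]
    simp only [h2]
    rw [Finset.prod_ite_mem, Finset.univ_inter]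
    split_ifs with hc
    · rw [Finset.prod_congr rfl fun i hi => if_pos (hc i hi), Finset.prod_const]
      push_cast
      rfl
    · push Not at hc
      obtain ⟨i, hi, hci⟩ := hc
      rw [Finset.prod_eq_zero hi (if_neg hci), Complex.ofReal_zero]
  have h3 := congrArg Complex.re h1
  rw [Complex.re_sum, Complex.ofReal_re] at h3
  exact h3

lemma sum_freqs_exp_le (J : Finset ι) {b : ℝ} (hb : 0 < b) :
    ∑ ξ ∈ freqs N J, Real.exp (-(b * ∑ i, |((ξ i).valMinAbs : ℝ)|)) ≤ (1 + 2 / b) ^ J.card := by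
  have h1 : ∀ ξ : ι → ZMod N, Real.exp (-(b * ∑ i, |((ξ i).valMinAbs : ℝ)|)) =
      ∏ i, Real.exp (-(b * |((ξ i).valMinAbs : ℝ)|)) := fun ξ => by
    rw [← Real.exp_sum, Finset.mul_sum, Finset.sum_neg_distrib]
  simp only [h1, freqs]
  rw [← Finset.prod_univ_sum _ fun i k => Real.exp (-(b * |((k : ZMod N).valMinAbs : ℝ)|)),
    ← Finset.prod_const, ← Finset.prod_subset (Finset.subset_univ J)]
  · refine Finset.prod_le_prod (fun i _ => Finset.sum_nonneg fun _ _ => (Real.exp_pos _).le) ?_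
    intro i hi
    simpa [hi] using sum_exp_valMinAbs_le hb
  · intro i _ hi
    simp [hi]

end Torus

/-! ### The heat kernel -/

/-- The coordinates of a point of the cylinder modulo `N`. -/
def zCoord {d N : ℕ} (z : Cylinder d N) (i : Fin (d + 1)) : ZMod N :=
  Fin.lastCases (motive := fun _ => ZMod N) (z.2 : ZMod N) z.1 i

lemma zCoord_proj {d N : ℕ} (x : Fin (d + 1) → ℤ) (i : Fin (d + 1)) :
    zCoord (proj d N x) i = (x i : ZMod N) := by
  refine Fin.lastCases ?_ (fun i => ?_) i <;> simp [zCoord, proj]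

lemma zCoord_add {d N : ℕ} (z w : Cylinder d N) (i : Fin (d + 1)) :
    zCoord (z + w) i = zCoord z i + zCoord w i := by
  refine Fin.lastCases ?_ (fun i => ?_) i <;> simp [zCoord]

lemma zCoord_sub {d N : ℕ} (z w : Cylinder d N) (i : Fin (d + 1)) :
    zCoord (z - w) i = zCoord z i - zCoord w i := by
  refine Fin.lastCases ?_ (fun i => ?_) i <;> simp [zCoord]

section Heat

variable {d N : ℕ} [NeZero N]

lemma nbrAvg_zcos (ξ y : Fin (d + 1) → ZMod N) (z : Cylinder d N) :
    nbrAvg (cylVec d N) (fun x => zcos (∑ i, ξ i * (zCoord x i - y i))) z =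
      ((∑ i, zcos (ξ i)) / (d + 1)) * zcos (∑ i, ξ i * (zCoord z i - y i)) := by
  have hsum : ∀ k, ∑ i, ξ i * zCoord (cylVec d N k) i = ξ k := fun k => by
    simp [cylVec, zCoord_proj, Pi.single_apply]
  have h : ∀ k, zcos (∑ i, ξ i * (zCoord (z + cylVec d N k) i - y i)) +
      zcos (∑ i, ξ i * (zCoord (z - cylVec d N k) i - y i)) =
      2 * zcos (ξ k) * zcos (∑ i, ξ i * (zCoord z i - y i)) := fun k => by
    rw [← zcos_add_add_zcos_sub, ← hsum k, ← Finset.sum_add_distrib, ← Finset.sum_sub_distrib]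
    congr 2 <;> refine Finset.sum_congr rfl fun i _ => ?_
    · rw [zCoord_add]; ring
    · rw [zCoord_sub]; ring
  simp only [nbrAvg, h, ← Finset.sum_mul, ← Finset.mul_sum, Fintype.card_fin]
  push_cast
  field_simp

/-- The heat kernel bound for three coordinates of the walk. -/
lemma iterate_nbrAvg_indicator_le (hd : 3 ≤ d) {J : Finset (Fin (d + 1))} (hJ : J.card = 3)
    {F : Set (Cylinder d N)} (y : Fin (d + 1) → ZMod N) (hF : ∀ z ∈ F, ∀ i ∈ J, zCoord z i = y i)
    {n : ℕ} (hn : 0 < n) (z : Cylinder d N) :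
    (nbrAvg (cylVec d N))^[n] (F.indicator fun _ => (1 : ℝ)) z ≤
      Real.exp ((d + 1) / 4) * (1 / N + 2 * (d + 1) / √n) ^ 3 := by
  have hN : (0 : ℝ) < N := by exact_mod_cast Nat.pos_of_ne_zero (NeZero.ne N)
  have hn' : (0 : ℝ) < n := by exact_mod_cast hn
  have hd' : (3 : ℝ) ≤ d := by exact_mod_cast hd
  -- Fourier inversion: the right-hand side is the indicator that the three coordinates in `J` agree
  -- with `y`, which dominates the indicator of `F`.
  have h1 : ∀ x : Cylinder d N, F.indicator (fun _ => (1 : ℝ)) x ≤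
      ∑ ξ ∈ freqs N J, (1 / (N : ℝ) ^ 3) * zcos (∑ i, ξ i * (zCoord x i - y i)) := by
    intro x
    rw [← Finset.mul_sum, sum_freqs_zcos, hJ]
    by_cases hx : x ∈ F
    · rw [Set.indicator_of_mem hx, if_pos fun i hi => sub_eq_zero.2 (hF x hx i hi)]
      field_simp
      exact le_rfl
    · rw [Set.indicator_of_notMem hx]
      split_ifs <;> positivity
  refine (iterate_nbrAvg_mono h1 n z).trans ?_
  rw [iterate_nbrAvg_sum]
  -- With this β the square of β |ξ_i| is at most n/(4(d+1)) times 1 - cos. Then x ≤ x² + 1/4 trades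
  -- Gaussian for exponential decay, at the price of a factor e^(1/4) per coordinate, and the sum
  -- over frequencies becomes geometric.
  set β : ℝ := √(2 * n / (d + 1)) / N with hβ
  have hβ0 : 0 < β := by positivity
  have h2 : ∀ ξ ∈ freqs N J, (nbrAvg (cylVec d N))^[n]
      (fun x => (1 / (N : ℝ) ^ 3) * zcos (∑ i, ξ i * (zCoord x i - y i))) z ≤
      1 / (N : ℝ) ^ 3 * (Real.exp ((d + 1) / 4) *
        Real.exp (-(β * ∑ i, |((ξ i).valMinAbs : ℝ)|))) := by
    intro ξ hξ
    set r : ℝ := (∑ i, zcos (ξ i)) / (d + 1) with hr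
    rw [iterate_nbrAvg_of_eigen (r := r) fun x => by rw [nbrAvg_const_mul, nbrAvg_zcos]; ring]
    set t : ℝ := (∑ i, (1 - zcos (ξ i))) / (d + 1) with ht
    have hrt : r = 1 - t := by
      simp only [hr, ht, Finset.sum_sub_distrib, Finset.sum_const, Finset.card_univ,
        Fintype.card_fin]
      field_simp
      ring
    have ht0 : 0 ≤ t := div_nonneg (Finset.sum_nonneg fun i _ => sub_nonneg.2 (zcos_le_one _))
      (by positivity)
    -- The walk may be nearly periodic, so eigenvalues near -1 must be excluded. Only three of the d
    -- + 1 ≥ 4 frequencies can be non-zero, hence t ≤ 6/4, and this makes |1 - t| ≤ e^(-t/4) valid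
    -- on the negative side too.
    have ht1 : t ≤ 3 / 2 := by
      rw [ht, div_le_iff₀ (by positivity)]
      have : ∑ i, (1 - zcos (ξ i)) = ∑ i ∈ J, (1 - zcos (ξ i)) := by
        refine (Finset.sum_subset (Finset.subset_univ J) fun i _ hi => ?_).symm
        rw [eq_zero_of_mem_freqs hξ hi, zcos_zero, sub_self]
      have h3 : ∑ i ∈ J, (1 - zcos (ξ i)) ≤ ∑ i ∈ J, (2 : ℝ) :=
        Finset.sum_le_sum fun i _ => by linarith [neg_one_le_zcos (ξ i)]
      rw [Finset.sum_const, hJ, nsmul_eq_mul] at h3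
      rw [this]
      push_cast at h3
      linarith
    have hexp : |1 - t| ≤ Real.exp (-(t / 4)) := by
      have h3 := Real.add_one_le_exp (-(t / 4))
      rw [abs_le]
      constructor <;> linarith
    have hpow : |r ^ n * (1 / (N : ℝ) ^ 3 * zcos (∑ i, ξ i * (zCoord z i - y i)))| ≤
        1 / (N : ℝ) ^ 3 * Real.exp (-(n * (t / 4))) := by
      rw [abs_mul, abs_mul, abs_pow, abs_of_pos (show (0 : ℝ) < 1 / (N : ℝ) ^ 3 by positivity), hrt]
      have h4 : |1 - t| ^ n ≤ Real.exp (-(n * (t / 4))) := by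
        rw [show -(n * (t / 4)) = n * (-(t / 4)) by ring, Real.exp_nat_mul]
        gcongr
      have h5 := abs_zcos_le_one (∑ i, ξ i * (zCoord z i - y i))
      calc |1 - t| ^ n * (1 / (N : ℝ) ^ 3 * |zcos (∑ i, ξ i * (zCoord z i - y i))|)
          ≤ Real.exp (-(n * (t / 4))) * (1 / (N : ℝ) ^ 3 * 1) := by gcongr
        _ = _ := by ring
    refine (le_abs_self _).trans (hpow.trans ?_)
    gcongr
    rw [← Real.exp_add, Real.exp_le_exp]
    have h6 : ∀ i, β * |((ξ i).valMinAbs : ℝ)| ≤ n / (4 * (d + 1)) * (1 - zcos (ξ i)) + 1 / 4 := by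
      intro i
      have h7 := sq_valMinAbs_le_one_sub_zcos (ξ i)
      have h8 : (β * |((ξ i).valMinAbs : ℝ)|) ^ 2 =
          n / (4 * (d + 1)) * (8 * (|((ξ i).valMinAbs : ℝ)| / N) ^ 2) := by
        rw [hβ, mul_pow, div_pow, Real.sq_sqrt (by positivity)]
        field_simp
        ring
      have h9 : (β * |((ξ i).valMinAbs : ℝ)|) ^ 2 ≤ n / (4 * (d + 1)) * (1 - zcos (ξ i)) := by
        rw [h8]
        gcongr
      nlinarith [sq_nonneg (β * |((ξ i).valMinAbs : ℝ)| - 1 / 2)]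
    have h10 := Finset.sum_le_sum fun i (_ : i ∈ Finset.univ) => h6 i
    rw [Finset.sum_add_distrib, ← Finset.mul_sum, ← Finset.mul_sum, Finset.sum_const,
      Finset.card_univ, Fintype.card_fin, nsmul_eq_mul] at h10
    have h11 : (n : ℝ) * (t / 4) = n / (4 * (d + 1)) * ∑ i, (1 - zcos (ξ i)) := by
      rw [ht]
      field_simp
    rw [h11]
    push_cast at h10
    linarith
  refine (Finset.sum_le_sum h2).trans ?_
  rw [← Finset.mul_sum, ← Finset.mul_sum]
  have h3 := sum_freqs_exp_le (N := N) J hβ0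
  rw [hJ] at h3
  have h4 : 1 / (N : ℝ) * (1 + 2 / β) ≤ 1 / N + 2 * (d + 1) / √n := by
    have h5 : √n ≤ (d + 1) * √(2 * n / (d + 1)) := by
      refine Real.sqrt_le_iff.2 ⟨by positivity, ?_⟩
      rw [mul_pow, Real.sq_sqrt (by positivity)]
      field_simp
      nlinarith
    have h6 : 0 < √(2 * n / (d + 1 : ℝ)) := by positivity
    have h7 : 1 / (N : ℝ) * (2 / β) ≤ 2 * (d + 1) / √n := by
      have : 1 / (N : ℝ) * (2 / β) = 2 / √(2 * n / (d + 1)) := by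
        rw [hβ]
        field_simp
      rw [this, div_le_div_iff₀ h6 (by positivity)]
      linarith
    rw [mul_add, mul_one]
    linarith
  calc 1 / (N : ℝ) ^ 3 * (Real.exp ((d + 1) / 4) *
        ∑ ξ ∈ freqs N J, Real.exp (-(β * ∑ i, |((ξ i).valMinAbs : ℝ)|)))
      ≤ 1 / (N : ℝ) ^ 3 * (Real.exp ((d + 1) / 4) * (1 + 2 / β) ^ 3) := by gcongr
    _ = Real.exp ((d + 1) / 4) * (1 / (N : ℝ) * (1 + 2 / β)) ^ 3 := by ring
    _ ≤ _ := by gcongr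

end Heat

/-! ### A superharmonic function on the cylinder -/

section Green

variable {d N : ℕ} [NeZero N]

/-- The eigenvalue of the horizontal Laplacian at frequency `ξ`. -/
noncomputable def lapEig (ξ : Fin d → ZMod N) : ℝ := ∑ i, (1 - zcos (ξ i))

/-- The hyperbolic sine of the decay rate of the vertical profile. -/
noncomputable def decaySinh (ξ : Fin d → ZMod N) : ℝ := √(lapEig ξ ^ 2 + 2 * lapEig ξ)

/-- The ratio of the vertical profile. -/
noncomputable def decayRatio (ξ : Fin d → ZMod N) : ℝ := 1 + lapEig ξ - decaySinh ξ

/-- The vertical profile at frequency `ξ`. -/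
noncomputable def profile (L : ℝ) (ξ : Fin d → ZMod N) (s : ℤ) : ℝ :=
  if ξ = 0 then L - |(s : ℝ)| else decayRatio ξ ^ s.natAbs / decaySinh ξ

/-- The sum of the profiles over all frequencies. -/
noncomputable def greenFun (L : ℝ) (z : Cylinder d N) : ℝ :=
  (d + 1) / (N : ℝ) ^ d * ∑ ξ : Fin d → ZMod N, zcos (∑ i, ξ i * z.1 i) * profile L ξ z.2

lemma lapEig_nonneg (ξ : Fin d → ZMod N) : 0 ≤ lapEig ξ :=
  Finset.sum_nonneg fun _ _ => sub_nonneg.2 (zcos_le_one _)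

lemma lapEig_le (ξ : Fin d → ZMod N) : lapEig ξ ≤ 2 * d := by
  have : ∑ i, (1 - zcos (ξ i)) ≤ ∑ _i : Fin d, (2 : ℝ) :=
    Finset.sum_le_sum fun i _ => by linarith [neg_one_le_zcos (ξ i)]
  rw [Finset.sum_const, Finset.card_univ, Fintype.card_fin, nsmul_eq_mul] at this
  rw [lapEig]
  linarith

lemma sq_decaySinh (ξ : Fin d → ZMod N) : decaySinh ξ ^ 2 = lapEig ξ ^ 2 + 2 * lapEig ξ :=
  Real.sq_sqrt (by have := lapEig_nonneg ξ; positivity)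

lemma decaySinh_nonneg (ξ : Fin d → ZMod N) : 0 ≤ decaySinh ξ := Real.sqrt_nonneg _

lemma valMinAbs_le_decaySinh (ξ : Fin d → ZMod N) (i : Fin d) :
    4 * |((ξ i).valMinAbs : ℝ)| / N ≤ decaySinh ξ := by
  have h1 := sq_valMinAbs_le_one_sub_zcos (ξ i)
  have h2 : 1 - zcos (ξ i) ≤ lapEig ξ :=
    Finset.single_le_sum (f := fun i => 1 - zcos (ξ i))
      (fun k _ => sub_nonneg.2 (zcos_le_one _)) (Finset.mem_univ i)
  refine Real.le_sqrt_of_sq_le ?_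
  have h3 : (4 * |((ξ i).valMinAbs : ℝ)| / N) ^ 2 = 2 * (8 * (|((ξ i).valMinAbs : ℝ)| / N) ^ 2) := by
    ring
  rw [h3]
  nlinarith [sq_nonneg (lapEig ξ)]

lemma four_div_le_decaySinh {ξ : Fin d → ZMod N} (hξ : ξ ≠ 0) : 4 / N ≤ decaySinh ξ := by
  obtain ⟨i, hi⟩ := Function.ne_iff.1 hξ
  refine le_trans ?_ (valMinAbs_le_decaySinh ξ i)
  have h1 : (ξ i).valMinAbs ≠ 0 := by
    rw [Ne, ZMod.valMinAbs_eq_zero]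
    exact hi
  have h2 : (1 : ℝ) ≤ |((ξ i).valMinAbs : ℝ)| := by
    have := Int.one_le_abs h1
    exact_mod_cast this
  gcongr
  linarith

lemma decayRatio_mul (ξ : Fin d → ZMod N) : decayRatio ξ * (1 + lapEig ξ + decaySinh ξ) = 1 := by
  have := sq_decaySinh ξ
  rw [decayRatio]
  linear_combination -this

/-- The characteristic equation of the vertical recursion. Writing 1 + `lapEig ξ` = cosh θ, the
ratio is e^(-θ) and `decaySinh ξ` is sinh θ. -/
lemma decayRatio_sq (ξ : Fin d → ZMod N) :
    decayRatio ξ ^ 2 + 1 = 2 * (1 + lapEig ξ) * decayRatio ξ := by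
  have := sq_decaySinh ξ
  rw [decayRatio]
  linear_combination this

lemma decayRatio_pos (ξ : Fin d → ZMod N) : 0 < decayRatio ξ := by
  have h1 := decayRatio_mul ξ
  have h2 : 0 < 1 + lapEig ξ + decaySinh ξ := by
    linarith [lapEig_nonneg ξ, decaySinh_nonneg ξ]
  by_contra! h
  nlinarith

lemma decayRatio_le_exp (ξ : Fin d → ZMod N) :
    decayRatio ξ ≤ Real.exp (-(decaySinh ξ / (2 * d + 2))) := by
  have ha := lapEig_nonneg ξ
  have ha' := lapEig_le ξ
  have ht := decaySinh_nonneg ξ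
  have ht' : decaySinh ξ ≤ 2 * d + 1 := by
    have := sq_decaySinh ξ
    nlinarith
  have h1 : decayRatio ξ ≤ 1 / (1 + decaySinh ξ) := by
    rw [le_div_iff₀ (by linarith)]
    nlinarith [decayRatio_mul ξ, mul_nonneg (decayRatio_pos ξ).le ha]
  have h2 : decaySinh ξ / (2 * d + 2) ≤ decaySinh ξ / (1 + decaySinh ξ) := by
    exact div_le_div_of_nonneg_left ht (by linarith) (by linarith)
  have h3 := Real.add_one_le_exp (-(decaySinh ξ / (1 + decaySinh ξ)))
  have h4 : -(decaySinh ξ / (1 + decaySinh ξ)) + 1 = 1 / (1 + decaySinh ξ) := by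
    field_simp
    ring
  have h5 : Real.exp (-(decaySinh ξ / (1 + decaySinh ξ))) ≤
      Real.exp (-(decaySinh ξ / (2 * d + 2))) := Real.exp_le_exp.2 (by linarith)
  linarith

/-- At vertical distance N/4 the factor N cancels: averaging sinh θ ≥ 4|ξ_i|/N over the d
coordinates gives a decay rate in Σ|ξ_i| that does not depend on N. -/
lemma decayRatio_pow_le (hd : 0 < d) (ξ : Fin d → ZMod N) {n : ℕ} (hn : (N : ℝ) / 4 ≤ n) :
    decayRatio ξ ^ n ≤
      Real.exp (-(1 / (2 * d * (d + 1)) * ∑ i, |((ξ i).valMinAbs : ℝ)|)) := by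
  have hN : (0 : ℝ) < N := by exact_mod_cast Nat.pos_of_ne_zero (NeZero.ne N)
  have hd' : (0 : ℝ) < d := by exact_mod_cast hd
  refine (pow_le_pow_left₀ (decayRatio_pos ξ).le (decayRatio_le_exp ξ) n).trans ?_
  rw [← Real.exp_nat_mul, Real.exp_le_exp]
  have h1 := Finset.sum_le_sum fun i (_ : i ∈ Finset.univ) => valMinAbs_le_decaySinh ξ i
  rw [Finset.sum_const, Finset.card_univ, Fintype.card_fin, nsmul_eq_mul, ← Finset.sum_div,
    ← Finset.mul_sum, div_le_iff₀ hN] at h1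
  have h2 : ∑ i, |((ξ i).valMinAbs : ℝ)| ≤ d * (n * decaySinh ξ) := by
    have := mul_le_mul_of_nonneg_right hn (mul_nonneg hd'.le (decaySinh_nonneg ξ))
    nlinarith
  have h3 : 1 / (2 * d * (d + 1)) * ∑ i, |((ξ i).valMinAbs : ℝ)| ≤
      1 / (2 * d * (d + 1)) * (d * (n * decaySinh ξ)) := by gcongr
  have h4 : 1 / (2 * d * (d + 1)) * (d * (n * decaySinh ξ)) = n * (decaySinh ξ / (2 * d + 2)) := by
    field_simp
  linarith

/-- Every profile is normalised to produce the same source 2 at height zero, which is why non-zero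
modes are divided by `decaySinh`. Summed over all frequencies, equal sources add up to a point mass.
-/
lemma profile_add_profile (L : ℝ) (ξ : Fin d → ZMod N) (s : ℤ) :
    profile L ξ (s + 1) + profile L ξ (s - 1) =
      2 * (1 + lapEig ξ) * profile L ξ s - if s = 0 then 2 else 0 := by
  by_cases hξ : ξ = 0
  · have h0 : lapEig ξ = 0 := by simp [lapEig, hξ]
    simp only [profile, hξ, if_true]
    rw [hξ] at h0
    rw [h0]
    rcases lt_trichotomy s 0 with hs | hs | hs
    · have h1 : (s : ℝ) ≤ -1 := by exact_mod_cast Int.le_sub_one_of_lt hs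
      rw [if_neg hs.ne]
      push_cast
      rw [abs_of_nonpos (by linarith), abs_of_nonpos (by linarith), abs_of_nonpos (by linarith)]
      ring
    · subst hs
      norm_num
      ring
    · have h1 : (1 : ℝ) ≤ s := by exact_mod_cast hs
      rw [if_neg hs.ne']
      push_cast
      rw [abs_of_nonneg (by linarith), abs_of_nonneg (by linarith), abs_of_nonneg (by linarith)]
      ring
  · have hN : (0 : ℝ) < N := by exact_mod_cast Nat.pos_of_ne_zero (NeZero.ne N)
    have ht : decaySinh ξ ≠ 0 := by
      have := four_div_le_decaySinh hξ
      have h4 : 0 < 4 / (N : ℝ) := by positivity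
      linarith
    simp only [profile, hξ, if_false]
    have hr := decayRatio_sq ξ
    rcases Int.natAbs_eq s with hs | hs <;> cases hk : s.natAbs with
    | zero =>
      rw [hk] at hs
      have hs0 : s = 0 := by simpa using hs
      subst hs0
      have h5 : decayRatio ξ = 1 + lapEig ξ - decaySinh ξ := rfl
      norm_num
      field_simp
      linear_combination 2 * h5
    | succ k =>
      rw [hk] at hs
      have hs0 : s ≠ 0 := by omega
      rw [if_neg hs0]
      -- The two alternatives serve s = k + 1 and s = -(k + 1), where the roles of the neighbours
      -- above and below are exchanged.
      first
      | rw [show (s + 1).natAbs = k + 2 by omega, show (s - 1).natAbs = k by omega]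
      | rw [show (s + 1).natAbs = k by omega, show (s - 1).natAbs = k + 2 by omega]
      field_simp
      linear_combination decayRatio ξ ^ k * hr

/-- Mode by mode the vertical recursion leaves a multiple of the character at height zero.
Orthogonality collects these into a multiple of the point mass at the origin, and the prefactor
(d+1)/N^d makes its weight one. -/
lemma nbrAvg_greenFun (L : ℝ) (z : Cylinder d N) :
    nbrAvg (cylVec d N) (greenFun L) z = greenFun L z - if z = 0 then 1 else 0 := by
  have hN : (0 : ℝ) < N := by exact_mod_cast Nat.pos_of_ne_zero (NeZero.ne N)
  have hmode : ∀ ξ : Fin d → ZMod N,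
      nbrAvg (cylVec d N) (fun x => zcos (∑ i, ξ i * x.1 i) * profile L ξ x.2) z =
        zcos (∑ i, ξ i * z.1 i) * profile L ξ z.2 -
          (if z.2 = 0 then 1 / (d + 1 : ℝ) else 0) * zcos (∑ i, ξ i * z.1 i) := by
    intro ξ
    have h1 : ∀ k : Fin d, zcos (∑ i, ξ i * (z + cylVec d N k.castSucc).1 i) *
        profile L ξ (z + cylVec d N k.castSucc).2 +
        zcos (∑ i, ξ i * (z - cylVec d N k.castSucc).1 i) *
        profile L ξ (z - cylVec d N k.castSucc).2 =
        2 * profile L ξ z.2 * zcos (∑ i, ξ i * z.1 i) * zcos (ξ k) := by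
      intro k
      have h2 : zcos (∑ i, ξ i * (z + cylVec d N k.castSucc).1 i) +
          zcos (∑ i, ξ i * (z - cylVec d N k.castSucc).1 i) =
          2 * zcos (ξ k) * zcos (∑ i, ξ i * z.1 i) := by
        rw [← zcos_add_add_zcos_sub]
        simp [cylVec_castSucc, mul_add, mul_sub, Finset.sum_add_distrib, Finset.sum_sub_distrib,
          Pi.single_apply]
      have h3 : (z + cylVec d N k.castSucc).2 = z.2 := by simp [cylVec_castSucc]
      have h4 : (z - cylVec d N k.castSucc).2 = z.2 := by simp [cylVec_castSucc]
      rw [h3, h4]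
      linear_combination profile L ξ z.2 * h2
    have h5 : ∑ k, zcos (ξ k) = d - lapEig ξ := by
      simp [lapEig]
    simp only [nbrAvg]
    rw [Fin.sum_univ_castSucc]
    simp only [h1]
    rw [← Finset.mul_sum, h5]
    have h6 := profile_add_profile L ξ z.2
    simp only [cylVec_last, Prod.fst_add, Prod.fst_sub, Prod.snd_add, Prod.snd_sub, add_zero,
      sub_zero, Fintype.card_fin]
    rw [← mul_add, h6]
    push_cast
    have hd1 : (d : ℝ) + 1 ≠ 0 := by positivity
    split_ifs
    · field_simp
      ring
    · field_simp
      ring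
  have h7 := sum_freqs_zcos (N := N) Finset.univ z.1
  rw [freqs_univ] at h7
  have h8 : nbrAvg (cylVec d N) (greenFun L) z = (d + 1) / (N : ℝ) ^ d *
      ∑ ξ : Fin d → ZMod N, nbrAvg (cylVec d N)
        (fun x => zcos (∑ i, ξ i * x.1 i) * profile L ξ x.2) z := by
    rw [← nbrAvg_sum, ← nbrAvg_const_mul]
    rfl
  rw [h8]
  simp only [hmode]
  rw [Finset.sum_sub_distrib, ← Finset.mul_sum, h7, mul_sub, greenFun, sub_right_inj,
    Finset.card_univ, Fintype.card_fin]
  have hz : z = 0 ↔ z.2 = 0 ∧ ∀ i ∈ Finset.univ, z.1 i = 0 := by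
    rw [Prod.ext_iff, funext_iff]
    simp [and_comm]
  have hd1 : (d : ℝ) + 1 ≠ 0 := by positivity
  by_cases h9 : z.2 = 0 <;> by_cases h10 : ∀ i ∈ Finset.univ, z.1 i = 0
  · rw [if_pos h9, if_pos h10, if_pos (hz.2 ⟨h9, h10⟩)]
    field_simp
  · rw [if_neg h10, if_neg fun h => h10 (hz.1 h).2]
    simp
  · rw [if_neg h9, if_neg fun h => h9 (hz.1 h).1]
    simp
  · rw [if_neg h9, if_neg fun h => h9 (hz.1 h).1]
    simp

/-- Summing over a horizontal slice kills all modes but the zero mode, so the slice average has no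
singularity at the pole. -/
lemma sum_greenFun (L : ℝ) (s : ℤ) :
    ∑ h : Fin d → ZMod N, greenFun L (h, s) = (d + 1) * (L - |(s : ℝ)|) := by
  have hN : (0 : ℝ) < N := by exact_mod_cast Nat.pos_of_ne_zero (NeZero.ne N)
  simp only [greenFun]
  rw [← Finset.mul_sum, Finset.sum_comm]
  have h1 : ∀ ξ : Fin d → ZMod N, ∑ h : Fin d → ZMod N, zcos (∑ i, ξ i * h i) * profile L ξ s =
      if ξ = 0 then (N : ℝ) ^ d * (L - |(s : ℝ)|) else 0 := by
    intro ξ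
    rw [← Finset.sum_mul]
    have h2 := sum_freqs_zcos (N := N) Finset.univ ξ
    rw [freqs_univ, Finset.card_univ, Fintype.card_fin] at h2
    simp only [mul_comm (ξ _)]
    rw [h2]
    by_cases hξ : ξ = 0
    · simp [hξ, profile]
    · rw [if_neg fun h => hξ (funext fun i => h i (Finset.mem_univ i)), if_neg hξ, zero_mul]
  simp only [h1]
  rw [Finset.sum_ite_eq' Finset.univ (0 : Fin d → ZMod N), if_pos (Finset.mem_univ _)]
  field_simp

/-- The constant that bounds the contribution of the non-zero frequencies. -/
noncomputable def freqConst (d : ℕ) : ℝ := (1 + 2 / (1 / (2 * d * (d + 1)))) ^ d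

lemma freqConst_pos (d : ℕ) : 0 < freqConst d := by
  unfold freqConst
  positivity

/-- At vertical distance N/4 or more the zero mode gives the main term. Each other mode is at most N
times a summable exponential in the frequency, because 1/`decaySinh` ≤ N. -/
lemma abs_greenFun_sub_le (hd : 0 < d) (L : ℝ) {z : Cylinder d N}
    (hz : (N : ℝ) / 4 ≤ |(z.2 : ℝ)|) :
    |greenFun L z - (d + 1) / (N : ℝ) ^ d * (L - |(z.2 : ℝ)|)| ≤
      (d + 1) / (N : ℝ) ^ d * (freqConst d * N) := by
  have hN : (0 : ℝ) < N := by exact_mod_cast Nat.pos_of_ne_zero (NeZero.ne N)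
  have hd' : (0 : ℝ) < d := by exact_mod_cast hd
  have hsum : ∑ ξ : Fin d → ZMod N, zcos (∑ i, ξ i * z.1 i) * profile L ξ z.2 - (L - |(z.2 : ℝ)|) =
      ∑ ξ ∈ Finset.univ.erase (0 : Fin d → ZMod N),
        zcos (∑ i, ξ i * z.1 i) * profile L ξ z.2 := by
    rw [← Finset.add_sum_erase _ _ (Finset.mem_univ (0 : Fin d → ZMod N))]
    simp [profile]
  rw [greenFun, ← mul_sub, hsum, abs_mul, abs_of_nonneg (by positivity)]
  gcongr
  have hn : (N : ℝ) / 4 ≤ (z.2.natAbs : ℝ) := by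
    rw [Nat.cast_natAbs, Int.cast_abs]
    exact hz
  have hb : (0 : ℝ) < 1 / (2 * d * (d + 1)) := by positivity
  calc |∑ ξ ∈ Finset.univ.erase (0 : Fin d → ZMod N), zcos (∑ i, ξ i * z.1 i) * profile L ξ z.2|
      ≤ ∑ ξ ∈ Finset.univ.erase (0 : Fin d → ZMod N),
        |zcos (∑ i, ξ i * z.1 i) * profile L ξ z.2| := Finset.abs_sum_le_sum_abs _ _
    _ ≤ ∑ ξ ∈ Finset.univ.erase (0 : Fin d → ZMod N),
        Real.exp (-(1 / (2 * d * (d + 1)) * ∑ i, |((ξ i).valMinAbs : ℝ)|)) * N := by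
      refine Finset.sum_le_sum fun ξ hξ => ?_
      have hξ0 := (Finset.mem_erase.1 hξ).1
      have ht := four_div_le_decaySinh hξ0
      have ht0 : 0 < decaySinh ξ := lt_of_lt_of_le (by positivity) ht
      have hr := decayRatio_pow_le hd ξ hn
      have hr0 := decayRatio_pos ξ
      rw [abs_mul, profile, if_neg hξ0, abs_of_nonneg
        (show 0 ≤ decayRatio ξ ^ z.2.natAbs / decaySinh ξ by positivity)]
      have h1 : decayRatio ξ ^ z.2.natAbs / decaySinh ξ ≤
          Real.exp (-(1 / (2 * d * (d + 1)) * ∑ i, |((ξ i).valMinAbs : ℝ)|)) * N := by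
        rw [div_le_iff₀ ht0]
        have h2 : 1 ≤ N * decaySinh ξ := by
          rw [div_le_iff₀ hN] at ht
          linarith
        calc decayRatio ξ ^ z.2.natAbs ≤
            Real.exp (-(1 / (2 * d * (d + 1)) * ∑ i, |((ξ i).valMinAbs : ℝ)|)) * 1 := by
              rw [mul_one]; exact hr
          _ ≤ Real.exp (-(1 / (2 * d * (d + 1)) * ∑ i, |((ξ i).valMinAbs : ℝ)|)) *
              (N * decaySinh ξ) := by gcongr
          _ = _ := by ring
      calc _ ≤ 1 * (decayRatio ξ ^ z.2.natAbs / decaySinh ξ) := by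
            gcongr
            exact abs_zcos_le_one _
        _ ≤ _ := by rw [one_mul]; exact h1
    _ ≤ ∑ ξ : Fin d → ZMod N,
        Real.exp (-(1 / (2 * d * (d + 1)) * ∑ i, |((ξ i).valMinAbs : ℝ)|)) * N :=
      Finset.sum_le_sum_of_subset_of_nonneg (Finset.erase_subset _ _) fun _ _ _ => by positivity
    _ ≤ freqConst d * N := by
      rw [← Finset.sum_mul]
      gcongr
      have h3 := sum_freqs_exp_le (N := N) (Finset.univ : Finset (Fin d)) hb
      rw [freqs_univ, Finset.card_univ, Fintype.card_fin] at h3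
      exact h3

/-- The vertical extent used for the superharmonic function. -/
noncomputable def greenHeight (d N : ℕ) : ℝ := (freqConst d + 3) * N

/-- This explains `greenHeight`: up to height 3N the zero mode is still at least `freqConst d * N`,
enough to absorb all other modes. -/
lemma greenFun_nonneg_of_le (hd : 0 < d) {z : Cylinder d N} (hz : (N : ℝ) / 4 ≤ |(z.2 : ℝ)|)
    (hz' : |(z.2 : ℝ)| ≤ 3 * N) : 0 ≤ greenFun (greenHeight d N) z := by
  have h1 := (abs_le.1 (abs_greenFun_sub_le hd (greenHeight d N) hz)).1
  have h2 : (d + 1) / (N : ℝ) ^ d * (freqConst d * N) ≤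
      (d + 1) / (N : ℝ) ^ d * (greenHeight d N - |(z.2 : ℝ)|) := by
    gcongr
    rw [greenHeight]
    linarith
  linarith

lemma greenFun_le_of_le (hd : 0 < d) {z : Cylinder d N} (hz : (N : ℝ) / 4 ≤ |(z.2 : ℝ)|) :
    greenFun (greenHeight d N) z ≤ (d + 1) * (2 * freqConst d + 3) * (N / (N : ℝ) ^ d) := by
  have h1 := (abs_le.1 (abs_greenFun_sub_le hd (greenHeight d N) hz)).2
  have h2 : (d + 1) / (N : ℝ) ^ d * (greenHeight d N - |(z.2 : ℝ)|) ≤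
      (d + 1) / (N : ℝ) ^ d * greenHeight d N := by
    gcongr
    linarith [abs_nonneg (z.2 : ℝ)]
  have h3 : (d + 1) / (N : ℝ) ^ d * (freqConst d * N) + (d + 1) / (N : ℝ) ^ d * greenHeight d N =
      (d + 1) * (2 * freqConst d + 3) * (N / (N : ℝ) ^ d) := by
    rw [greenHeight]
    ring
  linarith

/-- The minimum principle gives positivity near the pole. -/
lemma greenFun_nonneg (hd : 0 < d) {z : Cylinder d N} (hz : |(z.2 : ℝ)| ≤ 3 * N) :
    0 ≤ greenFun (greenHeight d N) z := by
  have hN1 : 1 ≤ N := Nat.pos_of_ne_zero (NeZero.ne N)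
  have hN : (1 : ℝ) ≤ N := by exact_mod_cast hN1
  by_contra! hneg
  set s : Finset (Cylinder d N) := Finset.univ ×ˢ Finset.Icc (-(3 * N : ℤ)) (3 * N) with hs
  have hmem : ∀ w : Cylinder d N, w ∈ s ↔ |(w.2 : ℝ)| ≤ 3 * N := by
    intro w
    have h1 : (3 * N : ℝ) = ((3 * N : ℤ) : ℝ) := by push_cast; rfl
    rw [h1, ← Int.cast_abs, Int.cast_le, abs_le]
    simp [hs]
  obtain ⟨w, hw, hmin⟩ := Finset.exists_min_image s (greenFun (greenHeight d N))
    ⟨z, (hmem z).2 hz⟩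
  -- Among the minimisers a highest one is taken. Negativity confines it to heights below N/4, so
  -- its neighbours stay in `s`, and the neighbour above is strictly larger, which contradicts
  -- superharmonicity.
  obtain ⟨v, hv, hmax⟩ := Finset.exists_max_image
    (s.filter fun x => greenFun (greenHeight d N) x = greenFun (greenHeight d N) w)
    (fun x => x.2) ⟨w, by simp [hw]⟩
  obtain ⟨hvs, hvw⟩ := Finset.mem_filter.1 hv
  have hvneg : greenFun (greenHeight d N) v < 0 := by
    rw [hvw]
    exact (hmin z ((hmem z).2 hz)).trans_lt hneg
  have hv4 : |(v.2 : ℝ)| < N / 4 := by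
    by_contra! h
    exact absurd (greenFun_nonneg_of_le hd h ((hmem v).1 hvs)) (not_le.2 hvneg)
  have hnbr : ∀ x : Cylinder d N, |x.2 - v.2| ≤ 1 → x ∈ s := by
    intro x hx
    rw [hmem]
    have h1 : |(x.2 : ℝ) - v.2| ≤ 1 := by exact_mod_cast hx
    have h2 := abs_add_le ((x.2 : ℝ) - v.2) v.2
    rw [sub_add_cancel] at h2
    linarith
  have hge : ∀ i, greenFun (greenHeight d N) v ≤ greenFun (greenHeight d N) (v + cylVec d N i) ∧
      greenFun (greenHeight d N) v ≤ greenFun (greenHeight d N) (v - cylVec d N i) := by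
    intro i
    have := abs_snd_add_cylVec_le v i
    rw [hvw]
    exact ⟨hmin _ (hnbr _ this.1), hmin _ (hnbr _ this.2)⟩
  have hgt : greenFun (greenHeight d N) v <
      greenFun (greenHeight d N) (v + cylVec d N (Fin.last d)) := by
    refine lt_of_le_of_ne (hge _).1 fun heq => ?_
    have := hmax (v + cylVec d N (Fin.last d)) (Finset.mem_filter.2
      ⟨hnbr _ (abs_snd_add_cylVec_le v _).1, by rw [← heq, hvw]⟩)
    simp [cylVec_last] at this
  have hsum : ∑ _i : Fin (d + 1), (greenFun (greenHeight d N) v + greenFun (greenHeight d N) v) <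
      ∑ i, (greenFun (greenHeight d N) (v + cylVec d N i) +
        greenFun (greenHeight d N) (v - cylVec d N i)) :=
    Finset.sum_lt_sum (fun i _ => add_le_add (hge i).1 (hge i).2)
      ⟨Fin.last d, Finset.mem_univ _, add_lt_add_of_lt_of_le hgt (hge _).2⟩
  have havg := nbrAvg_greenFun (greenHeight d N) v
  have h2 : nbrAvg (cylVec d N) (greenFun (greenHeight d N)) v ≤ greenFun (greenHeight d N) v := by
    rw [havg]
    split_ifs <;> linarith
  have h3 : greenFun (greenHeight d N) v < nbrAvg (cylVec d N) (greenFun (greenHeight d N)) v := by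
    conv_lhs => rw [← nbrAvg_const (E := cylVec d N) (z := v) (greenFun (greenHeight d N) v)]
    unfold nbrAvg
    gcongr
  linarith

/-- At the pole the value is the neighbour average plus one, and the neighbours have non-negative
values. -/
lemma one_le_greenFun_zero (hd : 0 < d) : 1 ≤ greenFun (greenHeight d N) (0 : Cylinder d N) := by
  have hN1 : 1 ≤ N := Nat.pos_of_ne_zero (NeZero.ne N)
  have hN : (1 : ℝ) ≤ N := by exact_mod_cast hN1
  have h1 := nbrAvg_greenFun (greenHeight d N) (0 : Cylinder d N)
  rw [if_pos rfl] at h1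
  have h2 : nbrAvg (cylVec d N) (fun _ => (0 : ℝ)) 0 ≤
      nbrAvg (cylVec d N) (greenFun (greenHeight d N)) 0 := by
    refine nbrAvg_le_nbrAvg fun i => ?_
    have hi := abs_snd_add_cylVec_le (0 : Cylinder d N) i
    have h3 : ∀ x : Cylinder d N, |x.2 - (0 : Cylinder d N).2| ≤ 1 →
        0 ≤ greenFun (greenHeight d N) x := by
      intro x hx
      refine greenFun_nonneg hd ?_
      have : |(x.2 : ℝ)| ≤ 1 := by
        simp only [Prod.snd_zero, sub_zero] at hx
        exact_mod_cast hx
      linarith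
    exact ⟨h3 _ hi.1, h3 _ hi.2⟩
  rw [nbrAvg_const] at h2
  linarith

end Green

/-! ### Return probabilities on the cylinder -/

lemma outerBlock_step {d N : ℕ} {j : ℤ} {z : Cylinder d N} (hz : z ∈ outerBlock d N j)
    (i : Fin (d + 1)) :
    |(z + cylVec d N i).2 - j * N| ≤ 2 * N ∧ |(z - cylVec d N i).2 - j * N| ≤ 2 * N := by
  have h1 := abs_snd_add_cylVec_le z i
  have h2 : (j - 2) * N + 1 ≤ z.2 ∧ z.2 ≤ (j + 2) * N - 1 := hz
  rw [abs_le, abs_le] at *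
  constructor <;> constructor <;> nlinarith

lemma nbrAvg_vertical {d N : ℕ} (f : ℤ → ℝ) (z : Cylinder d N) :
    nbrAvg (cylVec d N) (fun x => f x.2) z =
      (2 * d * f z.2 + f (z.2 + 1) + f (z.2 - 1)) / (2 * (d + 1)) := by
  simp only [nbrAvg]
  rw [Fin.sum_univ_castSucc]
  simp only [cylVec_castSucc, cylVec_last, Prod.snd_add, Prod.snd_sub, add_zero, sub_zero,
    Finset.sum_const, Finset.card_univ, Fintype.card_fin, nsmul_eq_mul]
  push_cast
  ring

/-- The vertical coordinate moves with probability 1/(d+1), so (d+1)(4N² - s²), with s the height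
relative to jN, decreases by exactly one per step on average and bounds the expected exit time. -/
lemma mul_survProb_outerBlock_le {d N : ℕ} (j : ℤ) (n : ℕ) (z : Cylinder d N) :
    n * survProb (cylVec d N) (outerBlock d N j) n z ≤ 4 * (d + 1) * (N : ℝ) ^ 2 := by
  by_cases hz : z ∈ outerBlock d N j
  · set U : Set (Cylinder d N) := {w | |w.2 - j * N| ≤ 2 * N} with hU
    set φ : Cylinder d N → ℝ := fun w => (d + 1) * (4 * (N : ℝ) ^ 2 - ((w.2 : ℝ) - j * N) ^ 2)
      with hφ
    have hzU : z ∈ U := by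
      have h2 : (j - 2) * N + 1 ≤ z.2 ∧ z.2 ≤ (j + 2) * N - 1 := hz
      change |z.2 - j * N| ≤ 2 * N
      rw [abs_le]
      constructor <;> nlinarith
    have h := mul_survProb_le (E := cylVec d N) (D := outerBlock d N j) (U := U) (φ := φ)
      (fun w hw i => outerBlock_step hw i) ?_ ?_ n hzU
    · refine h.trans ?_
      have h1 : 0 ≤ (d + 1 : ℝ) * ((z.2 : ℝ) - j * N) ^ 2 := by positivity
      simp only [hφ]
      linarith
    · intro w hw
      have h1 : |w.2 - j * N| ≤ 2 * N := hw
      have h2 : |(w.2 : ℝ) - j * N| ≤ 2 * N := by exact_mod_cast h1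
      have h3 : ((w.2 : ℝ) - j * N) ^ 2 ≤ (2 * N) ^ 2 := sq_le_sq' (abs_le.1 h2).1 (abs_le.1 h2).2
      simp only [hφ]
      have h4 : 0 ≤ 4 * (N : ℝ) ^ 2 - ((w.2 : ℝ) - j * N) ^ 2 := by linarith
      positivity
    · intro w _
      have := nbrAvg_vertical (N := N)
        (fun s => (d + 1) * (4 * (N : ℝ) ^ 2 - ((s : ℝ) - j * N) ^ 2)) w
      simp only [hφ]
      rw [this]
      push_cast
      apply le_of_eq
      field_simp
      ring
  · rw [survProb_of_notMem _ hz, mul_zero]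
    positivity

/-! ### Comparison with the infinite lattice through the coordinates transverse to a section. -/

section Lift

variable {d m : ℕ} {I : Finset (Fin (d + 1))} (hI : Iᶜ.card = d + 1 - m) (y : Fin (d + 1) → ℤ)

/-- The coordinates outside of `I`, relative to `y`. -/
def transverse (x : Fin (d + 1) → ℤ) (a : Fin (d + 1 - m)) : ℤ :=
  x (Iᶜ.orderEmbOfFin hI a) - y (Iᶜ.orderEmbOfFin hI a)

/-- Seen transversally the walk is lazy: the m directions in `I` do not move it, the others act as
simple random walk on ℤ^(d+1-m). -/
lemma nbrAvg_transverse (hm : m ≤ d) (f : (Fin (d + 1 - m) → ℤ) → ℝ) (x : Fin (d + 1) → ℤ) :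
    nbrAvg (intVec (d + 1)) (fun x' => f (transverse hI y x')) x =
      (m : ℝ) / (d + 1) * f (transverse hI y x) +
        (1 - (m : ℝ) / (d + 1)) * nbrAvg (intVec (d + 1 - m)) f (transverse hI y x) := by
  have hcard : I.card = m := by
    have := Finset.card_add_card_compl I
    rw [hI, Fintype.card_fin] at this
    omega
  have h1 : ∀ k ∈ I, f (transverse hI y (x + intVec (d + 1) k)) +
      f (transverse hI y (x - intVec (d + 1) k)) = 2 * f (transverse hI y x) := by
    intro k hk
    have hne : ∀ a, Iᶜ.orderEmbOfFin hI a ≠ k := fun a h =>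
      (Finset.mem_compl.1 (Finset.orderEmbOfFin_mem Iᶜ hI a)) (h ▸ hk)
    have h2 : transverse hI y (x + intVec (d + 1) k) = transverse hI y x := by
      funext a
      simp [transverse, intVec, hne a]
    have h3 : transverse hI y (x - intVec (d + 1) k) = transverse hI y x := by
      funext a
      simp [transverse, intVec, hne a]
    rw [h2, h3]
    ring
  have h4 : ∀ a : Fin (d + 1 - m),
      transverse hI y (x + intVec (d + 1) (Iᶜ.orderEmbOfFin hI a)) =
        transverse hI y x + intVec (d + 1 - m) a ∧
      transverse hI y (x - intVec (d + 1) (Iᶜ.orderEmbOfFin hI a)) =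
        transverse hI y x - intVec (d + 1 - m) a := by
    intro a
    constructor <;> funext b <;>
      simp only [transverse, intVec, Pi.add_apply, Pi.sub_apply, Pi.single_apply,
        EmbeddingLike.apply_eq_iff_eq] <;> ring
  have h5 : ∑ k ∈ Iᶜ, (f (transverse hI y (x + intVec (d + 1) k)) +
      f (transverse hI y (x - intVec (d + 1) k))) =
      ∑ a, (f (transverse hI y x + intVec (d + 1 - m) a) +
        f (transverse hI y x - intVec (d + 1 - m) a)) := by
    conv_lhs => rw [← Finset.map_orderEmbOfFin_univ Iᶜ hI]
    rw [Finset.sum_map]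
    refine Finset.sum_congr rfl fun a _ => ?_
    have := h4 a
    simp only [RelEmbedding.coe_toEmbedding]
    rw [this.1, this.2]
  have hν : ((d + 1 - m : ℕ) : ℝ) = d + 1 - m := by
    rw [Nat.cast_sub (by omega)]
    push_cast
    rfl
  have hν0 : (0 : ℝ) < d + 1 - m := by
    have : (m : ℝ) ≤ d := by exact_mod_cast hm
    linarith
  simp only [nbrAvg, Fintype.card_fin]
  rw [← Finset.sum_add_sum_compl I, h5, Finset.sum_congr rfl h1, Finset.sum_const, hcard,
    nsmul_eq_mul, hν]
  push_cast
  field_simp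

lemma nbrAvg_proj {N : ℕ} (f : Cylinder d N → ℝ) (x : Fin (d + 1) → ℤ) :
    nbrAvg (cylVec d N) f (proj d N x) = nbrAvg (intVec (d + 1)) (fun x' => f (proj d N x')) x := by
  simp only [nbrAvg, proj_add, proj_sub]
  rfl

lemma transverse_eq_zero {N : ℕ} {x : Fin (d + 1) → ℤ} (hx : ∀ i ∉ I, |x i - y i| < N)
    (hF : proj d N x ∈ proj d N '' {x | ∀ i, i ∉ I → x i = y i}) : transverse hI y x = 0 := by
  obtain ⟨w, hw, hwx⟩ := hF
  have hw' : ∀ i, i ∉ I → w i = y i := hw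
  funext a
  have ha : Iᶜ.orderEmbOfFin hI a ∉ I := Finset.mem_compl.1 (Finset.orderEmbOfFin_mem Iᶜ hI a)
  have h1 : ((x (Iᶜ.orderEmbOfFin hI a) : ℤ) : ZMod N) = (y (Iᶜ.orderEmbOfFin hI a) : ℤ) := by
    rw [← zCoord_proj, ← hwx, zCoord_proj, hw' _ ha]
  have h2 : (N : ℤ) ∣ x (Iᶜ.orderEmbOfFin hI a) - y (Iᶜ.orderEmbOfFin hI a) := by
    exact (ZMod.intCast_eq_intCast_iff_dvd_sub _ _ N).1 h1.symm
  exact Int.eq_zero_of_abs_lt_dvd h2 (hx _ ha)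

/-- Starting at transverse distance less than N - k in each coordinate, k steps are too few to reach
another lift of the section. So a hit on the cylinder forces the transverse walk to hit the origin.
-/
lemma hitProb_proj_le {N : ℕ} (hm : m ≤ d) (k : ℕ) {x : Fin (d + 1) → ℤ}
    (hx : ∀ i ∉ I, |x i - y i| + k < N) :
    hitProb (cylVec d N) Set.univ (proj d N '' {x | ∀ i, i ∉ I → x i = y i}) k (proj d N x) ≤
      hitProb (intVec (d + 1 - m)) Set.univ {0} k (transverse hI y x) := by
  have hne : Nonempty (Fin (d + 1 - m)) := ⟨⟨0, by omega⟩⟩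
  have hlt : ∀ i ∉ I, |x i - y i| < N := fun i hi => by have := hx i hi; omega
  by_cases hF : proj d N x ∈ proj d N '' {x | ∀ i, i ∉ I → x i = y i}
  · rw [hitProb_of_mem _ (Set.mem_univ _) hF, hitProb_of_mem _ (Set.mem_univ _)
      (Set.mem_singleton_iff.2 (transverse_eq_zero hI y hlt hF))]
  · induction k generalizing x with
    | zero =>
      refine le_trans (le_of_eq ?_) (hitProb_nonneg 0 _)
      simp only [hitProb, hF, and_false, if_false]
    | succ k ih =>
      by_cases h0 : transverse hI y x = 0
      · rw [hitProb_of_mem _ (Set.mem_univ (transverse hI y x)) h0]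
        exact hitProb_le_one _ _
      · have hnbr : ∀ x' : Fin (d + 1) → ℤ, (∀ i, |x' i - x i| ≤ 1) →
            hitProb (cylVec d N) Set.univ (proj d N '' {x | ∀ i, i ∉ I → x i = y i}) k
              (proj d N x') ≤
            hitProb (intVec (d + 1 - m)) Set.univ {0} k (transverse hI y x') := by
          intro x' hx'
          have hx'' : ∀ i ∉ I, |x' i - y i| + k < N := by
            intro i hi
            have h1 := hx i hi
            have h2 := hx' i
            have h3 := abs_sub_le (x' i) (x i) (y i)
            push_cast at h1
            omega
          have hlt' : ∀ i ∉ I, |x' i - y i| < N := fun i hi => by have := hx'' i hi; omega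
          by_cases hF' : proj d N x' ∈ proj d N '' {x | ∀ i, i ∉ I → x i = y i}
          · rw [hitProb_of_mem _ (Set.mem_univ _) hF', hitProb_of_mem _ (Set.mem_univ _)
              (Set.mem_singleton_iff.2 (transverse_eq_zero hI y hlt' hF'))]
          · exact ih hx'' hlt' hF'
        have hcoord : ∀ k' i : Fin (d + 1), |intVec (d + 1) k' i| ≤ 1 := by
          intro k' i
          simp only [intVec, Pi.single_apply]
          split_ifs <;> simp
        rw [hitProb_succ k (Set.mem_univ _) hF, nbrAvg_proj]
        refine (nbrAvg_le_nbrAvg (g := fun x' =>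
          hitProb (intVec (d + 1 - m)) Set.univ {0} k (transverse hI y x')) fun i =>
            ⟨hnbr _ fun l => by simpa using hcoord i l,
              hnbr _ fun l => by simpa using hcoord i l⟩).trans ?_
        rw [nbrAvg_transverse hI y hm]
        have h1 := hitProb_succ (E := intVec (d + 1 - m)) (F := {0}) k
          (Set.mem_univ (transverse hI y x)) h0
        have h2 := hitProb_le_succ (E := intVec (d + 1 - m)) (D := Set.univ) (F := {0}) k
          (transverse hI y x)
        rw [← h1]
        have h3 : 0 ≤ (m : ℝ) / (d + 1) := by positivity
        -- A lazy step wastes one unit of time; monotonicity of the hitting probability in the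
        -- number of steps, `h2`, pays for it.
        nlinarith [mul_le_mul_of_nonneg_left h2 h3]

end Lift

/-- The chance to return to a lattice section of dimension `m` of the infinite lattice. -/
noncomputable def sectionReturn (d m : ℕ) : ℝ :=
  (m : ℝ) / (d + 1) + (1 - (m : ℝ) / (d + 1)) * returnProb (d + 1 - m)

/-- From a point of the section, a first step along the section is already a return; after any other
step, returning within `M` steps costs at most the return probability of the transverse walk. -/
lemma nbrAvg_hitProb_univ_le {d m N M : ℕ} (hm : m ≤ d) (hN : M + 1 < N)
    {F : Set (Cylinder d N)} (hF : F ∈ latticeSections d N m) {z : Cylinder d N} (hz : z ∈ F) :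
    nbrAvg (cylVec d N) (hitProb (cylVec d N) Set.univ F M) z ≤ sectionReturn d m := by
  obtain ⟨I, y, hIm, rfl⟩ := hF
  obtain ⟨x, hx, rfl⟩ := hz
  have hx' : ∀ i, i ∉ I → x i = y i := hx
  have hI : Iᶜ.card = d + 1 - m := by rw [Finset.card_compl, Fintype.card_fin, hIm]
  have hne : Nonempty (Fin (d + 1 - m)) := ⟨⟨0, by omega⟩⟩
  have hT : transverse hI y x = 0 := by
    funext a
    simp [transverse, hx' _ (Finset.mem_compl.1 (Finset.orderEmbOfFin_mem Iᶜ hI a))]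
  have hnbr : ∀ x' : Fin (d + 1) → ℤ, (∀ i, |x' i - x i| ≤ 1) →
      ∀ i ∉ I, |x' i - y i| + M < N := by
    intro x' h i hi
    have := h i
    rw [hx' i hi] at this
    omega
  have hcoord : ∀ k' i : Fin (d + 1), |intVec (d + 1) k' i| ≤ 1 := by
    intro k' i
    simp only [intVec, Pi.single_apply]
    split_ifs <;> simp
  rw [nbrAvg_proj]
  refine (nbrAvg_le_nbrAvg (g := fun x' =>
    hitProb (intVec (d + 1 - m)) Set.univ {0} M (transverse hI y x')) fun i =>
      ⟨hitProb_proj_le hI y hm M (hnbr _ fun l => by simpa using hcoord i l),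
        hitProb_proj_le hI y hm M (hnbr _ fun l => by simpa using hcoord i l)⟩).trans ?_
  rw [nbrAvg_transverse hI y hm, hT, hitProb_of_mem _ (Set.mem_univ _) (Set.mem_singleton _),
    mul_one, sectionReturn]
  have h1 : (m : ℝ) / (d + 1) ≤ 1 := by
    rw [div_le_one (by positivity)]
    have : (m : ℝ) ≤ d := by exact_mod_cast hm
    linarith
  have := nbrAvg_hitProb_le_returnProb (ν := d + 1 - m) (by omega) M
  gcongr

lemma summable_one_div_sqrt_pow_three : Summable fun n : ℕ => 1 / √(n : ℝ) ^ 3 := by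
  refine (Real.summable_one_div_nat_rpow (p := 3 / 2).2 (by norm_num)).congr fun n => ?_
  rw [Real.sqrt_eq_rpow, ← Real.rpow_natCast, ← Real.rpow_mul n.cast_nonneg]
  norm_num

/-- The expected number of visits to a lattice section after `M + 1` and before `M + 2 + L`. -/
lemma sum_iterate_indicator_le {d m N : ℕ} [NeZero N] (hd : 3 ≤ d) (hm : m ≤ d - 2)
    {F : Set (Cylinder d N)} (hF : F ∈ latticeSections d N m) (L M : ℕ) (z : Cylinder d N) :
    ∑ k ∈ Finset.range L, (nbrAvg (cylVec d N))^[M + 2]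
        ((nbrAvg (cylVec d N))^[k] (F.indicator fun _ => (1 : ℝ))) z ≤
      4 * Real.exp ((d + 1) / 4) * (L / (N : ℝ) ^ 3) +
        4 * Real.exp ((d + 1) / 4) * (2 * (d + 1)) ^ 3 *
          ∑ k ∈ Finset.range L, 1 / √((k + (M + 2) : ℕ) : ℝ) ^ 3 := by
  obtain ⟨I, y, hIm, hFI⟩ := hF
  -- m ≤ d - 2 leaves at least three transverse coordinates, just enough for the decay n^(-3/2) to
  -- be summable.
  obtain ⟨J, hJI, hJ⟩ : ∃ J ⊆ Iᶜ, J.card = 3 := Finset.exists_subset_card_eq (by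
    rw [Finset.card_compl, Fintype.card_fin, hIm]
    omega)
  have hFJ : ∀ w ∈ F, ∀ i ∈ J, zCoord w i = (fun i => (y i : ZMod N)) i := by
    intro w hw i hi
    rw [hFI] at hw
    obtain ⟨x, hx, rfl⟩ := hw
    rw [zCoord_proj, hx i (Finset.mem_compl.1 (hJI hi))]
  have h9 : ∀ a b : ℝ, 0 ≤ a → 0 ≤ b → (a + b) ^ 3 ≤ 4 * (a ^ 3 + b ^ 3) := by
    intro a b ha hb
    nlinarith [mul_nonneg (add_nonneg ha hb) (sq_nonneg (a - b))]
  have h5 : ∀ k ∈ Finset.range L, (nbrAvg (cylVec d N))^[M + 2]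
      ((nbrAvg (cylVec d N))^[k] (F.indicator fun _ => (1 : ℝ))) z ≤
        4 * Real.exp ((d + 1) / 4) * (1 / (N : ℝ) ^ 3) +
          4 * Real.exp ((d + 1) / 4) * (2 * (d + 1)) ^ 3 *
            (1 / √((k + (M + 2) : ℕ) : ℝ) ^ 3) := by
    intro k _
    rw [← Function.iterate_add_apply]
    have h6 := iterate_nbrAvg_indicator_le hd hJ _ hFJ (n := M + 2 + k) (by omega) z
    rw [show k + (M + 2) = M + 2 + k by omega]
    refine h6.trans ((mul_le_mul_of_nonneg_left (h9 _ _ ?_ ?_) (Real.exp_pos _).le).trans_eq ?_)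
    · positivity
    · positivity
    · ring
  refine (Finset.sum_le_sum h5).trans_eq ?_
  rw [Finset.sum_add_distrib, Finset.sum_const, Finset.card_range, nsmul_eq_mul, ← Finset.mul_sum]
  ring

/-- On large cylinders a lattice section is hardly more recurrent than in the infinite lattice. -/
lemma exists_nbrAvg_hitProb_le {d m : ℕ} (hd : 3 ≤ d) (hm : m ≤ d - 2) {ε : ℝ} (hε : 0 < ε) :
    ∃ N₀ : ℕ, ∀ N : ℕ, N₀ ≤ N → ∀ (j : ℤ), ∀ F ∈ latticeSections d N m, ∀ z ∈ F, ∀ n : ℕ,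
      nbrAvg (cylVec d N) (hitProb (cylVec d N) (outerBlock d N j) F n) z ≤
        sectionReturn d m + ε := by
  obtain ⟨C, hC⟩ : ∃ C : ℝ, C = Real.exp ((d + 1) / 4) := ⟨_, rfl⟩
  have hC0 : 0 < C := hC ▸ Real.exp_pos _
  obtain ⟨c, hc⟩ : ∃ c : ℝ, c = 2 * (d + 1) := ⟨_, rfl⟩
  have hc0 : 0 < c := hc ▸ by positivity
  -- The error ε is split into thirds. `M` makes the tail of Σ n^(-3/2) small; `K` makes survival in
  -- the outer block for L = K N² steps unlikely; `N₁` handles the stationary part of the heat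
  -- kernel, which sums to a multiple of L/N³ = K/N.
  obtain ⟨M, hM⟩ : ∃ M : ℕ, ∑' k : ℕ, 1 / √((k + (M + 2) : ℕ) : ℝ) ^ 3 ≤
      ε / (12 * C * c ^ 3) := by
    have h1 := tendsto_sum_nat_add fun n : ℕ => 1 / √(n : ℝ) ^ 3
    have h2 : ∀ᶠ i in atTop, ∑' k : ℕ, 1 / √((k + i : ℕ) : ℝ) ^ 3 < ε / (12 * C * c ^ 3) :=
      h1.eventually_lt_const (by positivity)
    obtain ⟨M, hM⟩ := eventually_atTop.1 h2
    exact ⟨M, (hM (M + 2) (by omega)).le⟩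
  have hsum : ∀ L : ℕ, ∑ k ∈ Finset.range L, 1 / √((k + (M + 2) : ℕ) : ℝ) ^ 3 ≤
      ε / (12 * C * c ^ 3) := fun L =>
    (((summable_nat_add_iff (f := fun n : ℕ => 1 / √(n : ℝ) ^ 3) (M + 2)).2
      summable_one_div_sqrt_pow_three).sum_le_tsum _ fun k _ => by positivity).trans hM
  obtain ⟨K, hK⟩ := exists_nat_gt (12 * (d + 1) / ε)
  have hK0 : (0 : ℝ) < K := lt_trans (by positivity) hK
  obtain ⟨N₁, hN₁⟩ := exists_nat_gt (12 * C * K / ε)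
  refine ⟨max (M + 2) N₁, fun N hN j F hF z hz n => ?_⟩
  have hNM : M + 2 ≤ N := (le_max_left _ _).trans hN
  have hN1 : 12 * C * K / ε < N := hN₁.trans_le (by exact_mod_cast (le_max_right _ _).trans hN)
  have : NeZero N := ⟨by omega⟩
  have hN0 : (0 : ℝ) < N := by exact_mod_cast Nat.pos_of_ne_zero (NeZero.ne N)
  obtain ⟨L, hL⟩ : ∃ L : ℕ, L = K * N ^ 2 := ⟨_, rfl⟩
  have hLr : (L : ℝ) = K * (N : ℝ) ^ 2 := by rw [hL]; push_cast; rfl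
  set E := cylVec d N with hE
  set D := outerBlock d N j with hD
  set g : Cylinder d N → ℝ := fun x =>
    ∑ k ∈ Finset.range L, (nbrAvg E)^[k] (F.indicator fun _ => (1 : ℝ)) x + survProb E D L x with hg
  have hg0 : ∀ x, 0 ≤ g x := fun x =>
    add_nonneg (Finset.sum_nonneg fun k _ => iterate_nbrAvg_nonneg indicator_one_nonneg _ _)
      (survProb_nonneg _ _)
  have h1 : nbrAvg E (hitProb E D F n) z ≤
      nbrAvg E (hitProb E Set.univ F M) z + (nbrAvg E)^[M + 2] g z := by
    rw [Function.iterate_succ_apply' _ (M + 1), ← nbrAvg_add]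
    exact nbrAvg_mono fun x => hitProb_le_hitProb_univ_add hg0
      (fun n x => hitProb_le_sum_add_survProb L n x) M n x
  have h2 := nbrAvg_hitProb_univ_le (by omega : m ≤ d) (by omega : M + 1 < N) hF hz
  have h3 : (nbrAvg E)^[M + 2] (survProb E D L) z ≤ ε / 3 := by
    rw [← iterate_nbrAvg_const (E := E) (ε / 3) (M + 2) z]
    refine iterate_nbrAvg_mono (fun x => ?_) _ _
    have h4 := mul_survProb_outerBlock_le j L x
    rw [hLr] at h4
    have h6 : (K : ℝ) * survProb E D L x ≤ 4 * (d + 1) := by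
      refine le_of_mul_le_mul_right ?_ (show (0 : ℝ) < (N : ℝ) ^ 2 by positivity)
      linarith
    rw [div_lt_iff₀ hε] at hK
    refine le_of_mul_le_mul_left ?_ hK0
    linarith
  have h4 := sum_iterate_indicator_le hd hm hF L M z
  rw [← hC, ← hc, ← hE] at h4
  have h7 : 4 * C * c ^ 3 * ∑ k ∈ Finset.range L, 1 / √((k + (M + 2) : ℕ) : ℝ) ^ 3 ≤ ε / 3 := by
    refine (mul_le_mul_of_nonneg_left (hsum L) (by positivity)).trans_eq ?_
    field_simp
    norm_num
  have h8 : 4 * C * (L / (N : ℝ) ^ 3) ≤ ε / 3 := by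
    rw [div_lt_iff₀ hε] at hN1
    have h10 : 4 * C * (L / (N : ℝ) ^ 3) = 4 * C * K / N := by
      rw [hLr]
      field_simp
    rw [h10, div_le_iff₀ hN0]
    linarith
  have h5 : (nbrAvg E)^[M + 2] g z = ∑ k ∈ Finset.range L,
      (nbrAvg E)^[M + 2] ((nbrAvg E)^[k] (F.indicator fun _ => (1 : ℝ))) z +
        (nbrAvg E)^[M + 2] (survProb E D L) z := by
    rw [hg, iterate_nbrAvg_add, iterate_nbrAvg_sum]
  linarith

/-! ### Hitting probabilities of finite sets -/

lemma innerBlock_subset_outerBlock {d N : ℕ} {j : ℤ} (hN : 1 ≤ N) : innerBlock d N j ⊆ outerBlock d N j := by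
  rintro z ⟨h1, h2⟩
  have : (1 : ℤ) ≤ N := by exact_mod_cast hN
  constructor <;> nlinarith

lemma block_subset_innerBlock {d N : ℕ} {j : ℤ} : block d N j ⊆ innerBlock d N j := by
  rintro z ⟨h1, h2⟩
  have hN : (0 : ℝ) ≤ N := N.cast_nonneg
  constructor
  · have : ((j : ℝ) - 1) * N ≤ z.2 := by nlinarith
    exact_mod_cast this
  · have : (z.2 : ℝ) ≤ ((j : ℝ) + 1) * N := by nlinarith
    exact_mod_cast this

section HitSet

variable {d N : ℕ} [NeZero N] {j : ℤ} {A : Finset (Cylinder d N)}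

/-- The sum of Green functions with poles in `A` is superharmonic and at least one on `A`. It is
non-negative on the whole slab because heights there differ from those of `A` by less than 3N. -/
lemma hitProb_le_sum_greenFun (hd : 0 < d) (hA : (A : Set (Cylinder d N)) ⊆ block d N j) (n : ℕ)
    {z : Cylinder d N} (hz : |z.2 - j * N| ≤ 2 * N) :
    hitProb (cylVec d N) (outerBlock d N j) A n z ≤
      ∑ x ∈ A, greenFun (greenHeight d N) (z - x) := by
  have hN : (0 : ℝ) ≤ N := N.cast_nonneg
  have hnonneg : ∀ w : Cylinder d N, |w.2 - j * N| ≤ 2 * N → ∀ x ∈ A,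
      0 ≤ greenFun (greenHeight d N) (w - x) := by
    intro w hw x hx
    obtain ⟨h1, h2⟩ := hA hx
    have h3 : |(w.2 : ℝ) - j * N| ≤ 2 * N := by exact_mod_cast hw
    refine greenFun_nonneg hd ?_
    rw [Prod.snd_sub]
    push_cast
    rw [abs_le] at h3 ⊢
    constructor <;> nlinarith
  have hmem : ∀ w ∈ outerBlock d N j, |w.2 - j * N| ≤ 2 * N := by
    rintro w ⟨h1, h2⟩
    rw [abs_le]
    constructor <;> nlinarith
  refine hitProb_le_of_superharmonic (U := {w : Cylinder d N | |w.2 - j * N| ≤ 2 * N})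
    (φ := fun w => ∑ x ∈ A, greenFun (greenHeight d N) (w - x))
    (fun w hw i => outerBlock_step hw i)
    (fun w hw => Finset.sum_nonneg fun x hx => hnonneg w hw x hx) ?_ ?_ n hz
  · intro w hw hwA
    refine le_trans ?_ (Finset.single_le_sum (f := fun x => greenFun (greenHeight d N) (w - x))
      (fun x hx => hnonneg w (hmem w hw) x hx) hwA)
    simp only [sub_self]
    exact one_le_greenFun_zero hd
  · intro w _
    rw [nbrAvg_sum]
    refine Finset.sum_le_sum fun x _ => ?_
    have h1 := nbrAvg_greenFun (greenHeight d N) (w - x)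
    have h2 : nbrAvg (cylVec d N) (fun w => greenFun (greenHeight d N) (w - x)) w =
        nbrAvg (cylVec d N) (greenFun (greenHeight d N)) (w - x) := by
      simp only [nbrAvg, add_sub_right_comm, sub_right_comm]
    rw [h2, h1]
    split_ifs <;> linarith

/-- Height N from the centre is at least N/4 away from `C_j`, which reaches only 3N/4, so each Green
function is of order N^(1-d). -/
lemma hitProb_le_of_far (hd : 0 < d) (hA : (A : Set (Cylinder d N)) ⊆ block d N j) (n : ℕ)
    {z : Cylinder d N} (hz : |z.2 - j * N| = N) :
    hitProb (cylVec d N) (outerBlock d N j) A n z ≤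
      A.card * ((d + 1) * (2 * freqConst d + 3) * (N / (N : ℝ) ^ d)) := by
  have hN : (0 : ℝ) ≤ N := N.cast_nonneg
  refine (hitProb_le_sum_greenFun hd hA n (by omega)).trans ?_
  rw [← nsmul_eq_mul]
  refine Finset.sum_le_card_nsmul _ _ _ fun x hx => greenFun_le_of_le hd ?_
  obtain ⟨h1, h2⟩ := hA hx
  have h3 : |(z.2 : ℝ) - j * N| = N := by exact_mod_cast hz
  rw [Prod.snd_sub]
  push_cast
  rcases (abs_eq hN).1 h3 with h4 | h4
  · exact le_trans (by nlinarith) (le_abs_self _)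
  · exact le_trans (by nlinarith) (neg_le_abs _)

/-- The points of `B_0`. -/
noncomputable def initialBlock (d N : ℕ) [NeZero N] : Finset (Cylinder d N) :=
  Finset.univ ×ˢ Finset.Icc (-(N : ℤ)) N

lemma coe_initialBlock : (initialBlock d N : Set (Cylinder d N)) = innerBlock d N 0 := by
  ext z
  simp [initialBlock, innerBlock]

lemma card_initialBlock : ((initialBlock d N).card : ℝ) = (2 * N + 1) * (N : ℝ) ^ d := by
  have h : (Finset.Icc (-(N : ℤ)) N).card = 2 * N + 1 := by
    rw [Int.card_Icc]
    omega
  rw [initialBlock, Finset.card_product, h, Finset.card_univ, Fintype.card_fun, ZMod.card,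
    Fintype.card_fin]
  push_cast
  ring

-- Near `A` there is no pointwise bound of order N^(1-d), but the sum of a Green function over each
-- horizontal slice is given by the zero mode alone. Slice by slice this yields the same order on
-- average over `B_0`.
open Classical in
lemma sum_hitProb_le (hd : 0 < d) (hA : (A : Set (Cylinder d N)) ⊆ block d N j) (n : ℕ) :
    ∑ z ∈ initialBlock d N, (if z ∈ innerBlock d N j then
        hitProb (cylVec d N) (outerBlock d N j) A n z else 0) ≤
      (initialBlock d N).card * (A.card * ((d + 1) * (freqConst d + 3) * (N / (N : ℝ) ^ d))) := by
  have hN : (0 : ℝ) < N := by exact_mod_cast Nat.pos_of_ne_zero (NeZero.ne N)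
  have hL : 0 ≤ greenHeight d N := by
    have := freqConst_pos d
    unfold greenHeight
    positivity
  have h1 : ∀ s : ℤ, ∑ h : Fin d → ZMod N, (if ((h, s) : Cylinder d N) ∈ innerBlock d N j then
      hitProb (cylVec d N) (outerBlock d N j) A n (h, s) else 0) ≤
      A.card * ((d + 1) * greenHeight d N) := by
    intro s
    by_cases hs : (j - 1) * N ≤ s ∧ s ≤ (j + 1) * N
    · have hmem : ∀ h : Fin d → ZMod N, ((h, s) : Cylinder d N) ∈ innerBlock d N j := fun h => hs
      have hU : |s - j * N| ≤ 2 * N := by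
        rw [abs_le]
        constructor <;> nlinarith [hs.1, hs.2]
      simp only [hmem, if_true]
      calc ∑ h : Fin d → ZMod N, hitProb (cylVec d N) (outerBlock d N j) A n (h, s)
          ≤ ∑ h : Fin d → ZMod N, ∑ x ∈ A, greenFun (greenHeight d N) ((h, s) - x) :=
            Finset.sum_le_sum fun h _ => hitProb_le_sum_greenFun hd hA n hU
        _ = ∑ x ∈ A, ∑ h : Fin d → ZMod N, greenFun (greenHeight d N) ((h, s) - x) :=
            Finset.sum_comm
        _ ≤ ∑ _x ∈ A, (d + 1) * greenHeight d N := by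
            refine Finset.sum_le_sum fun x _ => ?_
            have h2 := Equiv.sum_comp (Equiv.subRight x.1)
              fun h => greenFun (greenHeight d N) ((h, s - x.2) : Cylinder d N)
            rw [sum_greenFun] at h2
            refine (h2.le : _ ≤ _).trans ?_
            gcongr
            linarith [abs_nonneg (((s - x.2 : ℤ)) : ℝ)]
        _ = _ := by rw [Finset.sum_const, nsmul_eq_mul]
    · have hmem : ∀ h : Fin d → ZMod N, ((h, s) : Cylinder d N) ∉ innerBlock d N j := fun h => hs
      simp only [hmem, if_false, Finset.sum_const_zero]
      positivity
  have hcard : (Finset.Icc (-(N : ℤ)) N).card = 2 * N + 1 := by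
    rw [Int.card_Icc]
    omega
  rw [initialBlock, Finset.sum_product_right]
  refine (Finset.sum_le_sum fun s _ => h1 s).trans ?_
  rw [Finset.sum_const, hcard, nsmul_eq_mul, ← initialBlock, card_initialBlock, greenHeight]
  push_cast
  apply le_of_eq
  field_simp

end HitSet

/-! ### Entrance times along a path -/

section Entrance

variable {G : Type*} {U : Set G} {t : ℕ∞} {ω : ℕ → G}

lemma entranceFrom_le {n : ℕ} (ht : t ≤ n) (hn : ω n ∈ U) : entranceFrom U t ω ≤ n :=
  iInf₂_le n ⟨ht, hn⟩

lemma le_entranceFrom {a : ℕ∞} (h : ∀ n : ℕ, t ≤ n → ω n ∈ U → a ≤ n) :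
    a ≤ entranceFrom U t ω :=
  le_iInf₂ fun n hn => h n hn.1 hn.2

lemma entranceFrom_eq_coe {n : ℕ} (h : entranceFrom U t ω = n) : t ≤ n ∧ ω n ∈ U := by
  have h1 : entranceFrom U t ω < (n + 1 : ℕ) := by
    rw [h]
    exact_mod_cast n.lt_succ_self
  simp only [entranceFrom, iInf_lt_iff] at h1
  obtain ⟨k, hk, hkn⟩ := h1
  have h2 : (n : ℕ∞) ≤ k := h ▸ entranceFrom_le hk.1 hk.2
  have h3 : k < n + 1 := by exact_mod_cast hkn
  have h4 : n ≤ k := by exact_mod_cast h2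
  obtain rfl : k = n := by omega
  exact hk

lemma entranceFrom_prepend (z : G) :
    entranceFrom U (t + 1) (prepend z ω) = entranceFrom U t ω + 1 := by
  refine le_antisymm ?_ (le_entranceFrom fun n hn hU => ?_)
  · cases h : entranceFrom U t ω with
    | top => simp
    | coe n =>
      obtain ⟨h1, h2⟩ := entranceFrom_eq_coe h
      refine (entranceFrom_le (n := n + 1) ?_ h2).trans ?_
      · push_cast
        gcongr
      · push_cast
        exact le_rfl
  · cases n with
    | zero =>
      exfalso
      simp at hn
    | succ n =>
      push_cast at hn ⊢
      gcongr
      exact entranceFrom_le (by simpa using hn) hU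

lemma entranceFrom_prepend_of_mem {z : G} (hz : z ∈ U) : entranceFrom U 0 (prepend z ω) = 0 := by
  have := entranceFrom_le (t := 0) (ω := prepend z ω) (n := 0) (by simp) hz
  simpa using this

lemma entranceFrom_prepend_of_notMem {z : G} (hz : z ∉ U) :
    entranceFrom U 0 (prepend z ω) = entranceFrom U 0 ω + 1 := by
  rw [← entranceFrom_prepend z]
  refine le_antisymm (le_entranceFrom fun n hn hU => entranceFrom_le (by simp) hU)
    (le_entranceFrom fun n hn hU => entranceFrom_le ?_ hU)
  cases n with
  | zero => exact absurd hU hz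
  | succ n => simp

lemma measurable_entranceFrom [MeasurableSpace G] [DiscreteMeasurableSpace G]
    {τ : (ℕ → G) → ℕ∞} (hτ : Measurable τ) :
    Measurable fun ω : ℕ → G => entranceFrom U (τ ω) ω := by
  have hT : ∀ k : ℕ, MeasurableSet {ω : ℕ → G | τ ω ≤ k ∧ ω k ∈ U} := fun k =>
    (hτ (MeasurableSet.of_discrete (s := Set.Iic (k : ℕ∞)))).inter
      (measurable_pi_apply (X := fun _ => G) k (MeasurableSet.of_discrete (s := U)))
  refine ENat.measurable_iff.2 fun n => ?_
  have h : (fun ω : ℕ → G => entranceFrom U (τ ω) ω) ⁻¹' {(n : ℕ∞)} =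
      {ω | τ ω ≤ n ∧ ω n ∈ U} \ ⋃ k ∈ Finset.range n, {ω : ℕ → G | τ ω ≤ k ∧ ω k ∈ U} := by
    ext ω
    simp only [Set.mem_preimage, Set.mem_singleton_iff, Set.mem_sdiff, Set.mem_ofPred_eq,
      Set.mem_iUnion, Finset.mem_range, not_exists]
    constructor
    · intro hω
      refine ⟨entranceFrom_eq_coe hω, fun k hk hk' => ?_⟩
      have h1 : (n : ℕ∞) ≤ k := hω ▸ entranceFrom_le hk'.1 hk'.2
      have h2 : n ≤ k := by exact_mod_cast h1
      omega
    · rintro ⟨hn, hk⟩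
      refine le_antisymm (entranceFrom_le hn.1 hn.2) (le_entranceFrom fun k hk1 hk2 => ?_)
      have h1 : n ≤ k := not_lt.1 fun hlt => hk k hlt ⟨hk1, hk2⟩
      exact_mod_cast h1
  rw [h]
  exact (hT n).diff (Finset.measurableSet_biUnion _ fun k _ => hT k)

end Entrance

/-! ### Excursions -/

section Excursion

variable {G : Type*} (B D : Set G)

/-- The first exit from `D` after the first visit to `B` from time `t` on. -/
noncomputable def nextExit (ω : ℕ → G) (t : ℕ∞) : ℕ∞ := entranceFrom Dᶜ (entranceFrom B t ω) ω

/-- The end of the `k`-th excursion. -/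
noncomputable def excursionEnd (k : ℕ) (ω : ℕ → G) : ℕ∞ := (nextExit B D ω)^[k] 0

/-- The end of the `k`-th excursion after the first exit from `D`. -/
noncomputable def exitThenExcursionEnd (k : ℕ) (ω : ℕ → G) : ℕ∞ :=
  (nextExit B D ω)^[k] (entranceFrom Dᶜ 0 ω)

lemma departure_eq_excursionEnd (d N : ℕ) (j : ℤ) (k : ℕ) (ω : ℕ → Cylinder d N) :
    departure d N j k ω = excursionEnd (innerBlock d N j) (outerBlock d N j) k ω := by
  induction k with
  | zero => rfl
  | succ k ih =>
    rw [excursionEnd, Function.iterate_succ_apply', ← excursionEnd, ← ih]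
    rfl

variable {B D}

lemma iterate_nextExit_prepend (z : G) (ω : ℕ → G) (k : ℕ) (t : ℕ∞) :
    (nextExit B D (prepend z ω))^[k] (t + 1) = (nextExit B D ω)^[k] t + 1 := by
  induction k with
  | zero => rfl
  | succ k ih =>
    rw [Function.iterate_succ_apply', Function.iterate_succ_apply', ih, nextExit,
      entranceFrom_prepend, entranceFrom_prepend, nextExit]

lemma exitThenExcursionEnd_prepend_of_mem {z : G} (hz : z ∈ D) (k : ℕ) (ω : ℕ → G) :
    exitThenExcursionEnd B D k (prepend z ω) = exitThenExcursionEnd B D k ω + 1 := by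
  rw [exitThenExcursionEnd, entranceFrom_prepend_of_notMem (by simpa using hz),
    iterate_nextExit_prepend, exitThenExcursionEnd]

lemma exitThenExcursionEnd_prepend_of_notMem {z : G} (hz : z ∉ D) (k : ℕ) (ω : ℕ → G) :
    exitThenExcursionEnd B D k (prepend z ω) = excursionEnd B D k (prepend z ω) := by
  rw [exitThenExcursionEnd, entranceFrom_prepend_of_mem (by simpa using hz), excursionEnd]

lemma excursionEnd_succ_prepend_of_mem {z : G} (hz : z ∈ B) (k : ℕ) (ω : ℕ → G) :
    excursionEnd B D (k + 1) (prepend z ω) = exitThenExcursionEnd B D k (prepend z ω) := by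
  rw [excursionEnd, Function.iterate_succ_apply, nextExit, entranceFrom_prepend_of_mem hz,
    exitThenExcursionEnd]

lemma excursionEnd_succ_prepend_of_notMem {z : G} (hz : z ∉ B) (k : ℕ) (ω : ℕ → G) :
    excursionEnd B D (k + 1) (prepend z ω) = excursionEnd B D (k + 1) ω + 1 := by
  rw [excursionEnd, Function.iterate_succ_apply, nextExit, entranceFrom_prepend_of_notMem hz,
    entranceFrom_prepend, iterate_nextExit_prepend, excursionEnd, Function.iterate_succ_apply,
    nextExit]

section Measurability

variable [MeasurableSpace G] [DiscreteMeasurableSpace G]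

lemma measurable_iterate_nextExit {τ : (ℕ → G) → ℕ∞} (hτ : Measurable τ) (k : ℕ) :
    Measurable fun ω : ℕ → G => (nextExit B D ω)^[k] (τ ω) := by
  induction k with
  | zero => exact hτ
  | succ k ih =>
    simp only [Function.iterate_succ_apply']
    exact measurable_entranceFrom (measurable_entranceFrom ih)

lemma measurable_excursionEnd (k : ℕ) : Measurable (excursionEnd B D k) :=
  measurable_iterate_nextExit measurable_const k

lemma measurable_exitThenExcursionEnd (k : ℕ) : Measurable (exitThenExcursionEnd B D k) :=
  measurable_iterate_nextExit (measurable_entranceFrom measurable_const) k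

end Measurability

open Classical in
/-- The number of visits to `A` before the times `n` and `τ`. -/
noncomputable def visitsBefore (A : Set G) (n : ℕ) (τ : ℕ∞) (ω : ℕ → G) : ℕ :=
  ∑ i ∈ Finset.range n, if ω i ∈ A ∧ (i : ℕ∞) < τ then 1 else 0

open Classical in
lemma visitsBefore_prepend (A : Set G) (n : ℕ) (τ : ℕ∞) (z : G) (ω : ℕ → G) :
    visitsBefore A (n + 1) (τ + 1) (prepend z ω) =
      (if z ∈ A then 1 else 0) + visitsBefore A n τ ω := by
  rw [visitsBefore, Finset.sum_range_succ', visitsBefore, add_comm]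
  congr 1
  · have : (0 : ℕ∞) < τ + 1 := by simp
    simp [this]
  · refine Finset.sum_congr rfl fun i _ => ?_
    have : ((i + 1 : ℕ) : ℕ∞) < τ + 1 ↔ (i : ℕ∞) < τ := by
      push_cast
      exact ENat.add_lt_add_iff_right (by simp)
    simp only [prepend_succ, this]

lemma visitsBefore_zero (A : Set G) (n : ℕ) (ω : ℕ → G) : visitsBefore A n 0 ω = 0 := by
  simp [visitsBefore]

lemma visitsBefore_mono (A : Set G) (τ : ℕ∞) (ω : ℕ → G) :
    Monotone fun n => visitsBefore A n τ ω := fun _ _ h =>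
  Finset.sum_le_sum_of_subset (Finset.range_mono h)

/-- The exponential weight of the visits. -/
noncomputable def visitWeight (lam : ℝ) (A : Set G) (n : ℕ) (τ : ℕ∞) (ω : ℕ → G) : ENNReal :=
  ENNReal.ofReal (Real.exp (lam * visitsBefore A n τ ω))

lemma measurable_visitWeight [MeasurableSpace G] [DiscreteMeasurableSpace G] (lam : ℝ) (A : Set G)
    (n : ℕ) {τ : (ℕ → G) → ℕ∞} (hτ : Measurable τ) :
    Measurable fun ω : ℕ → G => visitWeight lam A n (τ ω) ω := by
  classical
  have h : Measurable fun ω : ℕ → G => visitsBefore A n (τ ω) ω := by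
    unfold visitsBefore
    refine Finset.measurable_sum _ fun i _ => Measurable.ite ?_ measurable_const measurable_const
    exact (measurable_pi_apply (X := fun _ => G) i (MeasurableSet.of_discrete (s := A))).inter
      (hτ (MeasurableSet.of_discrete (s := Set.Ioi (i : ℕ∞))))
  unfold visitWeight
  have h2 : Measurable fun n : ℕ => ENNReal.ofReal (Real.exp (lam * n)) :=
    measurable_of_countable _
  exact h2.comp h

end Excursion

/-! ### The exponential moment of the number of visits -/

section Moment

variable {G ι : Type*} [AddCommGroup G] [Fintype ι] [Nonempty ι] {E : ι → G} {S : Set G}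
  {A B D : Set G} {lam ρ η : ℝ}

/-- The factor in the one-excursion estimate. -/
noncomputable def excursionFactor (lam ρ : ℝ) : ℝ := (Real.exp lam - 1) / (1 - Real.exp lam * ρ)

lemma excursionFactor_nonneg (hlam : 0 ≤ lam) (hρ : Real.exp lam * ρ < 1) :
    0 ≤ excursionFactor lam ρ :=
  div_nonneg (by linarith [Real.add_one_le_exp lam]) (by linarith)

open Classical in
/-- The bound for walks that have not yet begun an excursion. -/
noncomputable def outsideBound (E : ι → G) (A B D : Set G) (gam W : ℝ) (n : ℕ) : ℕ → G → ℝ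
  | 0, _ => 1
  | k + 1, z => if z ∈ B then (1 + gam * hitProb E D A n z) * W ^ k else W ^ (k + 1)

variable [MeasurableSpace G] [DiscreteMeasurableSpace G] [MeasurableAdd₂ G]

lemma lintegral_congr_start (h : IsStepSet S E) (z : G) {f g : (ℕ → G) → ENNReal}
    (hf : Measurable f) (hg : Measurable g) (hfg : ∀ ω, f (prepend z ω) = g (prepend z ω)) :
    ∫⁻ ω, f ω ∂walkLaw (Measure.dirac z) S = ∫⁻ ω, g ω ∂walkLaw (Measure.dirac z) S := by
  rw [h.lintegral_walkLaw z hf, h.lintegral_walkLaw z hg]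
  simp only [hfg]

/-- Exponential moments of the number of visits to `A` during the first excursions. -/
lemma lintegral_visitWeight_le (h : IsStepSet S E) (hAB : A ⊆ B) (hBD : B ⊆ D) (hlam : 0 ≤ lam)
    (hρ : Real.exp lam * ρ < 1) (hη : 0 ≤ η)
    (hret : ∀ z ∈ A, ∀ n, nbrAvg E (hitProb E D A n) z ≤ ρ)
    (hent : ∀ z ∉ B, ∀ i n, (z + E i ∈ B → hitProb E D A n (z + E i) ≤ η) ∧
      (z - E i ∈ B → hitProb E D A n (z - E i) ≤ η)) (n : ℕ) :
    (∀ k z, ∫⁻ ω, visitWeight lam A n (exitThenExcursionEnd B D k ω) ω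
        ∂walkLaw (Measure.dirac z) S ≤
      ENNReal.ofReal ((1 + excursionFactor lam ρ * hitProb E D A n z) *
        (1 + excursionFactor lam ρ * η) ^ k)) ∧
    ∀ k z, ∫⁻ ω, visitWeight lam A n (excursionEnd B D k ω) ω ∂walkLaw (Measure.dirac z) S ≤
      ENNReal.ofReal (outsideBound E A B D (excursionFactor lam ρ)
        (1 + excursionFactor lam ρ * η) n k z) := by
  classical
  have := h.isProbabilityMeasure
  have hgam : 0 ≤ excursionFactor lam ρ := excursionFactor_nonneg hlam hρ
  -- Equivalently e^λ (1 + γρ) = 1 + γ: the weight e^λ of a visit together with the chance ρ of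
  -- another one reproduces the value 1 + γ on `A`.
  have hgam_eq : excursionFactor lam ρ * (1 - Real.exp lam * ρ) = Real.exp lam - 1 :=
    div_mul_cancel₀ _ (by linarith)
  set gam := excursionFactor lam ρ with hgam_def
  set W : ℝ := 1 + gam * η with hW
  have hW1 : 1 ≤ W := by
    have := mul_nonneg hgam hη
    linarith
  have hw1 : ∀ n z, 1 ≤ 1 + gam * hitProb E D A n z := fun n z => by
    have := mul_nonneg hgam (hitProb_nonneg (E := E) (D := D) (F := A) n z)
    linarith
  have hin0 : ∀ n k z, 0 ≤ (1 + gam * hitProb E D A n z) * W ^ k := fun n k z =>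
    mul_nonneg (by linarith [hw1 n z]) (by positivity)
  have hout1 : ∀ n k z, 1 ≤ outsideBound E A B D gam W n k z := by
    intro n k z
    cases k with
    | zero => exact le_rfl
    | succ k =>
      simp only [outsideBound]
      split_ifs
      · exact one_le_mul_of_one_le_of_one_le (hw1 n z) (one_le_pow₀ hW1)
      · exact one_le_pow₀ hW1
  have hmIn : ∀ n k, Measurable fun ω : ℕ → G =>
      visitWeight lam A n (exitThenExcursionEnd B D k ω) ω := fun n k =>
    measurable_visitWeight lam A n (measurable_exitThenExcursionEnd k)
  have hmOut : ∀ n k, Measurable fun ω : ℕ → G =>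
      visitWeight lam A n (excursionEnd B D k ω) ω := fun n k =>
    measurable_visitWeight lam A n (measurable_excursionEnd k)
  induction n with
  | zero =>
    have h0 : ∀ (τ : ℕ∞) (ω : ℕ → G), visitWeight lam A 0 τ ω = 1 := fun τ ω => by
      simp [visitWeight, visitsBefore]
    simp only [h0, lintegral_one, measure_univ]
    refine ⟨fun k z => ?_, fun k z => ?_⟩
    · exact ENNReal.one_le_ofReal.2 (one_le_mul_of_one_le_of_one_le (hw1 0 z) (one_le_pow₀ hW1))
    · exact ENNReal.one_le_ofReal.2 (hout1 0 k z)
  | succ n ih =>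
    obtain ⟨ihIn, ihOut⟩ := ih
    -- At horizon n + 1 the two bounds refer to each other without a step in between: a start in `B`
    -- begins an excursion at once, a start outside `D` ends one at once. Treating starts in `D`
    -- separately avoids a circle, since B ⊆ D.
    have hIn : ∀ k, ∀ z ∈ D, ∫⁻ ω, visitWeight lam A (n + 1) (exitThenExcursionEnd B D k ω) ω
        ∂walkLaw (Measure.dirac z) S ≤
        ENNReal.ofReal ((1 + gam * hitProb E D A (n + 1) z) * W ^ k) := by
      intro k z hz
      set a : ℝ := Real.exp (lam * (if z ∈ A then 1 else 0)) with ha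
      have ha0 : 0 < a := Real.exp_pos _
      have hstep := h.lintegral_walkLaw_le z (hmIn (n + 1) k)
        (φ := fun x => a * ((1 + gam * hitProb E D A n x) * W ^ k))
        (fun x => mul_nonneg ha0.le (hin0 n k x)) fun x => by
          have h1 : ∀ ω, visitWeight lam A (n + 1) (exitThenExcursionEnd B D k (prepend z ω))
              (prepend z ω) =
              ENNReal.ofReal a * visitWeight lam A n (exitThenExcursionEnd B D k ω) ω := by
            intro ω
            rw [exitThenExcursionEnd_prepend_of_mem hz, visitWeight, visitsBefore_prepend,
              visitWeight, ← ENNReal.ofReal_mul ha0.le, ha, ← Real.exp_add]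
            congr 2
            push_cast
            split_ifs <;> ring
          simp only [h1]
          rw [lintegral_const_mul _ (hmIn n k), ENNReal.ofReal_mul ha0.le]
          gcongr
          exact ihIn k x
      refine hstep.trans (ENNReal.ofReal_le_ofReal ?_)
      have h2 : nbrAvg E (fun x => a * ((1 + gam * hitProb E D A n x) * W ^ k)) z =
          a * (1 + gam * nbrAvg E (hitProb E D A n) z) * W ^ k := by
        have h3 : (fun x => a * ((1 + gam * hitProb E D A n x) * W ^ k)) =
            fun x => (a * W ^ k) * (1 + gam * hitProb E D A n x) := by
          funext x
          ring
        rw [h3, nbrAvg_const_mul, nbrAvg_add, nbrAvg_const, nbrAvg_const_mul]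
        ring
      rw [h2]
      gcongr
      -- On `A` the equation for γ closes the estimate; off `A` the function 1 + γ h satisfies the
      -- averaging identity exactly.
      by_cases hzA : z ∈ A
      · rw [hitProb_of_mem _ hz hzA, ha, if_pos hzA, mul_one]
        have h4 := mul_le_mul_of_nonneg_left (hret z hzA n)
          (mul_nonneg (Real.exp_pos lam).le hgam)
        linarith
      · rw [hitProb_succ n hz hzA, ha, if_neg hzA, mul_zero, Real.exp_zero, one_mul]
    have hOut : ∀ k z, ∫⁻ ω, visitWeight lam A (n + 1) (excursionEnd B D k ω) ω
        ∂walkLaw (Measure.dirac z) S ≤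
        ENNReal.ofReal (outsideBound E A B D gam W (n + 1) k z) := by
      intro k z
      cases k with
      | zero =>
        have h1 : ∀ ω : ℕ → G, visitWeight lam A (n + 1) (excursionEnd B D 0 ω) ω = 1 := by
          intro ω
          rw [excursionEnd, Function.iterate_zero_apply, visitWeight, visitsBefore_zero]
          simp
        simp [h1, outsideBound]
      | succ k =>
        by_cases hz : z ∈ B
        · rw [lintegral_congr_start h z (hmOut (n + 1) (k + 1)) (hmIn (n + 1) k) fun ω => by
            rw [excursionEnd_succ_prepend_of_mem hz]]
          simpa only [outsideBound, hz, if_true] using hIn k z (hBD hz)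
        · have hstep := h.lintegral_walkLaw_le z (hmOut (n + 1) (k + 1))
            (φ := outsideBound E A B D gam W n (k + 1))
            (fun x => zero_le_one.trans (hout1 n (k + 1) x)) fun x => by
              have h1 : ∀ ω, visitWeight lam A (n + 1) (excursionEnd B D (k + 1) (prepend z ω))
                  (prepend z ω) = visitWeight lam A n (excursionEnd B D (k + 1) ω) ω := by
                intro ω
                rw [excursionEnd_succ_prepend_of_notMem hz, visitWeight, visitsBefore_prepend,
                  if_neg fun hA => hz (hAB hA), zero_add, visitWeight]
              simp only [h1]
              exact ihOut (k + 1) x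
          refine hstep.trans (ENNReal.ofReal_le_ofReal ?_)
          -- When the walk enters `B`, the hitting probability is at most η, so the pending
          -- excursion turns into one more factor W.
          have hbd : ∀ x, (x ∈ B → hitProb E D A n x ≤ η) →
              outsideBound E A B D gam W n (k + 1) x ≤ W ^ (k + 1) := by
            intro x hx
            simp only [outsideBound]
            split_ifs with hxB
            · rw [pow_succ', hW]
              gcongr
              exact hx hxB
            · exact le_rfl
          rw [show outsideBound E A B D gam W (n + 1) (k + 1) z = W ^ (k + 1) by
            simp [outsideBound, hz]]
          exact nbrAvg_le_of_forall fun i =>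
            ⟨hbd _ (hent z hz i n).1, hbd _ (hent z hz i n).2⟩
    refine ⟨fun k z => ?_, hOut⟩
    by_cases hz : z ∈ D
    · exact hIn k z hz
    · rw [lintegral_congr_start h z (hmIn (n + 1) k) (hmOut (n + 1) k) fun ω => by
        rw [exitThenExcursionEnd_prepend_of_notMem hz]]
      refine (hOut k z).trans (ENNReal.ofReal_le_ofReal ?_)
      rw [hitProb_of_notMem _ hz, mul_zero, add_zero, one_mul]
      cases k with
      | zero => simp [outsideBound]
      | succ k => simp [outsideBound, show z ∉ B from fun hB => hz (hBD hB)]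

end Moment

/-! ### The excursions are finite -/

lemma measurableSet_forall_le_mem {G : Type*} [MeasurableSpace G] [DiscreteMeasurableSpace G]
    {D : Set G} (n : ℕ) :
    MeasurableSet {ω : ℕ → G | ∀ i, i ≤ n → ω i ∈ D} := by
  have h : {ω : ℕ → G | ∀ i, i ≤ n → ω i ∈ D} =
      ⋂ i ∈ Finset.range (n + 1), (fun ω : ℕ → G => ω i) ⁻¹' D := by
    ext ω
    simp
  rw [h]
  exact Finset.measurableSet_biInter _ fun i _ =>
    measurable_pi_apply (X := fun _ => G) i (MeasurableSet.of_discrete (s := D))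

section Recurrence

variable {G ι : Type*} [AddCommGroup G] [Fintype ι] [Nonempty ι] {E : ι → G} {S D : Set G}
  [MeasurableSpace G] [DiscreteMeasurableSpace G] [MeasurableAdd₂ G]

lemma measure_walkLaw_prepend (h : IsStepSet S E) (z : G) {Q Q' : Set (ℕ → G)}
    (hQ : MeasurableSet Q) (hQ' : MeasurableSet Q') (hsub : ∀ ω, prepend z ω ∈ Q → ω ∈ Q')
    {φ : G → ℝ} (hφ : ∀ x, 0 ≤ φ x)
    (hle : ∀ x, walkLaw (Measure.dirac x) S Q' ≤ ENNReal.ofReal (φ x)) :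
    walkLaw (Measure.dirac z) S Q ≤ ENNReal.ofReal (nbrAvg E φ z) := by
  rw [← one_mul (walkLaw _ _ _), ← lintegral_indicator_const hQ]
  refine h.lintegral_walkLaw_le z (measurable_const.indicator hQ) hφ fun x => ?_
  refine le_trans ?_ (hle x)
  rw [← one_mul (walkLaw _ _ _), ← lintegral_indicator_const hQ']
  refine lintegral_mono fun ω => ?_
  by_cases hω : prepend z ω ∈ Q
  · rw [Set.indicator_of_mem hω, Set.indicator_of_mem (hsub ω hω)]
  · rw [Set.indicator_of_notMem hω]
    exact zero_le

lemma walkLaw_forall_le_mem_le (h : IsStepSet S E) (n : ℕ) (z : G) :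
    walkLaw (Measure.dirac z) S {ω | ∀ i, i ≤ n → ω i ∈ D} ≤
      ENNReal.ofReal (survProb E D n z) := by
  have := h.isProbabilityMeasure
  have hnot : ∀ n, z ∉ D → walkLaw (Measure.dirac z) S {ω | ∀ i, i ≤ n → ω i ∈ D} ≤
      ENNReal.ofReal 0 := by
    intro n hz
    refine (measure_walkLaw_prepend h z (measurableSet_forall_le_mem n) MeasurableSet.empty
      (fun ω hω => hz (hω 0 n.zero_le)) (φ := fun _ => 0) (fun _ => le_rfl) (by simp)).trans_eq ?_
    rw [nbrAvg_const]
  induction n generalizing z with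
  | zero =>
    by_cases hz : z ∈ D
    · simpa [survProb, hz] using prob_le_one
    · rw [survProb_of_notMem _ hz]
      exact hnot _ hz
  | succ n ih =>
    by_cases hz : z ∈ D
    · have h1 : survProb E D (n + 1) z = nbrAvg E (survProb E D n) z := by simp [survProb, hz]
      rw [h1]
      refine measure_walkLaw_prepend h z (measurableSet_forall_le_mem (n + 1))
        (measurableSet_forall_le_mem n) (fun ω hω i hi => hω (i + 1) (by omega))
        (survProb_nonneg n) fun x => ih x fun n hx => ?_
      refine (measure_walkLaw_prepend h x (measurableSet_forall_le_mem n) MeasurableSet.empty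
        (fun ω hω => hx (hω 0 n.zero_le)) (φ := fun _ => 0) (fun _ => le_rfl)
        (by simp)).trans_eq ?_
      rw [nbrAvg_const]
    · rw [survProb_of_notMem _ hz]
      exact hnot _ hz

/-- If the survival probabilities in `D` vanish, then the walk is infinitely often outside `D`. -/
lemma ae_exists_ge_notMem (h : IsStepSet S E)
    (hs : ∀ z, Tendsto (fun n => survProb E D n z) atTop (nhds 0)) (z : G) :
    ∀ᵐ ω ∂walkLaw (Measure.dirac z) S, ∀ n : ℕ, ∃ i, n ≤ i ∧ ω i ∉ D := by
  have hmeas : ∀ n : ℕ, MeasurableSet {ω : ℕ → G | ∀ i, n ≤ i → ω i ∈ D} := by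
    intro n
    have h1 : {ω : ℕ → G | ∀ i, n ≤ i → ω i ∈ D} =
        ⋂ i, ⋂ (_ : n ≤ i), (fun ω : ℕ → G => ω i) ⁻¹' D := by
      ext ω
      simp
    rw [h1]
    exact MeasurableSet.iInter fun i => MeasurableSet.iInter fun _ =>
      measurable_pi_apply (X := fun _ => G) i (MeasurableSet.of_discrete (s := D))
  have hnull : ∀ (n : ℕ) (z : G),
      walkLaw (Measure.dirac z) S {ω | ∀ i, n ≤ i → ω i ∈ D} = 0 := by
    intro n
    induction n with
    | zero =>
      intro z
      have h1 : Tendsto (fun n => ENNReal.ofReal (survProb E D n z)) atTop (nhds 0) := by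
        simpa using ENNReal.tendsto_ofReal (hs z)
      refine le_antisymm (ge_of_tendsto' h1 fun n => ?_) zero_le
      exact (measure_mono (s := {ω : ℕ → G | ∀ i, 0 ≤ i → ω i ∈ D})
        (t := {ω | ∀ i, i ≤ n → ω i ∈ D}) fun ω hω i _ => hω i i.zero_le).trans (walkLaw_forall_le_mem_le h n z)
    | succ n ih =>
      intro z
      have h1 := measure_walkLaw_prepend h z (hmeas (n + 1)) (hmeas n)
        (fun ω hω i hi => hω (i + 1) (by omega)) (φ := fun _ => 0) (fun _ => le_rfl)
        fun x => by rw [ih x]; exact zero_le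
      rw [nbrAvg_const, ENNReal.ofReal_zero] at h1
      exact le_antisymm h1 zero_le
  rw [ae_all_iff]
  intro n
  rw [ae_iff, ← hnull n z]
  congr 1
  ext ω
  simp

end Recurrence

lemma excursionEnd_lt_top {G : Type*} {B D : Set G} {ω : ℕ → G}
    (hB : ∀ n : ℕ, ∃ i, n ≤ i ∧ ω i ∉ Bᶜ) (hD : ∀ n : ℕ, ∃ i, n ≤ i ∧ ω i ∉ D) (k : ℕ) :
    excursionEnd B D k ω < ⊤ := by
  have hstep : ∀ (U : Set G) (t : ℕ∞), (∀ n : ℕ, ∃ i, n ≤ i ∧ ω i ∉ Uᶜ) → t < ⊤ →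
      entranceFrom U t ω < ⊤ := by
    intro U t hU ht
    lift t to ℕ using ht.ne
    obtain ⟨i, hi, hiU⟩ := hU t
    exact entranceFrom_lt_top_iff.2 ⟨i, by exact_mod_cast hi, by simpa using hiU⟩
  induction k with
  | zero => exact ENat.natCast_lt_top 0
  | succ k ih =>
    rw [excursionEnd, Function.iterate_succ_apply']
    exact hstep _ _ (by simpa using hD) (hstep _ _ hB ih)

/-! ### All departure times on the cylinder are almost surely finite. -/

section CylinderRecurrence

variable {d N : ℕ}

lemma tendsto_survProb_outerBlock (j : ℤ) (z : Cylinder d N) :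
    Tendsto (fun n => survProb (cylVec d N) (outerBlock d N j) n z) atTop (nhds 0) := by
  have h1 : Tendsto (fun n : ℕ => 4 * (d + 1) * (N : ℝ) ^ 2 / n) atTop (nhds 0) :=
    tendsto_const_div_atTop_nhds_zero_nat _
  refine tendsto_of_tendsto_of_tendsto_of_le_of_le' tendsto_const_nhds h1
    (Eventually.of_forall fun n => survProb_nonneg n z) ?_
  filter_upwards [eventually_gt_atTop 0] with n hn
  rw [le_div_iff₀ (by exact_mod_cast hn), mul_comm]
  exact mul_survProb_outerBlock_le j n z

/-- The vertical coordinate is recurrent. -/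
lemma mul_survProb_compl_innerBlock_le (j : ℤ) {R : ℕ} (hR : 0 < R) (n : ℕ) (z : Cylinder d N) :
    n * survProb (cylVec d N) (innerBlock d N j)ᶜ n z ≤
      (d + 1) * (R : ℝ) ^ 2 + n * (|(z.2 : ℝ) - j * N| / R) := by
  have hR' : (0 : ℝ) < R := by exact_mod_cast hR
  have hfar : ∀ (n : ℕ) (w : Cylinder d N), (R : ℝ) ≤ |(w.2 : ℝ) - j * N| →
      n * survProb (cylVec d N) (innerBlock d N j)ᶜ n w ≤ n * (|(w.2 : ℝ) - j * N| / R) := by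
    intro n w hw
    have h1 : 1 ≤ |(w.2 : ℝ) - j * N| / R := (one_le_div hR').2 hw
    gcongr
    exact (survProb_le_one n w).trans h1
  -- Let s be the height relative to jN. The term (d+1)(R² - s²) accounts for the exit time from the
  -- strip |s| < R, and |s|/R for the chance to reach height R before the inner block. The latter is
  -- harmonic except at s = 0, which lies in the block.
  have hnear : ∀ (n : ℕ) (w : Cylinder d N), |(w.2 : ℝ) - j * N| ≤ R →
      n * survProb (cylVec d N) (innerBlock d N j)ᶜ n w ≤
        (d + 1) * ((R : ℝ) ^ 2 - ((w.2 : ℝ) - j * N) ^ 2) + n * (|(w.2 : ℝ) - j * N| / R) := by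
    intro n
    induction n with
    | zero =>
      intro w hw
      have h1 : ((w.2 : ℝ) - j * N) ^ 2 ≤ (R : ℝ) ^ 2 := sq_le_sq' (abs_le.1 hw).1 (abs_le.1 hw).2
      have h2 : 0 ≤ (R : ℝ) ^ 2 - ((w.2 : ℝ) - j * N) ^ 2 := by linarith
      simp only [Nat.cast_zero, zero_mul, add_zero]
      positivity
    | succ n ih =>
      intro w hw
      rcases hw.lt_or_eq with hlt | heq
      · by_cases hwB : w ∈ (innerBlock d N j)ᶜ
        · have hs0 : w.2 - j * N ≠ 0 := by
            intro h0
            refine hwB ⟨?_, ?_⟩ <;> nlinarith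
          have hint : |w.2 - j * N| + 1 ≤ R := by
            have : |w.2 - j * N| < R := by exact_mod_cast hlt
            omega
          have hnbr : ∀ x : Cylinder d N, |x.2 - w.2| ≤ 1 → |(x.2 : ℝ) - j * N| ≤ R := by
            intro x hx
            have h1 := abs_sub_le x.2 w.2 (j * N)
            have h2 : |x.2 - j * N| ≤ R := by omega
            exact_mod_cast h2
          have havg : n * nbrAvg (cylVec d N) (survProb (cylVec d N) (innerBlock d N j)ᶜ n) w ≤
              nbrAvg (cylVec d N) (fun x => (d + 1) * ((R : ℝ) ^ 2 - ((x.2 : ℝ) - j * N) ^ 2) +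
                n * (|(x.2 : ℝ) - j * N| / R)) w := by
            rw [← nbrAvg_const_mul]
            exact nbrAvg_le_nbrAvg fun i =>
              ⟨ih _ (hnbr _ (abs_snd_add_cylVec_le w i).1),
                ih _ (hnbr _ (abs_snd_add_cylVec_le w i).2)⟩
          have habs : |((w.2 + 1 : ℤ) : ℝ) - j * N| + |((w.2 - 1 : ℤ) : ℝ) - j * N| =
              2 * |(w.2 : ℝ) - j * N| := by
            have h1 : |w.2 + 1 - j * N| + |w.2 - 1 - j * N| = 2 * |w.2 - j * N| := by
              rcases lt_or_gt_of_ne hs0 with h | h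
              · rw [abs_of_nonpos (by omega), abs_of_nonpos (by omega), abs_of_nonpos (by omega)]
                ring
              · rw [abs_of_nonneg (by omega), abs_of_nonneg (by omega), abs_of_nonneg (by omega)]
                ring
            exact_mod_cast h1
          have hval := nbrAvg_vertical (d := d) (N := N)
            (fun s => (d + 1) * ((R : ℝ) ^ 2 - ((s : ℝ) - j * N) ^ 2) +
              n * (|(s : ℝ) - j * N| / R)) w
          rw [hval] at havg
          have hrhs : (2 * d * ((d + 1) * ((R : ℝ) ^ 2 - ((w.2 : ℝ) - j * N) ^ 2) +
              n * (|(w.2 : ℝ) - j * N| / R)) +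
              ((d + 1) * ((R : ℝ) ^ 2 - (((w.2 + 1 : ℤ) : ℝ) - j * N) ^ 2) +
              n * (|((w.2 + 1 : ℤ) : ℝ) - j * N| / R)) +
              ((d + 1) * ((R : ℝ) ^ 2 - (((w.2 - 1 : ℤ) : ℝ) - j * N) ^ 2) +
              n * (|((w.2 - 1 : ℤ) : ℝ) - j * N| / R))) / (2 * (d + 1)) =
              (d + 1) * ((R : ℝ) ^ 2 - ((w.2 : ℝ) - j * N) ^ 2) - 1 +
                n * (|(w.2 : ℝ) - j * N| / R) := by
            have h2 : |((w.2 + 1 : ℤ) : ℝ) - j * N| =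
                2 * |(w.2 : ℝ) - j * N| - |((w.2 - 1 : ℤ) : ℝ) - j * N| := by linarith
            rw [h2]
            generalize |((w.2 - 1 : ℤ) : ℝ) - j * N| = q
            push_cast
            field_simp
            ring
          rw [hrhs] at havg
          have h3 : survProb (cylVec d N) (innerBlock d N j)ᶜ (n + 1) w =
              nbrAvg (cylVec d N) (survProb (cylVec d N) (innerBlock d N j)ᶜ n) w := by
            rw [survProb, if_pos hwB]
          have h4 := survProb_le_one (E := cylVec d N) (D := (innerBlock d N j)ᶜ) (n + 1) w
          have h5 : 0 ≤ |(w.2 : ℝ) - j * N| / R := by positivity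
          push_cast
          rw [h3] at *
          linarith
        · rw [survProb_of_notMem _ hwB]
          have h1 : ((w.2 : ℝ) - j * N) ^ 2 ≤ (R : ℝ) ^ 2 :=
            sq_le_sq' (abs_le.1 hw).1 (abs_le.1 hw).2
          have h2 : 0 ≤ (R : ℝ) ^ 2 - ((w.2 : ℝ) - j * N) ^ 2 := by linarith
          rw [mul_zero]
          positivity
      · have h1 := hfar (n + 1) w heq.ge
        have h2 : ((w.2 : ℝ) - j * N) ^ 2 = (R : ℝ) ^ 2 := by rw [← heq, sq_abs]
        rw [h2, sub_self, mul_zero, zero_add]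
        exact h1
  rcases le_total |(z.2 : ℝ) - j * N| R with h | h
  · refine (hnear n z h).trans ?_
    gcongr
    linarith [sq_nonneg ((z.2 : ℝ) - j * N)]
  · have h1 : 0 ≤ (d + 1) * (R : ℝ) ^ 2 := by positivity
    linarith [hfar n z h]

lemma tendsto_survProb_compl_innerBlock (j : ℤ) (z : Cylinder d N) :
    Tendsto (fun n => survProb (cylVec d N) (innerBlock d N j)ᶜ n z) atTop (nhds 0) := by
  rw [Metric.tendsto_atTop]
  intro ε hε
  obtain ⟨R, hR⟩ := exists_nat_gt (2 * |(z.2 : ℝ) - j * N| / ε)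
  have hR' : (0 : ℝ) < R := lt_of_le_of_lt (by positivity) hR
  obtain ⟨n₀, hn₀⟩ := exists_nat_gt (2 * ((d + 1) * (R : ℝ) ^ 2) / ε)
  refine ⟨n₀, fun n hn => ?_⟩
  have hn' : 2 * ((d + 1) * (R : ℝ) ^ 2) / ε < n := hn₀.trans_le (by exact_mod_cast hn)
  have hn0 : (0 : ℝ) < n := lt_of_le_of_lt (by positivity) hn'
  have h1 := mul_survProb_compl_innerBlock_le j (by exact_mod_cast hR' : 0 < R) n z
  rw [Real.dist_eq, sub_zero, abs_of_nonneg (survProb_nonneg n z)]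
  rw [div_lt_iff₀ hε] at hR hn'
  have h2 : |(z.2 : ℝ) - j * N| / R < ε / 2 := by
    rw [div_lt_iff₀ hR']
    linarith
  refine lt_of_mul_lt_mul_left ?_ hn0.le
  have h3 : (n : ℝ) * (|(z.2 : ℝ) - j * N| / R) ≤ n * (ε / 2) := by gcongr
  linarith

variable [NeZero N]

lemma lintegral_cylLaw (hN : 3 ≤ N) {f : (ℕ → Cylinder d N) → ENNReal} (hf : Measurable f) :
    ∫⁻ ω, f ω ∂cylLaw d N =
      (∑ z ∈ initialBlock d N, ∫⁻ ω, f ω ∂walkLaw (Measure.dirac z) (steps d N)) /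
        (initialBlock d N).card := by
  have := (isStepSet_steps d hN).isProbabilityMeasure
  rw [cylLaw, lintegral_walkLaw _ _ hf, ← coe_initialBlock, lintegral_uniformOn_finset]

/-- Needed because for an infinite departure time the condition `H_x ≤ D` holds even at points that
are never visited, and these would be counted as visited. -/
lemma ae_departure_lt_top (hN : 3 ≤ N) (j : ℤ) (k : ℕ) :
    ∀ᵐ ω ∂cylLaw d N, departure d N j k ω < ⊤ := by
  have hstep := isStepSet_steps d hN
  have hmeas : MeasurableSet {ω : ℕ → Cylinder d N | ¬departure d N j k ω < ⊤} := by
    simp only [departure_eq_excursionEnd]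
    exact (measurable_excursionEnd k (MeasurableSet.of_discrete (s := Set.Iio ⊤))).compl
  rw [ae_iff, ← one_mul (cylLaw d N _), ← lintegral_indicator_const hmeas,
    lintegral_cylLaw hN (measurable_const.indicator hmeas), ENNReal.div_eq_zero_iff]
  left
  refine Finset.sum_eq_zero fun z _ => ?_
  rw [lintegral_indicator_const hmeas, one_mul, ← ae_iff]
  filter_upwards [ae_exists_ge_notMem hstep (tendsto_survProb_compl_innerBlock j) z,
    ae_exists_ge_notMem hstep (tendsto_survProb_outerBlock j) z] with ω h1 h2
  rw [departure_eq_excursionEnd]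
  exact excursionEnd_lt_top h1 h2 k

end CylinderRecurrence

/-! ### Visited points -/

/-- Choosing the first visit to each point maps the visited points injectively to visit times. These
lie strictly before the departure, since the walk is then outside `B̃_j`, hence not in `A`. This
requires at least one excursion: at D_0 = 0 the walk may sit in `A`. -/
lemma exists_visited_le {d N : ℕ} (hN : 1 ≤ N) {j : ℤ} {A : Finset (Cylinder d N)}
    (hA : (A : Set (Cylinder d N)) ⊆ block d N j) {t : ℝ} (ht : 1 ≤ ⌊t⌋₊) {ω : ℕ → Cylinder d N}
    (hω : departure d N j ⌊t⌋₊ ω < ⊤) :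
    ∃ n, visited d N j A t ω ≤ visitsBefore (A : Set (Cylinder d N)) n
      (departure d N j ⌊t⌋₊ ω) ω := by
  classical
  obtain ⟨τ, hτ⟩ := WithTop.ne_top_iff_exists.1 hω.ne
  have hτ' : departure d N j ⌊t⌋₊ ω = (τ : ℕ∞) := hτ.symm
  refine ⟨τ, ?_⟩
  have hexit : ω τ ∉ outerBlock d N j := by
    obtain ⟨k, hk⟩ : ∃ k, ⌊t⌋₊ = k + 1 := ⟨⌊t⌋₊ - 1, by omega⟩
    rw [hk, departure] at hτ'
    exact (entranceFrom_eq_coe hτ').2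
  have hcard : visitsBefore (A : Set (Cylinder d N)) τ τ ω =
      ((Finset.range τ).filter fun i => ω i ∈ (A : Set (Cylinder d N)) ∧ (i : ℕ∞) < τ).card := by
    rw [visitsBefore, Finset.card_filter]
    exact Finset.sum_congr rfl fun i _ => by congr
  rw [hτ', visited, hcard, hτ', Finset.sum_boole, Nat.cast_le]
  refine (Finset.card_le_card ?_).trans (Finset.card_image_le (f := ω))
  intro x hx
  obtain ⟨hxA, hxτ⟩ := Finset.mem_filter.1 hx
  obtain ⟨i, hi⟩ := WithTop.ne_top_iff_exists.1 (lt_of_le_of_lt hxτ (ENat.natCast_lt_top τ)).ne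
  have hi' : entranceFrom {x} 0 ω = (i : ℕ∞) := hi.symm
  have hxi : ω i = x := (entranceFrom_eq_coe hi').2
  rw [hi'] at hxτ
  have hiτ : i ≤ τ := by exact_mod_cast hxτ
  have hne : i ≠ τ := by
    rintro rfl
    rw [hxi] at hexit
    exact hexit (innerBlock_subset_outerBlock hN (block_subset_innerBlock (hA hxA)))
  have hlt : i < τ := lt_of_le_of_ne hiτ hne
  refine Finset.mem_image.2 ⟨i, Finset.mem_filter.2 ⟨Finset.mem_range.2 hlt, ?_, ?_⟩, hxi⟩
  · rw [hxi]
    exact hxA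
  · exact_mod_cast hlt

lemma visited_eq_card_of_coversBy {d N : ℕ} {j : ℤ} {A : Finset (Cylinder d N)} {t : ℝ}
    {ω : ℕ → Cylinder d N} (hω : ω ∈ coversBy d N j A t) : visited d N j A t ω = A.card := by
  classical
  have h : ∀ x ∈ A, entranceFrom {x} 0 ω ≤ departure d N j ⌊t⌋₊ ω := by
    intro x hx
    obtain ⟨n, hn, hnx⟩ := hω x hx
    exact (entranceFrom_le (by simp) hnx).trans hn
  rw [visited, Finset.sum_congr rfl fun x hx => if_pos (h x hx)]
  simp

/-! ### The exponential moment -/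

/-- The constant in the exponential moment bound. -/
noncomputable def momentConst (d : ℕ) : ℝ := (d + 1) * (3 * freqConst d + 6)

lemma momentConst_pos (d : ℕ) : 0 < momentConst d := by
  have := freqConst_pos d
  unfold momentConst
  positivity

/-- Heights change by at most one per step, so `B_j` is entered through its top or bottom layer. -/
lemma entrance_height {d N : ℕ} {j : ℤ} {z x : Cylinder d N} (hz : z ∉ innerBlock d N j)
    (hx : x ∈ innerBlock d N j) (hxz : |x.2 - z.2| ≤ 1) : |x.2 - j * N| = N := by
  obtain ⟨h1, h2⟩ := hx
  have h3 : ¬((j - 1) * N ≤ z.2 ∧ z.2 ≤ (j + 1) * N) := hz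
  rw [sub_mul, one_mul] at h1 h3
  rw [add_mul, one_mul] at h2 h3
  rw [abs_le] at hxz
  generalize j * (N : ℤ) = a at *
  rw [abs_eq (by omega)]
  omega

/-- A first excursion begun at time zero can start next to `A`; its hitting probability is
controlled only after averaging over the starting point. All later entrances obey the uniform bound
η. -/
lemma lintegral_visitWeight_cylLaw_le {d N : ℕ} (hd : 0 < d) (hN : 3 ≤ N) {j : ℤ}
    {A : Finset (Cylinder d N)} (hA : (A : Set (Cylinder d N)) ⊆ block d N j) {lam ρ : ℝ}
    (hlam : 0 ≤ lam) (hρ : Real.exp lam * ρ < 1)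
    (hret : ∀ z ∈ (A : Set (Cylinder d N)), ∀ n,
      nbrAvg (cylVec d N) (hitProb (cylVec d N) (outerBlock d N j) A n) z ≤ ρ) (n k : ℕ) :
    ∫⁻ ω, visitWeight lam (A : Set (Cylinder d N)) n (departure d N j (k + 1) ω) ω ∂cylLaw d N ≤
      ENNReal.ofReal (Real.exp ((k + 1 : ℕ) *
        (excursionFactor lam ρ * (A.card * (momentConst d * (N / (N : ℝ) ^ d)))))) := by
  classical
  have : NeZero N := ⟨by omega⟩
  have hN0 : (0 : ℝ) < N := by exact_mod_cast Nat.pos_of_ne_zero (NeZero.ne N)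
  have hfc := freqConst_pos d
  set η : ℝ := A.card * ((d + 1) * (2 * freqConst d + 3) * (N / (N : ℝ) ^ d)) with hη
  have hη0 : 0 ≤ η := by positivity
  have hgam : 0 ≤ excursionFactor lam ρ := excursionFactor_nonneg hlam hρ
  set gam := excursionFactor lam ρ with hgam_def
  have hmom := (lintegral_visitWeight_le (isStepSet_steps d hN)
    (hA.trans block_subset_innerBlock) (innerBlock_subset_outerBlock (by omega)) hlam hρ hη0 hret
    (fun z hz i n => ⟨fun h => hitProb_le_of_far hd hA n
        (entrance_height hz h (abs_snd_add_cylVec_le z i).1),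
      fun h => hitProb_le_of_far hd hA n
        (entrance_height hz h (abs_snd_add_cylVec_le z i).2)⟩) n).2 (k + 1)
  rw [← hgam_def] at hmom
  set W : ℝ := 1 + gam * η with hW
  have hW1 : 1 ≤ W := by
    have := mul_nonneg hgam hη0
    linarith
  simp only [departure_eq_excursionEnd]
  rw [lintegral_cylLaw hN (measurable_visitWeight lam _ n (measurable_excursionEnd (k + 1)))]
  have hcard : (0 : ℝ) < (initialBlock d N).card := by
    rw [card_initialBlock]
    positivity
  set h : Cylinder d N → ℝ := hitProb (cylVec d N) (outerBlock d N j) A n with hh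
  have hout : ∀ z, outsideBound (cylVec d N) A (innerBlock d N j) (outerBlock d N j) gam W n
      (k + 1) z ≤ W ^ k * W + W ^ k * gam * (if z ∈ innerBlock d N j then h z else 0) := by
    intro z
    have h0 : 0 ≤ W ^ k := by positivity
    simp only [outsideBound]
    split_ifs
    · have : (1 + gam * h z) * W ^ k ≤ (W + gam * h z) * W ^ k := by gcongr
      linarith
    · rw [pow_succ]
      linarith
  have hout0 : ∀ z, 0 ≤ W ^ k * W + W ^ k * gam * (if z ∈ innerBlock d N j then h z else 0) := by
    intro z
    have h1 : 0 ≤ h z := hitProb_nonneg n z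
    split_ifs <;> positivity
  calc (∑ z ∈ initialBlock d N, ∫⁻ ω, visitWeight lam (A : Set (Cylinder d N)) n
        (excursionEnd (innerBlock d N j) (outerBlock d N j) (k + 1) ω) ω
          ∂walkLaw (Measure.dirac z) (steps d N)) / (initialBlock d N).card
      ≤ (∑ z ∈ initialBlock d N, ENNReal.ofReal
          (W ^ k * W + W ^ k * gam * (if z ∈ innerBlock d N j then h z else 0))) /
            (initialBlock d N).card := by
        gcongr with z
        exact (hmom z).trans (ENNReal.ofReal_le_ofReal (hout z))
    _ = ENNReal.ofReal ((∑ z ∈ initialBlock d N,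
          (W ^ k * W + W ^ k * gam * (if z ∈ innerBlock d N j then h z else 0))) /
            (initialBlock d N).card) := by
        rw [ENNReal.ofReal_div_of_pos hcard, ENNReal.ofReal_sum_of_nonneg fun z _ => hout0 z,
          ENNReal.ofReal_natCast]
    _ ≤ _ := by
        refine ENNReal.ofReal_le_ofReal ?_
        set H : ℝ := A.card * ((d + 1) * (freqConst d + 3) * (N / (N : ℝ) ^ d)) with hH
        have hH0 : 0 ≤ H := by positivity
        have hsum := sum_hitProb_le hd hA n
        rw [← hH, ← hh] at hsum
        have h1 : (∑ z ∈ initialBlock d N,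
            (W ^ k * W + W ^ k * gam * (if z ∈ innerBlock d N j then h z else 0))) /
            (initialBlock d N).card ≤ W ^ k * (W + gam * H) := by
          rw [div_le_iff₀ hcard, Finset.sum_add_distrib, Finset.sum_const, nsmul_eq_mul,
            ← Finset.mul_sum]
          have h2 := mul_le_mul_of_nonneg_left hsum
            (mul_nonneg (show 0 ≤ W ^ k by positivity) hgam)
          linarith
        -- `momentConst` is the sum of the constants for entrances, 2c + 3, and for the averaged
        -- start, c + 3, with c = `freqConst d`, times d + 1.
        have hX : gam * (A.card * (momentConst d * (N / (N : ℝ) ^ d))) = gam * η + gam * H := by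
          rw [hη, hH, momentConst]
          ring
        rw [hX, Real.exp_nat_mul]
        refine h1.trans ?_
        have h3 := Real.add_one_le_exp (gam * η + gam * H)
        have h4 : 0 ≤ gam * H := mul_nonneg hgam hH0
        have h5 : W ≤ Real.exp (gam * η + gam * H) := by linarith
        have h6 : W + gam * H ≤ Real.exp (gam * η + gam * H) := by linarith
        rw [pow_succ]
        gcongr

/-- The moment bound for admissible sets, uniform in the number of excursions. -/
lemma exists_lintegral_iSup_visitWeight_le {d m : ℕ} (hd : 3 ≤ d) (hm : m ≤ d - 2) {lam : ℝ}
    (hlam : 0 < lam) (hchi : chi d m lam < 1) :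
    ∃ N₀ : ℕ, 3 ≤ N₀ ∧ ∀ N : ℕ, N₀ ≤ N → ∀ j : ℤ, ∀ A ∈ admissible d N m j, ∀ u : ℝ,
      1 ≤ ⌊u * (N : ℝ) ^ (d - 1)⌋₊ →
      ∫⁻ ω, ⨆ n, visitWeight lam (A : Set (Cylinder d N)) n
          (departure d N j ⌊u * (N : ℝ) ^ (d - 1)⌋₊ ω) ω ∂cylLaw d N ≤
        ENNReal.ofReal (Real.exp (2 * momentConst d * u *
          ((Real.exp lam - 1) / (1 - chi d m lam)) * A.card)) := by
  have hexp := Real.exp_pos lam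
  -- Chosen so that 1 - e^λ ρ is half of 1 - χ(λ), which is the source of the factor 2 in the final
  -- constant.
  set ε : ℝ := (1 - chi d m lam) / (2 * Real.exp lam) with hε
  have hε0 : 0 < ε := div_pos (by linarith) (by positivity)
  obtain ⟨N₀, hN₀⟩ := exists_nbrAvg_hitProb_le hd hm hε0
  refine ⟨max 3 N₀, le_max_left _ _, fun N hN j A hA u hu => ?_⟩
  have hN3 : 3 ≤ N := (le_max_left _ _).trans hN
  have : NeZero N := ⟨by omega⟩
  have hN0 : (0 : ℝ) < N := by exact_mod_cast Nat.pos_of_ne_zero (NeZero.ne N)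
  obtain ⟨-, hAblock, F, hF, hAF⟩ := hA
  have hchi_eq : Real.exp lam * (sectionReturn d m + ε) = (1 + chi d m lam) / 2 := by
    have h1 : Real.exp lam * sectionReturn d m = chi d m lam := rfl
    rw [mul_add, h1, hε]
    field_simp
    ring
  have hρ : Real.exp lam * (sectionReturn d m + ε) < 1 := by
    rw [hchi_eq]
    linarith
  have hfactor : excursionFactor lam (sectionReturn d m + ε) =
      2 * ((Real.exp lam - 1) / (1 - chi d m lam)) := by
    have h1 : 1 - chi d m lam ≠ 0 := by linarith
    have h2 : 1 - (1 + chi d m lam) / 2 = (1 - chi d m lam) / 2 := by ring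
    rw [excursionFactor, hchi_eq, h2]
    field_simp
  have hret : ∀ z ∈ (A : Set (Cylinder d N)), ∀ n,
      nbrAvg (cylVec d N) (hitProb (cylVec d N) (outerBlock d N j) A n) z ≤
        sectionReturn d m + ε := fun z hz n =>
    (nbrAvg_mono (hitProb_mono_set hAF n)).trans
      (hN₀ N ((le_max_right _ _).trans hN) j F hF z (hAF hz) n)
  obtain ⟨k, hk⟩ : ∃ k, ⌊u * (N : ℝ) ^ (d - 1)⌋₊ = k + 1 :=
    ⟨⌊u * (N : ℝ) ^ (d - 1)⌋₊ - 1, by omega⟩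
  -- Monotone convergence removes the time horizon `n`; the bounds do not depend on it.
  rw [lintegral_iSup]
  · refine iSup_le fun n => ?_
    rw [hk]
    refine (lintegral_visitWeight_cylLaw_le (by omega) hN3 hAblock hlam.le hρ hret n k).trans ?_
    refine ENNReal.ofReal_le_ofReal (Real.exp_le_exp.2 ?_)
    have hg : 0 ≤ (Real.exp lam - 1) / (1 - chi d m lam) :=
      div_nonneg (by linarith [Real.add_one_le_exp lam]) (by linarith)
    have hkN : ((k + 1 : ℕ) : ℝ) * (N / (N : ℝ) ^ d) ≤ u := by
      have h1 : ((k + 1 : ℕ) : ℝ) ≤ u * (N : ℝ) ^ (d - 1) := by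
        rw [← hk]
        refine Nat.floor_le ?_
        by_contra! hneg
        rw [Nat.floor_of_nonpos hneg.le] at hu
        omega
      have h2 : (N : ℝ) ^ d = (N : ℝ) ^ (d - 1) * N := by
        rw [← pow_succ]
        congr 1
        omega
      calc ((k + 1 : ℕ) : ℝ) * (N / (N : ℝ) ^ d)
          ≤ u * (N : ℝ) ^ (d - 1) * (N / (N : ℝ) ^ d) := by gcongr
        _ = u := by
          rw [h2]
          field_simp
    have hmc := momentConst_pos d
    rw [hfactor]
    calc ((k + 1 : ℕ) : ℝ) * (2 * ((Real.exp lam - 1) / (1 - chi d m lam)) *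
          (A.card * (momentConst d * (N / (N : ℝ) ^ d))))
        = 2 * momentConst d * (((k + 1 : ℕ) : ℝ) * (N / (N : ℝ) ^ d)) *
          ((Real.exp lam - 1) / (1 - chi d m lam)) * A.card := by ring
      _ ≤ _ := by gcongr
  · intro n
    simp only [departure_eq_excursionEnd]
    exact measurable_visitWeight lam _ n (measurable_excursionEnd _)
  · intro n n' hnn' ω
    have h1 := visitsBefore_mono (A : Set (Cylinder d N))
      (departure d N j ⌊u * (N : ℝ) ^ (d - 1)⌋₊ ω) ω hnn'
    exact ENNReal.ofReal_le_ofReal (Real.exp_le_exp.2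
      (mul_le_mul_of_nonneg_left (Nat.cast_le.2 h1) hlam.le))

end CylinderWalk

/-! ### The moment bound and the covering estimate. -/

open CylinderWalk in
theorem theorem1p2 (d : ℕ) (hd : 3 ≤ d) :
    ∃ c : ℝ, 0 < c ∧
      ∀ m : ℕ, 1 ≤ m → m ≤ d - 2 →
      ∀ lam : ℝ, 0 < lam → CylinderWalk.chi d m lam < 1 →
        (∀ u : ℝ, 0 < u →
          limsup (fun N : ℕ => ⨆ (j : ℤ), ⨆ A ∈ CylinderWalk.admissible d N m j,
              ((((A.card : ℝ)⁻¹ * Real.log (∫ ω,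
                Real.exp (lam * CylinderWalk.visited d N j A (u * (N : ℝ) ^ (d - 1)) ω)
                  ∂(CylinderWalk.cylLaw d N))) : ℝ) : EReal)) atTop
            ≤ ((c * u * ((Real.exp lam - 1) / (1 - CylinderWalk.chi d m lam)) : ℝ) : EReal)) ∧
        ∃ N₁ : ℕ, 0 < N₁ ∧ ∃ u₁ : ℝ, 0 < u₁ ∧
          ∀ N : ℕ, N₁ ≤ N → ∀ j : ℤ, ∀ A ∈ CylinderWalk.admissible d N m j,
            (CylinderWalk.cylLaw d N).real
                (CylinderWalk.coversBy d N j A (u₁ * (N : ℝ) ^ (d - 1)))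
              ≤ Real.exp (-(lam * A.card)) := by
  have hmc := momentConst_pos d
  -- For large N at least one excursion is completed, since d - 1 ≥ 1; the comparison of visited
  -- points with visits needs this.
  have hfloor : ∀ u : ℝ, 0 < u → ∃ N₀ : ℕ, ∀ N : ℕ, N₀ ≤ N → 1 ≤ ⌊u * (N : ℝ) ^ (d - 1)⌋₊ := by
    intro u hu
    obtain ⟨N₀, hN₀⟩ := exists_nat_gt (1 / u)
    refine ⟨N₀ + 1, fun N hN => Nat.le_floor ?_⟩
    have h1 : 1 / u < N := hN₀.trans_le (by exact_mod_cast (by omega : N₀ ≤ N))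
    have h2 : (1 : ℝ) ≤ N := by exact_mod_cast (by omega : 1 ≤ N)
    have h3 : (N : ℝ) ≤ (N : ℝ) ^ (d - 1) := le_self_pow₀ h2 (by omega)
    rw [div_lt_iff₀ hu] at h1
    push_cast
    nlinarith
  refine ⟨2 * momentConst d, by positivity, fun m _ hm lam hlam hchi => ⟨fun u hu => ?_, ?_⟩⟩
  · obtain ⟨N₀, hN₀3, hN₀⟩ := exists_lintegral_iSup_visitWeight_le hd hm hlam hchi
    obtain ⟨N₂, hN₂⟩ := hfloor u hu
    refine limsup_le_of_le (by isBoundedDefault) ?_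
    filter_upwards [eventually_ge_atTop (max N₀ N₂)] with N hN
    refine iSup_le fun j => iSup₂_le fun A hA => EReal.coe_le_coe_iff.2 ?_
    have hk := hN₂ N ((le_max_right _ _).trans hN)
    have hbound := hN₀ N ((le_max_left _ _).trans hN) j A hA u hk
    have hN3 : 3 ≤ N := hN₀3.trans ((le_max_left _ _).trans hN)
    have : NeZero N := ⟨by omega⟩
    have hcard : (0 : ℝ) < A.card := by exact_mod_cast hA.1.card_pos
    have hg : 0 ≤ (Real.exp lam - 1) / (1 - chi d m lam) :=
      div_nonneg (by linarith [Real.add_one_le_exp lam]) (by linarith)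
    have hint : ∫ ω, Real.exp (lam * visited d N j A (u * (N : ℝ) ^ (d - 1)) ω) ∂cylLaw d N ≤
        Real.exp (2 * momentConst d * u * ((Real.exp lam - 1) / (1 - chi d m lam)) * A.card) := by
      -- Measurability need not be proved: otherwise the Bochner integral is zero by convention and
      -- the bound is trivial.
      by_cases hmeas : AEStronglyMeasurable
          (fun ω => Real.exp (lam * visited d N j A (u * (N : ℝ) ^ (d - 1)) ω)) (cylLaw d N)
      · rw [integral_eq_lintegral_of_nonneg_ae
          (Eventually.of_forall fun ω => (Real.exp_pos _).le) hmeas]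
        refine ENNReal.toReal_le_of_le_ofReal (Real.exp_pos _).le (le_trans ?_ hbound)
        refine lintegral_mono_ae ?_
        filter_upwards [ae_departure_lt_top hN3 j ⌊u * (N : ℝ) ^ (d - 1)⌋₊] with ω hω
        obtain ⟨n, hn⟩ := exists_visited_le (by omega) hA.2.1 hk hω
        refine le_trans ?_ (le_iSup _ n)
        unfold visitWeight
        gcongr
      · rw [integral_non_aestronglyMeasurable hmeas]
        exact (Real.exp_pos _).le
    have hint0 : 0 ≤ ∫ ω, Real.exp (lam * visited d N j A (u * (N : ℝ) ^ (d - 1)) ω)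
        ∂cylLaw d N := integral_nonneg fun ω => (Real.exp_pos _).le
    have hlog : Real.log (∫ ω, Real.exp (lam * visited d N j A (u * (N : ℝ) ^ (d - 1)) ω)
        ∂cylLaw d N) ≤
        2 * momentConst d * u * ((Real.exp lam - 1) / (1 - chi d m lam)) * A.card := by
      -- If the integral is zero, so is its logarithm by convention, and the right-hand side is
      -- non-negative.
      rcases hint0.eq_or_lt with h0 | h0
      · rw [← h0, Real.log_zero]
        positivity
      · exact (Real.log_le_iff_le_exp h0).2 hint
    rw [inv_mul_le_iff₀ hcard]
    linarith
  · have hcont : Continuous fun l => chi d m l := by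
      unfold chi
      fun_prop
    -- χ is continuous and χ(λ) < 1 is an open condition, so there is room for a larger exponent;
    -- the gain e^(-(λ' - λ)|A|) will absorb the moment.
    obtain ⟨lam', hchi', hlam'⟩ : ∃ lam', chi d m lam' < 1 ∧ lam < lam' :=
      (((hcont.tendsto lam).eventually_lt_const hchi).filter_mono
        (nhdsWithin_le_nhds (s := Set.Ioi lam)) |>.and self_mem_nhdsWithin).exists
    obtain ⟨N₀, hN₀3, hN₀⟩ :=
      exists_lintegral_iSup_visitWeight_le hd hm (hlam.trans hlam') hchi'
    set g : ℝ := (Real.exp lam' - 1) / (1 - chi d m lam') with hg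
    have hg0 : 0 < g :=
      div_pos (by linarith [Real.add_one_le_exp lam']) (by linarith)
    -- Makes the exponent 2 · `momentConst d` · u · g of the moment bound equal to λ' - λ per point
    -- of `A`.
    set u : ℝ := (lam' - lam) / (2 * momentConst d * g) with hu
    have hu0 : 0 < u := div_pos (by linarith) (by positivity)
    obtain ⟨N₂, hN₂⟩ := hfloor u hu0
    refine ⟨max N₀ N₂, by omega, u, hu0, fun N hN j A hA => ?_⟩
    have hk := hN₂ N ((le_max_right _ _).trans hN)
    have hbound := hN₀ N ((le_max_left _ _).trans hN) j A hA u hk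
    have hN3 : 3 ≤ N := hN₀3.trans ((le_max_left _ _).trans hN)
    have : NeZero N := ⟨by omega⟩
    have hug : 2 * momentConst d * u * g * A.card = (lam' - lam) * A.card := by
      rw [hu]
      field_simp
    rw [hug] at hbound
    have hmeas : Measurable fun ω : ℕ → Cylinder d N =>
        ⨆ n, visitWeight lam' (A : Set (Cylinder d N)) n
          (departure d N j ⌊u * (N : ℝ) ^ (d - 1)⌋₊ ω) ω := by
      simp only [departure_eq_excursionEnd]
      exact Measurable.iSup fun n => measurable_visitWeight lam' _ n (measurable_excursionEnd _)
    have hmarkov := mul_meas_ge_le_lintegral (μ := cylLaw d N) hmeas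
      (ENNReal.ofReal (Real.exp (lam' * A.card)))
    have hcover : cylLaw d N (coversBy d N j A (u * (N : ℝ) ^ (d - 1))) ≤
        cylLaw d N {ω | ENNReal.ofReal (Real.exp (lam' * A.card)) ≤
          ⨆ n, visitWeight lam' (A : Set (Cylinder d N)) n
            (departure d N j ⌊u * (N : ℝ) ^ (d - 1)⌋₊ ω) ω} := by
      refine measure_mono_ae ?_
      filter_upwards [ae_departure_lt_top hN3 j ⌊u * (N : ℝ) ^ (d - 1)⌋₊] with ω hω hcov
      obtain ⟨n, hn⟩ := exists_visited_le (by omega) hA.2.1 hk hω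
      rw [visited_eq_card_of_coversBy hcov] at hn
      refine le_trans ?_ (le_iSup _ n)
      unfold visitWeight
      have := hlam.trans hlam'
      gcongr
    refine ENNReal.toReal_le_of_le_ofReal (Real.exp_pos _).le (hcover.trans ?_)
    have h1 := hmarkov.trans hbound
    have h2 : ENNReal.ofReal (Real.exp ((lam' - lam) * A.card)) =
        ENNReal.ofReal (Real.exp (lam' * A.card)) *
          ENNReal.ofReal (Real.exp (-(lam * A.card))) := by
      rw [← ENNReal.ofReal_mul (Real.exp_pos _).le, ← Real.exp_add]
      congr 2
      ring
    rw [h2] at h1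
    exact (ENNReal.mul_le_mul_iff_right
      (by simpa using Real.exp_pos _) ENNReal.ofReal_ne_top).1 h1
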